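/- **Setting.** Let $N,L,D\ge 1$, $\tau\ge 0$, $\nu=1+\tau^2$. A prompt consists of tokens $(x_i,y_i)_{i=1}^{L+1}$ with $x_i$ i.i.d. uniform on the unit sphere of $\mathbb R^D$ and $y_i=w^\top x_i+e_i$, where $w\sim\mathcal N(0,I_D)$ and $e_i$ i.i.d. $\mathcal N(0,\tau^2)$, all independent (a new $w$ for every prompt). Put $Z=\frac1L x_{L+1}\sum_{i=1}^L y_i x_i^\top\in\mathbb R^{D\times D}$. There are $N$ i.i.d. training prompts (tokens $x_{k,i},y_{k,i}$, matrices $Z_k$, $k\le N$) and an independent test prompt with matrix $Z$. Let $\langle\cdot,\cdot\rangle$ be the Frobenius inner product and $$\operatorname{vec}(\Gamma^\star)=\Big(\lambda N I+\sum_{k=1}^N \operatorname{vec}(Z_k)\operatorname{vec}(Z_k)^\top\Big)^{-1}\sum_{k=1}^N y_{k,L+1}\operatorname{vec}(Z_k)$$ the ridge estimator. Let $\mathrm{clip}_{\mathcal C}$ be the projection of $\mathbb R$ onto $[-\mathcal C,\mathcal C]$ and $\Pi_R$ the projection of $\mathbb R^{D\times D}$ onto the Frobenius ball of radius $R$. The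 algorithm NoisyHead sets $\widetilde Z_k=\Pi_G\big(L^{-1}x_{k,L+1}\sum_{i\le L}\mathrm{clip}_{\mathcal C}(y_{k,i})x_{k,i}^\top\big)$, starts at a fixed $\Gamma^0$ with $\|\Gamma^0\|_F\le R$, iterates $$\Gamma^{t+1}=\Pi_R\Big((1-2\lambda\eta_0)\Gamma^t-\tfrac{\eta_0}{N}\sum_{k=1}^N\big(\langle\Gamma^t,\widetilde Z_k\rangle-\mathrm{clip}_{\mathcal C}(y_{k,L+1})\big)\widetilde Z_k+z_t\Big),\qquad 0\le t<T,$$ where the $z_t$ are independent of each other and of the prompts and have i.i.d. $\mathcal N\big(0,2\eta_0^2\frac{T^2\sigma^2}{\varepsilon^2N^2}\log\frac{1.25T}{\delta}\big)$ entries, and returns $\hat\Gamma=\Gamma^T$. **Hyperparameters.** Fix $K\ge 1$, $c>1$ and $\delta_1<1$, and write $a\asymp b$ for $K^{-1}b\le a\le Kb$. Assume $N\asymp L^2$, $N\asymp D^2$, $\lambda\asymp N/D$, $\kappa\in(0,1)$ with $\kappa\ge K^{-1}(NL)^{-1}$, and $$\mathcal C=\sqrt{2\nu\log(NL/\kappa)},\quad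 G=\frac{\mathcal C}{\sqrt L}\Big(1+\frac{\sqrt{\log(N/\kappa)}}{D}\Big),\quad R\asymp\lambda^{-1}\mathcal C^2\sqrt{\frac NL}\Big(1+\frac{\sqrt{\log(1/\kappa)}}{D}\Big),\quad \sigma\asymp 2G(\mathcal C+RG),$$ $$\eta_0\in\Big(\frac{\lambda}{c(2\lambda+G^2)^2},\frac{\lambda}{(2\lambda+G^2)^2}\Big),\qquad \varepsilon>0,\quad \delta\in(0,\delta_1].$$ Let $r>1$ be such that $T=\frac{\log r}{\log((1-\eta_0\lambda)^{-1})}$ is a positive integer. **Claim.** There are constants $C,c_2>0$ depending only on $K,c,\delta_1$, and for each $\tau$ constants $c_1>0$ and $N_0$ depending only on $K,c,\delta_1,\tau$, such that for all parameters as above the following hold. 1. If $\varepsilon\le K$ or $r\le KN$, then with probability at least $1-c_1e^{-c_2D}-4\kappa$, $$\big(\langle\hat\Gamma,Z\rangle-\langle\Gamma^\star,Z\rangle\big)^2\le C\,\nu^5\log^3(NL)\,\frac{D^2}{NL^2r}\Big(1+r\log^3 r\cdot\frac{D}{N^3}\cdot\frac{\log(1/\delta)}{\varepsilon^2}\Big).$$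 2. In particular, suppose $r\asymp N$. Then $C^{-1}\log N\le T\le C\log N$ whenever $N\ge N_0$; and if $\frac{\log(1/\delta)}{\varepsilon^2}\log^3N\le K N^{3/2}$ (which holds, for suitable $K$, whenever $\varepsilon,\delta$ are fixed), then with probability at least $1-c_1e^{-c_2D}-4\kappa$, $$\big(\langle\hat\Gamma,Z\rangle-\langle\Gamma^\star,Z\rangle\big)^2\le C\,\nu^5\log^3(NL)\,\frac{D^2}{N^2L^2}.$$ -/

import Mathlib

open MeasureTheory ProbabilityTheory

namespace NoisyHead

/-- Column vectors in `ℝ^D` with the Euclidean norm. -/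
abbrev Vec (D : ℕ) : Type := EuclideanSpace ℝ (Fin D)

/-- Real `D × D` matrices with the Frobenius inner product and the Frobenius norm. -/
abbrev Mat (D : ℕ) : Type := EuclideanSpace ℝ (Fin D × Fin D)

/-- The rank-one matrix `u vᵀ`. -/
noncomputable def outer {D : ℕ} (u v : Vec D) : Mat D :=
  WithLp.toLp 2 fun p => u p.1 * v p.2

/-- A prompt with its query response: covariates `x_1, …, x_{L+1}` and responses
`y_1, …, y_{L+1}`. The last token is the query token. -/
abbrev Prompt (L D : ℕ) : Type := (Fin (L + 1) → Vec D) × (Fin (L + 1) → ℝ)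

/-- The response of the query token. -/
def queryResponse {L D : ℕ} (E : Prompt L D) : ℝ := E.2 (Fin.last L)

/-- `clip_B(t)`: the point of `[-B, B]` nearest to `t` (for `B ≥ 0`, see `clip_nearest`). -/
noncomputable def clip (B t : ℝ) : ℝ := max (-B) (min t B)

/-- `Π_R(X)`: the point of the Frobenius ball of radius `R` nearest to `X`
(for `R ≥ 0`, see `proj_nearest`). -/
noncomputable def proj {D : ℕ} (R : ℝ) (X : Mat D) : Mat D := min 1 (R / ‖X‖) • X

theorem clip_nearest {B : ℝ} (hB : 0 ≤ B) (t : ℝ) :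
    clip B t ∈ Set.Icc (-B) B ∧ ∀ y ∈ Set.Icc (-B) B, |t - clip B t| ≤ |t - y| := by
  unfold clip
  refine ⟨⟨le_max_left _ _, max_le (by linarith) (min_le_right _ _)⟩, ?_⟩
  rintro y ⟨h1, h2⟩
  rcases le_total t B with h | h
  · rcases le_total (-B) t with h' | h'
    · simp [h, h']
    · rw [min_eq_left h, max_eq_left h', abs_of_nonpos (by linarith), abs_of_nonpos (by linarith)]
      linarith
  · rw [min_eq_right h, max_eq_right (by linarith), abs_of_nonneg (by linarith),
      abs_of_nonneg (by linarith)]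
    linarith

theorem proj_nearest {D : ℕ} {R : ℝ} (hR : 0 ≤ R) (X : Mat D) :
    ‖proj R X‖ ≤ R ∧ ∀ Y : Mat D, ‖Y‖ ≤ R → ‖X - proj R X‖ ≤ ‖X - Y‖ := by
  unfold proj
  rcases eq_or_ne X 0 with rfl | hX
  · simp [hR]
  have hpos : 0 < ‖X‖ := norm_pos_iff.mpr hX
  rcases le_total ‖X‖ R with h | h
  · have h1 : min 1 (R / ‖X‖) = 1 := min_eq_left ((one_le_div hpos).mpr h)
    simp [h1, h]
  · have h1 : min 1 (R / ‖X‖) = R / ‖X‖ := min_eq_right ((div_le_one hpos).mpr h)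
    rw [h1]
    refine ⟨?_, fun Y hY => ?_⟩
    · rw [norm_smul, Real.norm_of_nonneg (by positivity), div_mul_cancel₀ _ hpos.ne']
    · have h2 : X - (R / ‖X‖) • X = (1 - R / ‖X‖) • X := by rw [sub_smul, one_smul]
      have h3 : 0 ≤ 1 - R / ‖X‖ := sub_nonneg.mpr ((div_le_one hpos).mpr h)
      rw [h2, norm_smul, Real.norm_of_nonneg h3, sub_mul, one_mul, div_mul_cancel₀ _ hpos.ne']
      have := norm_sub_norm_le X Y
      linarith

/-- `Z = L⁻¹ x_{L+1} ∑_{i ≤ L} y_i x_iᵀ`. -/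
noncomputable def feature {L D : ℕ} (E : Prompt L D) : Mat D :=
  (L : ℝ)⁻¹ • outer (E.1 (Fin.last L)) (∑ i : Fin L, E.2 i.castSucc • E.1 i.castSucc)

/-- `Z̃ = Π_G (L⁻¹ x_{L+1} ∑_{i ≤ L} clip_B(y_i) x_iᵀ)`. -/
noncomputable def clippedFeature {L D : ℕ} (B G : ℝ) (E : Prompt L D) : Mat D :=
  proj G ((L : ℝ)⁻¹ •
    outer (E.1 (Fin.last L)) (∑ i : Fin L, clip B (E.2 i.castSucc) • E.1 i.castSucc))

/-- The ridge estimator: `(λ N I + ∑_k vec(Z_k) vec(Z_k)ᵀ)⁻¹ ∑_k y_{k,L+1} vec(Z_k)`. -/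
noncomputable def ridge {N L D : ℕ} (lam : ℝ) (E : Fin N → Prompt L D) : Mat D :=
  WithLp.toLp 2
    (((lam * N) • (1 : Matrix (Fin D × Fin D) (Fin D × Fin D) ℝ)
        + ∑ k, Matrix.vecMulVec (feature (E k)).ofLp (feature (E k)).ofLp)⁻¹.mulVec
      (∑ k, queryResponse (E k) • (feature (E k)).ofLp))

/-- One update of the private algorithm, from the iterate `Γ` with injected noise `z`. -/
noncomputable def step {N L D : ℕ} (B G R lam η₀ : ℝ) (E : Fin N → Prompt L D)
    (Γ z : Mat D) : Mat D :=
  proj R ((1 - 2 * lam * η₀) • Γ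
    - (η₀ * (N : ℝ)⁻¹) • ∑ k, (inner ℝ Γ (clippedFeature B G (E k))
        - clip B (queryResponse (E k))) • clippedFeature B G (E k)
    + z)

/-- The output `Γ^T` of the private algorithm after `T` updates from the initialization `Γ₀`,
where `z t` is the noise injected in update `t`. -/
noncomputable def noisyHead {N L D T : ℕ} (B G R lam η₀ : ℝ) (Γ₀ : Mat D)
    (E : Fin N → Prompt L D) (z : Fin T → Mat D) : Mat D :=
  Fin.foldl T (fun Γ t => step B G R lam η₀ E Γ (z t)) Γ₀

/-- The uniform distribution on the unit sphere of `ℝ^D` (normalized surface measure), as a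
measure on `ℝ^D`. -/
noncomputable def uniformSphere (D : ℕ) : Measure (Vec D) :=
  ((volume : Measure (Vec D)).toSphere Set.univ)⁻¹ •
    (volume : Measure (Vec D)).toSphere.map Subtype.val

theorem isProbabilityMeasure_uniformSphere {D : ℕ} (hD : 0 < D) :
    IsProbabilityMeasure (uniformSphere D) := by
  constructor
  have : Nonempty (Fin D) := ⟨⟨0, hD⟩⟩
  rw [uniformSphere, Measure.smul_apply, Measure.map_apply measurable_subtype_coe .univ,
    Set.preimage_univ, smul_eq_mul]
  refine ENNReal.inv_mul_cancel ?_ (measure_ne_top _ _)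
  rw [Measure.toSphere_apply_univ]
  refine mul_ne_zero (by simpa using hD.ne') (Metric.measure_ball_pos _ _ one_pos).ne'

/-- The law of a prompt: `x_i` i.i.d. uniform on the unit sphere, `w ∼ N(0, I_D)`,
`e_i` i.i.d. `N(0, τ²)`, all independent, and `y_i = ⟨w, x_i⟩ + e_i`. -/
noncomputable def promptLaw (L D : ℕ) (τ : NNReal) : Measure (Prompt L D) :=
  (((stdGaussian (Vec D)).prod
      ((Measure.pi fun _ : Fin (L + 1) => uniformSphere D).prod
        (Measure.pi fun _ : Fin (L + 1) => gaussianReal 0 (τ ^ 2)))).map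
    fun q => (q.2.1, fun i => inner ℝ q.1 (q.2.1 i) + q.2.2 i))

/-- The variance of each entry of the injected noise. -/
noncomputable def noiseVar (N T : ℕ) (η₀ σ ε δ : ℝ) : ℝ :=
  2 * η₀ ^ 2 * ((T : ℝ) ^ 2 * σ ^ 2 / (ε ^ 2 * (N : ℝ) ^ 2)) * Real.log (1.25 * T / δ)

/-- The law of one injected noise matrix: i.i.d. centred Gaussian entries of variance `v`. -/
noncomputable def noiseLaw (D : ℕ) (v : ℝ) : Measure (Mat D) :=
  (stdGaussian (Mat D)).map fun g => Real.sqrt v • g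

/-- The joint law of the `N` training prompts, the test prompt and the `T` noise matrices, all
independent. -/
noncomputable def sampleLaw (N L D T : ℕ) (τ : NNReal) (v : ℝ) :
    Measure ((Fin N → Prompt L D) × Prompt L D × (Fin T → Mat D)) :=
  (Measure.pi fun _ : Fin N => promptLaw L D τ).prod
    ((promptLaw L D τ).prod (Measure.pi fun _ : Fin T => noiseLaw D v))

theorem isProbabilityMeasure_sampleLaw (N L : ℕ) {D : ℕ} (T : ℕ) (τ : NNReal) (v : ℝ)
    (hD : 0 < D) : IsProbabilityMeasure (sampleLaw N L D T τ v) := by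
  have := isProbabilityMeasure_uniformSphere hD
  have h1 : IsProbabilityMeasure (promptLaw L D τ) := by
    refine Measure.isProbabilityMeasure_map (Measurable.aemeasurable ?_)
    refine Measurable.prodMk (by fun_prop) (measurable_pi_lambda _ fun i => ?_)
    exact (Measurable.inner (by fun_prop) (by fun_prop)).add (by fun_prop)
  have h2 : IsProbabilityMeasure (noiseLaw D v) :=
    Measure.isProbabilityMeasure_map (by fun_prop)
  unfold sampleLaw
  infer_instance

/-- The cost of privacy `(⟨Γ̂, Z⟩ - ⟨Γ⋆, Z⟩)²`, with `Z` formed from the test prompt. -/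
noncomputable def costOfPrivacy {N L D T : ℕ} (B G R lam η₀ : ℝ) (Γ₀ : Mat D)
    (s : (Fin N → Prompt L D) × Prompt L D × (Fin T → Mat D)) : ℝ :=
  (inner ℝ (noisyHead B G R lam η₀ Γ₀ s.1 s.2.2) (feature s.2.1)
    - inner ℝ (ridge lam s.1) (feature s.2.1)) ^ 2

/-- `a ≍ b` with explicit constant `K`. -/
def Comparable (K a b : ℝ) : Prop := K⁻¹ * b ≤ a ∧ a ≤ K * b

/-- The clipping level `𝒞 = √(2 ν log(NL/κ))`. -/
noncomputable def clipLevel (N L : ℕ) (ν κ : ℝ) : ℝ :=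
  Real.sqrt (2 * ν * Real.log (N * L / κ))

/-- The radius `G = (𝒞/√L) (1 + √(log(N/κ))/D)` used to project the features. -/
noncomputable def featureRadius (N L D : ℕ) (ν κ : ℝ) : ℝ :=
  clipLevel N L ν κ / Real.sqrt L * (1 + Real.sqrt (Real.log (N / κ)) / D)

/-- The order `λ⁻¹ 𝒞² √(N/L) (1 + √(log(1/κ))/D)` of the radius `R` used to project the
iterates. -/
noncomputable def iterateRadiusOrder (N L D : ℕ) (ν κ lam : ℝ) : ℝ :=
  lam⁻¹ * clipLevel N L ν κ ^ 2 * Real.sqrt (N / L) * (1 + Real.sqrt (Real.log (1 / κ)) / D)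

end NoisyHead

open scoped ENNReal NNReal Pointwise

namespace NoisyHead

/-! ### Rotation invariant measures -/

/-! The two predictions are never compared with each other: both are small, and the triangle
inequality is enough. With high probability all features have norm at most `U`, where `U ^ 2` is of
order `ν log(NL) / L`, while `λ` is of order `√N`. Hence `U ^ 2 ≤ λ`, and the ridge penalty
dominates the data term in every direction. Solving the normal equation gives `|⟨Γ⋆, Z⟩| ≤ B U² /
λ`.

For the private iterates, `proj R` multiplies a matrix by a scalar in `[0, 1]`, so it can only
shrink the absolute value of an inner product. The linear part of an update is self-adjoint and can
be moved onto the test feature `Z`. Unrolling (`abs_inner_noisyHead_le`) therefore works despite the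
projections. It bounds the prediction by an initial term `R U / r`, a data term of the same order `B
U² / λ`, and a sum of Gaussian noises tested against the iterates of `Z` under the linear part.
These directions do not depend on the noise, so each noise contributes only about `√D` times its
entrywise standard deviation. Since `λ η₀` is bounded below, the sum over the steps costs only a
constant.

The bound `B U² / λ` suffices when `r ≤ K N`. For larger `r` it can exceed the optimization error
and must be beaten by the privacy term, which is where `ε ≤ K` enters. Expanding once more in the
data term leaves `⟨H, Z⟩ / (λ N)`, with `H` a moment matrix `∑ φ_k Z_k`, plus a remainder of order
`B U⁴ / λ²`. Let `t`, of order `√(log(NL) / D)`, bound the cosines between independent directions.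
The inner product of two rank-one matrices factorizes, so near orthogonality gives `‖H‖ ≤ 2 N B t U`
and `|⟨H, Z⟩| ≤ t² ‖H‖ U`. The main term is thus of order `B t³ U² / λ`.

The probabilistic input is `lintegral_exp_sq_uniformSphere`, an exponential moment on the sphere
obtained by comparison with a Gaussian vector. Together with rotation invariance of the context, it
controls all the angles. Conditionally on the covariates the context sum is Gaussian, which controls
its norm (`promptLaw_norm_sum_gt_le`). `abs_inner_sub_le_of_good` collects the deterministic
estimates, and `Regime.costOfPrivacy_le` inserts the parameters. -/

theorem exists_linearIsometryEquiv_apply_eq {E : Type*} [NormedAddCommGroup E]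
    [InnerProductSpace ℝ E] {v w : E} (h : ‖v‖ = ‖w‖) : ∃ O : E ≃ₗᵢ[ℝ] E, O v = w :=
  ⟨_, Submodule.reflection_sub h⟩

theorem uniformSphere_apply {D : ℕ} {s : Set (Vec D)} (hs : MeasurableSet s) :
    uniformSphere D s = ((volume : Measure (Vec D)).toSphere Set.univ)⁻¹ *
      (D * volume (Set.Ioo (0 : ℝ) 1 • (((↑) : Metric.sphere (0 : Vec D) 1 → Vec D) ''
        (Subtype.val ⁻¹' s)))) := by
  rw [uniformSphere, Measure.smul_apply, Measure.map_apply measurable_subtype_coe hs,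
    Measure.toSphere_apply' _ (measurable_subtype_coe hs), smul_eq_mul, finrank_euclideanSpace,
    Fintype.card_fin]

/-- The surface measure of a set is proportional to the volume of the cone over it, and an isometry
carries cones to cones while preserving volume. -/
theorem uniformSphere_map {D : ℕ} (O : Vec D ≃ₗᵢ[ℝ] Vec D) :
    (uniformSphere D).map O = uniformSphere D := by
  ext s hs
  have hO : Measurable O := O.continuous.measurable
  rw [Measure.map_apply hO hs, uniformSphere_apply hs, uniformSphere_apply (hO hs)]
  congr 2
  refine Eq.trans ?_ (O.measurePreserving.measure_preimage_equiv (f := O.toMeasurableEquiv) _)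
  congr 1
  ext y
  simp only [Set.mem_preimage, Set.mem_smul, Set.mem_image, Subtype.exists, mem_sphere_zero_iff_norm,
    exists_and_right, exists_eq_right]
  constructor
  · rintro ⟨r, hr, x, ⟨hx, hxs⟩, rfl⟩
    exact ⟨r, hr, O x, ⟨by simpa using hx, hxs⟩, by simp [LinearIsometryEquiv.toMeasurableEquiv]⟩
  · rintro ⟨r, hr, x, ⟨hx, hxs⟩, h⟩
    refine ⟨r, hr, O.symm x, ⟨by simpa using hx, by simpa using hxs⟩, ?_⟩
    apply O.injective
    simpa [LinearIsometryEquiv.toMeasurableEquiv] using h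

theorem ae_norm_eq_one_uniformSphere (D : ℕ) : ∀ᵐ x ∂(uniformSphere D), ‖x‖ = 1 := by
  have : ∀ᵐ x ∂((volume : Measure (Vec D)).toSphere.map Subtype.val), ‖x‖ = 1 := by
    rw [ae_map_iff measurable_subtype_coe.aemeasurable (measurableSet_eq_fun (by fun_prop) (by fun_prop))]
    exact ae_of_all _ fun x => by simp
  exact Measure.ae_smul_measure this _

theorem lintegral_inner_uniformSphere_congr {D : ℕ} {v w : Vec D} (h : ‖v‖ = ‖w‖)
    {F : ℝ → ℝ≥0∞} (hF : Measurable F) :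
    ∫⁻ x, F (inner ℝ v x) ∂(uniformSphere D) = ∫⁻ x, F (inner ℝ w x) ∂(uniformSphere D) := by
  obtain ⟨O, rfl⟩ := exists_linearIsometryEquiv_apply_eq h
  conv_rhs => rw [← uniformSphere_map O]
  rw [lintegral_map (by fun_prop) O.continuous.measurable]
  simp

/-! ### Gaussian vectors -/

theorem map_inner_stdGaussian {E : Type*} [NormedAddCommGroup E] [InnerProductSpace ℝ E]
    [FiniteDimensional ℝ E] [MeasurableSpace E] [BorelSpace E] (t : E) :
    (stdGaussian E).map (fun g => inner ℝ g t) = gaussianReal 0 (‖t‖₊ ^ 2) := by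
  have h := IsGaussian.map_eq_gaussianReal (μ := stdGaussian E) (innerSL ℝ t)
  rw [variance_dual_stdGaussian, integral_strongDual_stdGaussian, innerSL_apply_norm] at h
  convert h using 2
  · ext g; simp [real_inner_comm]
  · ext; simp

theorem lintegral_norm_sq_stdGaussian (D : ℕ) :
    Integrable (fun g : Vec D => ‖g‖ ^ 2) (stdGaussian (Vec D)) ∧
      ∫ g, ‖g‖ ^ 2 ∂(stdGaussian (Vec D)) = D := by
  have hm : ∀ i : Fin D, (stdGaussian (Vec D)).map (fun g => g i) = gaussianReal 0 1 := fun i => by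
    have := map_inner_stdGaussian (EuclideanSpace.single i (1 : ℝ))
    simpa [EuclideanSpace.inner_single_right] using this
  have hi : ∀ i : Fin D, Integrable (fun g : Vec D => g i ^ 2) (stdGaussian (Vec D)) := fun i => by
    have : Integrable (fun x : ℝ => x ^ 2) ((stdGaussian (Vec D)).map (fun g => g i)) := by
      rw [hm i]; exact (memLp_id_gaussianReal 2).integrable_sq
    exact this.comp_measurable (by fun_prop)
  have hv : ∀ i : Fin D, ∫ g, g i ^ 2 ∂(stdGaussian (Vec D)) = 1 := fun i => by
    have h1 := variance_fun_id_gaussianReal (μ := 0) (v := 1)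
    rw [variance_eq_integral (by fun_prop), ← hm i, integral_map (by fun_prop) (by fun_prop)] at h1
    simpa [hm i, integral_id_gaussianReal] using h1
  simp_rw [EuclideanSpace.real_norm_sq_eq]
  refine ⟨integrable_finsetSum _ fun i _ => hi i, ?_⟩
  rw [integral_finsetSum _ fun i _ => hi i]
  simp [hv]

theorem lintegral_exp_sq_gaussianReal :
    ∫⁻ z, ENNReal.ofReal (Real.exp (z ^ 2 / 4)) ∂(gaussianReal 0 1) = ENNReal.ofReal (Real.sqrt 2) := by
  rw [gaussianReal_of_var_ne_zero _ one_ne_zero,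
    lintegral_withDensity_eq_lintegral_mul _ (measurable_gaussianPDF _ _) (by fun_prop)]
  have h1 : ∀ z : ℝ, (gaussianPDF 0 1 * fun z => ENNReal.ofReal (Real.exp (z ^ 2 / 4))) z
      = ENNReal.ofReal ((Real.sqrt (2 * Real.pi))⁻¹ * Real.exp (-(1 / 4) * z ^ 2)) := fun z => by
    rw [Pi.mul_apply, gaussianPDF, ← ENNReal.ofReal_mul (gaussianPDFReal_nonneg _ _ _),
      gaussianPDFReal, mul_assoc, ← Real.exp_add]
    congr 3
    · simp
    · simp; ring
  simp_rw [h1]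
  rw [← ofReal_integral_eq_lintegral_ofReal, integral_const_mul, integral_gaussian]
  · congr 1
    rw [← Real.sqrt_inv, ← Real.sqrt_mul (by positivity)]
    congr 1
    field_simp
    norm_num
  · exact (integrable_exp_neg_mul_sq (by norm_num)).const_mul _
  · exact ae_of_all _ fun z => by positivity

/-- Jensen's inequality by integrating the tangent line of `exp` at the mean. Stating the right side
as a lower integral avoids assuming that `exp ∘ X` is integrable. -/
theorem exp_integral_le_lintegral {Ω : Type*} [MeasurableSpace Ω] {μ : Measure Ω}
    [IsProbabilityMeasure μ] {X : Ω → ℝ} (hX : Integrable X μ) :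
    ENNReal.ofReal (Real.exp (∫ ω, X ω ∂μ)) ≤ ∫⁻ ω, ENNReal.ofReal (Real.exp (X ω)) ∂μ := by
  set m := ∫ ω, X ω ∂μ
  have hi : Integrable (fun ω => Real.exp m * (1 + (X ω - m))) μ :=
    ((integrable_const _).add (hX.sub (integrable_const _))).const_mul _
  have h1 : ∫ ω, Real.exp m * (1 + (X ω - m)) ∂μ = Real.exp m := by
    have h2 : ∫ ω, (X ω - m) ∂μ = 0 := by
      rw [integral_sub hX (integrable_const _)]; simp [m]
    have h3 : Integrable (fun ω => X ω - m) μ := hX.sub (integrable_const _)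
    rw [integral_const_mul, integral_add (integrable_const _) h3, h2]
    simp
  rw [← h1]
  refine (ENNReal.ofReal_le_of_le_toReal ?_ : _).trans
    (lintegral_mono (f := fun ω => ENNReal.ofReal (Real.exp m * (1 + (X ω - m)))) fun ω =>
      ENNReal.ofReal_le_ofReal ?_)
  · rw [integral_eq_lintegral_pos_part_sub_lintegral_neg_part hi]
    simp
  · have := Real.add_one_le_exp (X ω - m)
    calc Real.exp m * (1 + (X ω - m)) ≤ Real.exp m * Real.exp (X ω - m) := by gcongr; linarith
      _ = Real.exp (X ω) := by rw [← Real.exp_add]; congr 1; ring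

/-- Since `D` is the mean of `‖g‖²` for a standard Gaussian `g`, Jensen replaces `D` by `‖g‖²`
inside the exponential. By rotation invariance `‖g‖ ⟨a, x⟩` may then be exchanged for `⟨g, x⟩`,
which for fixed `x` on the sphere is a standard normal variable, whose moment is `√2`. -/
theorem lintegral_exp_sq_uniformSphere {D : ℕ} (hD : 0 < D) {a : Vec D} (ha : ‖a‖ = 1) :
    ∫⁻ x, ENNReal.ofReal (Real.exp (D * inner ℝ a x ^ 2 / 4)) ∂(uniformSphere D)
      ≤ ENNReal.ofReal (Real.sqrt 2) := by
  have := isProbabilityMeasure_uniformSphere hD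
  obtain ⟨hi, hv⟩ := lintegral_norm_sq_stdGaussian D
  calc ∫⁻ x, ENNReal.ofReal (Real.exp (D * inner ℝ a x ^ 2 / 4)) ∂(uniformSphere D)
      ≤ ∫⁻ x, ∫⁻ g, ENNReal.ofReal (Real.exp (‖g‖ ^ 2 * (inner ℝ a x ^ 2 / 4)))
          ∂(stdGaussian (Vec D)) ∂(uniformSphere D) := by
        refine lintegral_mono fun x => ?_
        have := exp_integral_le_lintegral (hi.mul_const (inner ℝ a x ^ 2 / 4))
        rw [integral_mul_const, hv] at this
        simpa [mul_div_assoc] using this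
    _ = ∫⁻ g, ∫⁻ x, ENNReal.ofReal (Real.exp (‖g‖ ^ 2 * (inner ℝ a x ^ 2 / 4)))
          ∂(uniformSphere D) ∂(stdGaussian (Vec D)) :=
        lintegral_lintegral_swap (by fun_prop)
    _ = ∫⁻ g, ∫⁻ x, ENNReal.ofReal (Real.exp (inner ℝ g x ^ 2 / 4))
          ∂(uniformSphere D) ∂(stdGaussian (Vec D)) := by
        refine lintegral_congr fun g => ?_
        have h := lintegral_inner_uniformSphere_congr (v := ‖g‖ • a) (w := g)
          (by rw [norm_smul, ha]; simp) (F := fun z => ENNReal.ofReal (Real.exp (z ^ 2 / 4)))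
          (by fun_prop)
        rw [← h]
        refine lintegral_congr fun x => ?_
        rw [real_inner_smul_left, mul_pow, mul_div_assoc]
    _ = ∫⁻ x, ∫⁻ g, ENNReal.ofReal (Real.exp (inner ℝ g x ^ 2 / 4))
          ∂(stdGaussian (Vec D)) ∂(uniformSphere D) :=
        lintegral_lintegral_swap (by fun_prop)
    _ = ∫⁻ x, ENNReal.ofReal (Real.sqrt 2) ∂(uniformSphere D) := by
        refine lintegral_congr_ae ?_
        filter_upwards [ae_norm_eq_one_uniformSphere D] with x hx
        have h1 : ‖x‖₊ = 1 := by ext; simpa using hx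
        have h := map_inner_stdGaussian x
        rw [h1, one_pow] at h
        rw [← lintegral_exp_sq_gaussianReal, ← h, lintegral_map (by fun_prop) (by fun_prop)]
    _ = _ := by simp

/-- Tail of a linear functional on the sphere. -/
theorem uniformSphere_inner_gt_le {D : ℕ} (hD : 0 < D) (a : Vec D) {t : ℝ} (ht : 0 ≤ t) :
    uniformSphere D {x | t * ‖a‖ < |inner ℝ a x|} ≤
      ENNReal.ofReal (2 * Real.exp (-(D * t ^ 2 / 4))) := by
  rcases eq_or_ne a 0 with rfl | ha
  · simp
  have hpos : 0 < ‖a‖ := norm_pos_iff.mpr ha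
  have h1 := lintegral_exp_sq_uniformSphere hD (a := ‖a‖⁻¹ • a)
    (by rw [norm_smul]; simp [hpos.ne'])
  have h2 := mul_meas_ge_le_lintegral (μ := uniformSphere D) (f := fun x =>
    ENNReal.ofReal (Real.exp (D * inner ℝ (‖a‖⁻¹ • a) x ^ 2 / 4))) (by fun_prop)
    (ENNReal.ofReal (Real.exp (D * t ^ 2 / 4)))
  have hsub : {x | t * ‖a‖ < |inner ℝ a x|} ⊆ {x | ENNReal.ofReal (Real.exp (D * t ^ 2 / 4)) ≤
      ENNReal.ofReal (Real.exp (D * inner ℝ (‖a‖⁻¹ • a) x ^ 2 / 4))} := by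
    intro x hx
    refine ENNReal.ofReal_le_ofReal (Real.exp_le_exp.mpr ?_)
    have : t ≤ |inner ℝ (‖a‖⁻¹ • a) x| := by
      rw [real_inner_smul_left, abs_mul, abs_of_pos (inv_pos.mpr hpos), inv_mul_eq_div,
        le_div_iff₀ hpos]
      exact (Set.mem_ofPred.mp hx).le
    have h3 : t ^ 2 ≤ inner ℝ (‖a‖⁻¹ • a) x ^ 2 := by
      rw [← sq_abs (inner ℝ _ _)]; gcongr
    gcongr
  have h4 : ENNReal.ofReal (Real.exp (D * t ^ 2 / 4)) * uniformSphere D {x | t * ‖a‖ < |inner ℝ a x|}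
      ≤ ENNReal.ofReal (Real.sqrt 2) := by
    refine le_trans ?_ (h2.trans h1)
    gcongr
  have h5 : uniformSphere D {x | t * ‖a‖ < |inner ℝ a x|} =
      ENNReal.ofReal (Real.exp (-(D * t ^ 2 / 4))) * (ENNReal.ofReal (Real.exp (D * t ^ 2 / 4)) *
        uniformSphere D {x | t * ‖a‖ < |inner ℝ a x|}) := by
    rw [← mul_assoc, ← ENNReal.ofReal_mul (Real.exp_nonneg _), ← Real.exp_add]
    simp
  rw [h5, mul_comm 2, ENNReal.ofReal_mul (Real.exp_nonneg _)]
  gcongr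
  refine h4.trans (ENNReal.ofReal_le_ofReal ?_)
  exact Real.sqrt_le_iff.mpr ⟨by norm_num, by norm_num⟩

/-- Chernoff bound for the sum of squared inner products with i.i.d. points of the sphere. -/
theorem pi_uniformSphere_sum_inner_sq_gt_le {D : ℕ} (hD : 0 < D) (n : ℕ) {a : Vec D}
    (ha : ‖a‖ = 1) :
    (Measure.pi fun _ : Fin n => uniformSphere D) {x | 8 * (n : ℝ) / D < ∑ m, inner ℝ a (x m) ^ 2} ≤
      ENNReal.ofReal (Real.exp (-n)) := by
  have := isProbabilityMeasure_uniformSphere hD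
  have hD' : (0 : ℝ) < D := by exact_mod_cast hD
  set P := Measure.pi fun _ : Fin n => uniformSphere D
  have h0 : ∫⁻ x, ∏ m, ENNReal.ofReal (Real.exp (D * inner ℝ a (x m) ^ 2 / 4)) ∂P
      ≤ ENNReal.ofReal (Real.sqrt 2) ^ n := by
    have hind := iIndepFun_pi (μ := fun _ : Fin n => uniformSphere D)
      (X := fun _ (x : Vec D) => ENNReal.ofReal (Real.exp (D * inner ℝ a x ^ 2 / 4)))
      (fun _ => by fun_prop)
    rw [lintegral_prod_eq_prod_lintegral_of_indepFun Finset.univ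
      (fun (m : Fin n) (x : Fin n → Vec D) => ENNReal.ofReal (Real.exp (D * inner ℝ a (x m) ^ 2 / 4)))
      hind (fun _ => by fun_prop)]
    calc _ ≤ ∏ _m : Fin n, ENNReal.ofReal (Real.sqrt 2) := by
          refine Finset.prod_le_prod' fun m _ => ?_
          refine le_trans (le_of_eq ?_) (lintegral_exp_sq_uniformSphere hD ha)
          exact (measurePreserving_eval (fun _ : Fin n => uniformSphere D) m).lintegral_comp
            (f := fun x => ENNReal.ofReal (Real.exp (D * inner ℝ a x ^ 2 / 4))) (by fun_prop)
      _ = _ := by simp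
  have h1 : ∀ x : Fin n → Vec D, ∏ m, ENNReal.ofReal (Real.exp (D * inner ℝ a (x m) ^ 2 / 4)) =
      ENNReal.ofReal (Real.exp (D / 4 * ∑ m, inner ℝ a (x m) ^ 2)) := fun x => by
    rw [← ENNReal.ofReal_prod_of_nonneg fun _ _ => (Real.exp_nonneg _), ← Real.exp_sum,
      Finset.mul_sum]
    congr 2
    exact Finset.sum_congr rfl fun _ _ => by ring
  simp_rw [h1] at h0
  -- The threshold `8 n / D` times `D / 4` is `2 n`. Markov at level `exp (2 n)` against the moment
  -- `√2 ^ n ≤ exp n` leaves `exp (-n)`.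
  have h2 := (mul_meas_ge_le_lintegral (μ := P)
    (f := fun x => ENNReal.ofReal (Real.exp (D / 4 * ∑ m, inner ℝ a (x m) ^ 2))) (by fun_prop)
    (ENNReal.ofReal (Real.exp (2 * n)))).trans h0
  have hsub : {x | 8 * (n : ℝ) / D < ∑ m, inner ℝ a (x m) ^ 2} ⊆
      {x : Fin n → Vec D | ENNReal.ofReal (Real.exp (2 * n)) ≤
        ENNReal.ofReal (Real.exp (D / 4 * ∑ m, inner ℝ a (x m) ^ 2))} := by
    intro x hx
    refine ENNReal.ofReal_le_ofReal (Real.exp_le_exp.mpr ?_)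
    have := (Set.mem_ofPred.mp hx).le
    rw [div_le_iff₀ hD'] at this
    linarith
  have h3 : P {x | 8 * (n : ℝ) / D < ∑ m, inner ℝ a (x m) ^ 2} =
      ENNReal.ofReal (Real.exp (-(2 * n))) * (ENNReal.ofReal (Real.exp (2 * n)) *
        P {x | 8 * (n : ℝ) / D < ∑ m, inner ℝ a (x m) ^ 2}) := by
    rw [← mul_assoc, ← ENNReal.ofReal_mul (Real.exp_nonneg _), ← Real.exp_add]
    simp
  have h4 : Real.sqrt 2 ≤ Real.exp 1 := by
    have := Real.add_one_le_exp (1 : ℝ)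
    exact (Real.sqrt_le_iff.mpr ⟨by norm_num, by norm_num⟩ : Real.sqrt 2 ≤ 2).trans (by linarith)
  rw [h3]
  calc _ ≤ ENNReal.ofReal (Real.exp (-(2 * n))) * ENNReal.ofReal (Real.sqrt 2) ^ n := by
        gcongr
        exact (mul_le_mul_right (measure_mono hsub) _).trans h2
    _ ≤ ENNReal.ofReal (Real.exp (-(2 * n))) * ENNReal.ofReal (Real.exp 1) ^ n := by gcongr
    _ = _ := by
        rw [← ENNReal.ofReal_pow (Real.exp_nonneg _), ← ENNReal.ofReal_mul (Real.exp_nonneg _),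
          ← Real.exp_nat_mul, ← Real.exp_add]
        congr 2; ring

/-! ### Tails of Gaussian linear forms -/

theorem hasSubgaussianMGF_gaussianReal (v : ℝ≥0) :
    HasSubgaussianMGF (fun x => x) v (gaussianReal 0 v) where
  integrable_exp_mul t := by simpa using integrable_exp_mul_gaussianReal t
  mgf_le t := by simp [mgf_fun_id_gaussianReal]

/-- The scale is a positive upper bound `V` rather than the variance proxy itself, which may vanish;
the degenerate case is treated separately. -/
theorem HasSubgaussianMGF.measure_abs_gt_le {Ω : Type*} [MeasurableSpace Ω] {μ : Measure Ω}
    [IsFiniteMeasure μ] {X : Ω → ℝ} {c : ℝ≥0} (h : HasSubgaussianMGF X c μ) {s V : ℝ} (hs : 0 ≤ s)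
    (hV : 0 < V) (hc : c ≤ V) :
    μ {ω | s * Real.sqrt V < |X ω|} ≤ ENNReal.ofReal (2 * Real.exp (-(s ^ 2 / 2))) := by
  rcases eq_or_ne c 0 with rfl | hc0
  · have h1 := h.ae_eq_zero_of_hasSubgaussianMGF_zero
    have : μ {ω | s * Real.sqrt V < |X ω|} = 0 := by
      rw [measure_eq_zero_iff_ae_notMem]
      filter_upwards [h1] with ω hω
      simp only [hω]
      simp; positivity
    simp [this]
  have hc1 : (0 : ℝ) < c := by positivity
  have hexp : Real.exp (-(s * Real.sqrt V) ^ 2 / (2 * c)) ≤ Real.exp (-(s ^ 2 / 2)) := by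
    refine Real.exp_le_exp.mpr ?_
    rw [mul_pow, Real.sq_sqrt hV.le, neg_div, neg_le_neg_iff, div_le_div_iff₀ (by norm_num)
      (by positivity)]
    nlinarith [mul_le_mul_of_nonneg_left hc (sq_nonneg s)]
  have h1 := (h.measure_ge_le (ε := s * Real.sqrt V) (by positivity)).trans hexp
  have h2 := (h.neg.measure_ge_le (ε := s * Real.sqrt V) (by positivity)).trans hexp
  have h3 : {ω | s * Real.sqrt V < |X ω|} ⊆ {ω | s * Real.sqrt V ≤ X ω} ∪
      {ω | s * Real.sqrt V ≤ (-X) ω} := by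
    intro ω hω
    rcases lt_abs.mp (Set.mem_ofPred.mp hω) with h | h
    · exact Or.inl h.le
    · exact Or.inr h.le
  refine (measure_mono h3).trans ((measure_union_le _ _).trans ?_)
  rw [two_mul, ENNReal.ofReal_add (Real.exp_nonneg _) (Real.exp_nonneg _)]
  refine add_le_add ?_ ?_
  · rw [← ofReal_measureReal]; exact ENNReal.ofReal_le_ofReal h1
  · rw [← ofReal_measureReal]; exact ENNReal.ofReal_le_ofReal h2

theorem hasSubgaussianMGF_inner_stdGaussian {E : Type*} [NormedAddCommGroup E]
    [InnerProductSpace ℝ E] [FiniteDimensional ℝ E] [MeasurableSpace E] [BorelSpace E] (t : E) :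
    HasSubgaussianMGF (fun g => inner ℝ g t) (‖t‖₊ ^ 2) (stdGaussian E) := by
  have h := hasSubgaussianMGF_gaussianReal (‖t‖₊ ^ 2)
  rw [← map_inner_stdGaussian t] at h
  exact HasSubgaussianMGF.of_map (by fun_prop) h

theorem hasSubgaussianMGF_pi_gaussianReal (n : ℕ) (v : ℝ≥0) (c : Fin n → ℝ) :
    HasSubgaussianMGF (fun e => ∑ i, c i * e i) (∑ i, ⟨c i ^ 2, sq_nonneg _⟩ * v)
      (Measure.pi fun _ : Fin n => gaussianReal 0 v) := by
  refine HasSubgaussianMGF.sum_of_iIndepFun (X := fun i (e : Fin n → ℝ) => c i * e i)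
    (iIndepFun_pi (μ := fun _ : Fin n => gaussianReal 0 v) (X := fun i (x : ℝ) => c i * x)
      (fun _ => by fun_prop)) fun i _ => ?_
  have h := (hasSubgaussianMGF_gaussianReal v).const_mul (c i)
  rw [← (measurePreserving_eval (fun _ : Fin n => gaussianReal 0 v) i).map_eq] at h
  exact HasSubgaussianMGF.of_map (Y := fun e : Fin n → ℝ => e i)
    (measurable_pi_apply i).aemeasurable h

/-- Once the covariates are frozen, every response and every coordinate of the context sum is a
linear form of this kind in the weight vector and the label noise. -/
theorem prod_gaussian_linear_gt_le {D n : ℕ} (τ : ℝ≥0) (t : Vec D) (c : Fin n → ℝ) {s V : ℝ}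
    (hs : 0 ≤ s) (hV : 0 < V) (hle : ‖t‖ ^ 2 + τ ^ 2 * ∑ i, c i ^ 2 ≤ V) :
    ((stdGaussian (Vec D)).prod (Measure.pi fun _ : Fin n => gaussianReal 0 (τ ^ 2)))
      {q | s * Real.sqrt V < |inner ℝ q.1 t + ∑ i, c i * q.2 i|} ≤
      ENNReal.ofReal (2 * Real.exp (-(s ^ 2 / 2))) := by
  set μ := (stdGaussian (Vec D)).prod (Measure.pi fun _ : Fin n => gaussianReal 0 (τ ^ 2))
  have h1 : HasSubgaussianMGF (fun q : Vec D × (Fin n → ℝ) => (inner ℝ q.1 t : ℝ)) (‖t‖₊ ^ 2) μ := by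
    have h := hasSubgaussianMGF_inner_stdGaussian t
    rw [← (measurePreserving_fst (μ := stdGaussian (Vec D))
      (ν := Measure.pi fun _ : Fin n => gaussianReal 0 (τ ^ 2))).map_eq] at h
    exact HasSubgaussianMGF.of_map (Y := Prod.fst) (by fun_prop) h
  have h2 : HasSubgaussianMGF (fun q : Vec D × (Fin n → ℝ) => ∑ i, c i * q.2 i)
      (∑ i, ⟨c i ^ 2, sq_nonneg _⟩ * τ ^ 2) μ := by
    have h := hasSubgaussianMGF_pi_gaussianReal n (τ ^ 2) c
    rw [← (measurePreserving_snd (μ := stdGaussian (Vec D))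
      (ν := Measure.pi fun _ : Fin n => gaussianReal 0 (τ ^ 2))).map_eq] at h
    exact HasSubgaussianMGF.of_map (Y := Prod.snd) (by fun_prop) h
  have h3 := h1.add_of_indepFun h2
    (indepFun_prod (X := fun w : Vec D => (inner ℝ w t : ℝ))
      (Y := fun e : Fin n → ℝ => ∑ i, c i * e i) (by fun_prop) (by fun_prop))
  refine HasSubgaussianMGF.measure_abs_gt_le h3 hs hV (le_trans (le_of_eq ?_) hle)
  push_cast
  rw [Finset.mul_sum]
  congr 1
  exact Finset.sum_congr rfl fun i _ => mul_comm _ _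

/-! ### Union and Fubini bounds -/

theorem measure_prod_le_of_ae_left {α β : Type*} [MeasurableSpace α] [MeasurableSpace β]
    {μ : Measure α} {ν : Measure β} [IsProbabilityMeasure μ] [SFinite ν] {S : Set (α × β)}
    (hS : MeasurableSet S) {p : ℝ≥0∞} (h : ∀ᵐ a ∂μ, ν {b | (a, b) ∈ S} ≤ p) :
    (μ.prod ν) S ≤ p := by
  rw [Measure.prod_apply hS]
  calc _ ≤ ∫⁻ _, p ∂μ := lintegral_mono_ae h
    _ = p := by simp

theorem measure_prod_le_of_ae_right {α β : Type*} [MeasurableSpace α] [MeasurableSpace β]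
    {μ : Measure α} {ν : Measure β} [SFinite μ] [IsProbabilityMeasure ν] {S : Set (α × β)}
    (hS : MeasurableSet S) {p : ℝ≥0∞} (h : ∀ᵐ b ∂ν, μ {a | (a, b) ∈ S} ≤ p) :
    (μ.prod ν) S ≤ p := by
  rw [Measure.prod_apply_symm hS]
  calc _ ≤ ∫⁻ _, p ∂ν := lintegral_mono_ae h
    _ = p := by simp

theorem measure_exists_le_card_mul {Ω ι : Type*} [MeasurableSpace Ω] {μ : Measure Ω} [Fintype ι]
    {S : ι → Set Ω} {p : ℝ} (hp : 0 ≤ p) (h : ∀ i, μ (S i) ≤ ENNReal.ofReal p) :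
    μ {ω | ∃ i, ω ∈ S i} ≤ ENNReal.ofReal (Fintype.card ι * p) := by
  have : {ω | ∃ i, ω ∈ S i} = ⋃ i, S i := by ext; simp
  rw [this]
  refine (measure_iUnion_fintype_le _ _).trans ((Finset.sum_le_sum fun i _ => h i).trans ?_)
  rw [← ENNReal.ofReal_sum_of_nonneg fun _ _ => hp]
  simp

theorem pi_apply_succAbove {α : Type*} [MeasurableSpace α] (μ : Measure α) [SigmaFinite μ] {n : ℕ}
    (i : Fin (n + 1)) {S : Set (α × (Fin n → α))} (hS : MeasurableSet S) :
    (Measure.pi fun _ : Fin (n + 1) => μ) {x | (x i, fun j => x (i.succAbove j)) ∈ S} =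
      (μ.prod (Measure.pi fun _ : Fin n => μ)) S := by
  rw [← (measurePreserving_piFinSuccAbove (fun _ : Fin (n + 1) => μ) i).measure_preimage
    hS.nullMeasurableSet]
  rfl

/-- A bound for pairs of distinct coordinates of an i.i.d. family. -/
theorem pi_pair_le {α : Type*} [MeasurableSpace α] (μ : Measure α) [IsProbabilityMeasure μ] {n : ℕ}
    {i j : Fin n} (hij : i ≠ j) {S : Set (α × α)} (hS : MeasurableSet S) {p : ℝ≥0∞}
    (h : ∀ b, μ {a | (a, b) ∈ S} ≤ p) :
    (Measure.pi fun _ : Fin n => μ) {x | (x i, x j) ∈ S} ≤ p := by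
  obtain _ | n := n
  · exact i.elim0
  obtain ⟨k, rfl⟩ := Fin.exists_succAbove_eq hij.symm
  have hS' : MeasurableSet {q : α × (Fin n → α) | (q.1, q.2 k) ∈ S} :=
    (measurable_fst.prodMk ((measurable_pi_apply k).comp measurable_snd)) hS
  have := pi_apply_succAbove μ i hS'
  simp only [Set.mem_ofPred] at this
  rw [this]
  exact measure_prod_le_of_ae_right hS' (ae_of_all _ fun b => h (b k))

theorem pi_eval_apply {α : Type*} [MeasurableSpace α] (μ : Measure α) [IsProbabilityMeasure μ]
    {n : ℕ} (i : Fin n) {S : Set α} (hS : MeasurableSet S) :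
    (Measure.pi fun _ : Fin n => μ) {x | x i ∈ S} = μ S :=
  (measurePreserving_eval (fun _ : Fin n => μ) i).measure_preimage hS.nullMeasurableSet

/-! ### The law of a prompt -/

/-- The query covariate `x_{L+1}`. -/
def query {L D : ℕ} (E : Prompt L D) : Vec D := E.1 (Fin.last L)

/-- The context average `L⁻¹ ∑_{i ≤ L} y_i x_i`. -/
noncomputable def context {L D : ℕ} (E : Prompt L D) : Vec D :=
  (L : ℝ)⁻¹ • ∑ i : Fin L, E.2 i.castSucc • E.1 i.castSucc

@[fun_prop]
theorem measurable_query {L D : ℕ} : Measurable (query : Prompt L D → Vec D) := by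
  unfold query; fun_prop

@[fun_prop]
theorem measurable_context {L D : ℕ} : Measurable (context : Prompt L D → Vec D) := by
  unfold context; fun_prop

@[fun_prop]
theorem measurable_queryResponse {L D : ℕ} : Measurable (queryResponse : Prompt L D → ℝ) := by
  unfold queryResponse; fun_prop

@[fun_prop]
theorem measurable_respond {L D : ℕ} : Measurable
    (fun q : Vec D × (Fin (L + 1) → Vec D) × (Fin (L + 1) → ℝ) =>
      ((q.2.1, fun i => inner ℝ q.1 (q.2.1 i) + q.2.2 i) : Prompt L D)) := by
  refine Measurable.prodMk (by fun_prop) (measurable_pi_lambda _ fun i => ?_)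
  exact (Measurable.inner (by fun_prop) (by fun_prop)).add (by fun_prop)

theorem isProbabilityMeasure_promptLaw (L : ℕ) {D : ℕ} (τ : ℝ≥0) (hD : 0 < D) :
    IsProbabilityMeasure (promptLaw L D τ) := by
  have := isProbabilityMeasure_uniformSphere hD
  exact Measure.isProbabilityMeasure_map measurable_respond.aemeasurable

/-- Bounding a probability conditionally on the covariates. -/
theorem promptLaw_le_of_ae {L D : ℕ} (hD : 0 < D) (τ : ℝ≥0) {S : Set (Prompt L D)}
    (hS : MeasurableSet S) {p : ℝ≥0∞}
    (h : ∀ᵐ x ∂(Measure.pi fun _ : Fin (L + 1) => uniformSphere D),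
      ((stdGaussian (Vec D)).prod (Measure.pi fun _ : Fin (L + 1) => gaussianReal 0 (τ ^ 2)))
        {q | (x, fun i => inner ℝ q.1 (x i) + q.2 i) ∈ S} ≤ p) :
    promptLaw L D τ S ≤ p := by
  have := isProbabilityMeasure_uniformSphere hD
  have hS' := measurable_respond hS
  rw [promptLaw, Measure.map_apply measurable_respond hS, Measure.prod_apply hS']
  have h1 : ∀ w : Vec D, ((Measure.pi fun _ : Fin (L + 1) => uniformSphere D).prod
      (Measure.pi fun _ : Fin (L + 1) => gaussianReal 0 (τ ^ 2))) (Prod.mk w ⁻¹'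
        ((fun q : Vec D × (Fin (L + 1) → Vec D) × (Fin (L + 1) → ℝ) =>
          ((q.2.1, fun i => inner ℝ q.1 (q.2.1 i) + q.2.2 i) : Prompt L D)) ⁻¹' S)) =
      ∫⁻ x, (Measure.pi fun _ : Fin (L + 1) => gaussianReal 0 (τ ^ 2))
        {e | (x, fun i => inner ℝ w (x i) + e i) ∈ S}
          ∂(Measure.pi fun _ : Fin (L + 1) => uniformSphere D) := fun w => by
    rw [Measure.prod_apply (measurable_prodMk_left hS')]
    rfl
  simp_rw [h1]
  have hm : Measurable (fun q : (Vec D × (Fin (L + 1) → Vec D)) × (Fin (L + 1) → ℝ) =>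
      ((q.1.2, fun i => inner ℝ q.1.1 (q.1.2 i) + q.2 i) : Prompt L D)) :=
    measurable_respond.comp (by fun_prop : Measurable
      fun q : (Vec D × (Fin (L + 1) → Vec D)) × (Fin (L + 1) → ℝ) => (q.1.1, q.1.2, q.2))
  rw [lintegral_lintegral_swap (measurable_measure_prodMk_left (hm hS)).aemeasurable]
  calc _ ≤ ∫⁻ _, p ∂(Measure.pi fun _ : Fin (L + 1) => uniformSphere D) := by
        refine lintegral_mono_ae ?_
        filter_upwards [h] with x hx
        refine le_trans (le_of_eq ?_) hx
        have hm' : Measurable (fun q : Vec D × (Fin (L + 1) → ℝ) =>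
            ((x, fun i => inner ℝ q.1 (x i) + q.2 i) : Prompt L D)) :=
          measurable_respond.comp (by fun_prop : Measurable
            fun q : Vec D × (Fin (L + 1) → ℝ) => (q.1, x, q.2))
        exact (Measure.prod_apply (hm' hS)).symm
    _ = p := by simp

theorem map_fst_promptLaw {L D : ℕ} (hD : 0 < D) (τ : ℝ≥0) :
    (promptLaw L D τ).map Prod.fst = Measure.pi fun _ : Fin (L + 1) => uniformSphere D := by
  have := isProbabilityMeasure_uniformSphere hD
  rw [promptLaw, Measure.map_map measurable_fst measurable_respond]
  exact (measurePreserving_fst.comp measurePreserving_snd).map_eq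

theorem ae_norm_covariate (L : ℕ) {D : ℕ} (hD : 0 < D) :
    ∀ᵐ x ∂(Measure.pi fun _ : Fin (L + 1) => uniformSphere D), ∀ i, ‖x i‖ = 1 := by
  have := isProbabilityMeasure_uniformSphere hD
  rw [ae_all_iff]
  intro i
  exact (measurePreserving_eval (fun _ : Fin (L + 1) => uniformSphere D) i).quasiMeasurePreserving.ae
    (ae_norm_eq_one_uniformSphere D)

theorem ae_norm_query {L D : ℕ} (hD : 0 < D) (τ : ℝ≥0) : ∀ᵐ E ∂(promptLaw L D τ), ‖query E‖ = 1 := by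
  have h := ae_norm_covariate L hD
  rw [← map_fst_promptLaw hD τ] at h
  filter_upwards [ae_of_ae_map measurable_fst.aemeasurable h] with E hE using hE _

theorem promptLaw_response_gt_le {L D : ℕ} (hD : 0 < D) (τ : ℝ≥0) (i : Fin (L + 1)) {s : ℝ}
    (hs : 0 ≤ s) : promptLaw L D τ {E | s * Real.sqrt (1 + τ ^ 2) < |E.2 i|} ≤
      ENNReal.ofReal (2 * Real.exp (-(s ^ 2 / 2))) := by
  refine promptLaw_le_of_ae hD τ (measurableSet_lt (by fun_prop) (by fun_prop)) ?_
  filter_upwards [ae_norm_covariate L hD] with x hx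
  have h := prod_gaussian_linear_gt_le (n := L + 1) τ (x i) (Pi.single i 1) hs
    (V := 1 + τ ^ 2) (by positivity) (by
      simp [hx i, Pi.single_apply])
  simpa [Pi.single_apply] using h

/-- The query covariate is independent of the context. -/
theorem promptLaw_query_inner_gt_le {L D : ℕ} (hD : 0 < D) (τ : ℝ≥0) {M : Vec D → Vec D}
    (hM : Measurable M) {t : ℝ} (ht : 0 ≤ t) :
    promptLaw L D τ {E | t * ‖M (context E)‖ < |inner ℝ (M (context E)) (query E)|} ≤
      ENNReal.ofReal (2 * Real.exp (-(D * t ^ 2 / 4))) := by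
  have := isProbabilityMeasure_uniformSphere hD
  have hS : MeasurableSet {E : Prompt L D |
      t * ‖M (context E)‖ < |inner ℝ (M (context E)) (query E)|} :=
    measurableSet_lt (by fun_prop) (by fun_prop)
  rw [promptLaw, Measure.map_apply measurable_respond hS]
  refine measure_prod_le_of_ae_left (measurable_respond hS) (ae_of_all _ fun w => ?_)
  refine measure_prod_le_of_ae_right
    (measurable_prodMk_left (measurable_respond hS)) (ae_of_all _ fun e => ?_)
  -- With the weights and label noise frozen, the context depends only on the first `L` covariates,
  -- so the query covariate can be split off and stays uniform on the sphere.
  set g : (Fin L → Vec D) → Vec D := fun x =>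
    M ((L : ℝ)⁻¹ • ∑ i : Fin L, (inner ℝ w (x i) + e i.castSucc) • x i) with hg
  have hgm : Measurable g := hM.comp (by fun_prop)
  have h1 := pi_apply_succAbove (uniformSphere D) (Fin.last L)
    (S := {q | t * ‖g q.2‖ < |inner ℝ (g q.2) q.1|}) (measurableSet_lt (by fun_prop) (by fun_prop))
  simp only [Set.mem_ofPred, Fin.succAbove_last] at h1
  refine (le_of_eq h1).trans ?_
  exact measure_prod_le_of_ae_right (measurableSet_lt (by fun_prop) (by fun_prop))
    (ae_of_all _ fun x => uniformSphere_inner_gt_le hD (g x) ht)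

/-! ### Rotation invariance of the context -/

/-- Rotating the weight vector together with the covariates preserves their laws and leaves every
response unchanged. -/
theorem promptLaw_map_rotate {L D : ℕ} (hD : 0 < D) (τ : ℝ≥0) (O : Vec D ≃ₗᵢ[ℝ] Vec D) :
    (promptLaw L D τ).map (fun E => ((fun i => O (E.1 i), E.2) : Prompt L D)) =
      promptLaw L D τ := by
  have := isProbabilityMeasure_uniformSphere hD
  have hO : Measurable O := O.continuous.measurable
  have hpi : (Measure.pi fun _ : Fin (L + 1) => uniformSphere D).map (fun x i => O (x i)) =
      Measure.pi fun _ : Fin (L + 1) => uniformSphere D := by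
    rw [Measure.pi_map_pi (fun _ => hO.aemeasurable)]
    simp_rw [uniformSphere_map]
  have h1 : ((stdGaussian (Vec D)).prod
      ((Measure.pi fun _ : Fin (L + 1) => uniformSphere D).prod
        (Measure.pi fun _ : Fin (L + 1) => gaussianReal 0 (τ ^ 2)))).map
        (Prod.map O (Prod.map (fun x i => O (x i)) id)) = ((stdGaussian (Vec D)).prod
      ((Measure.pi fun _ : Fin (L + 1) => uniformSphere D).prod
        (Measure.pi fun _ : Fin (L + 1) => gaussianReal 0 (τ ^ 2)))) := by
    have hO2 : Measurable (fun (x : Fin (L + 1) → Vec D) i => O (x i)) := by fun_prop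
    rw [← Measure.map_prod_map _ _ hO (by fun_prop), ← Measure.map_prod_map _ _ hO2 measurable_id,
      stdGaussian_map, hpi, Measure.map_id]
  conv_rhs => rw [promptLaw, ← h1]
  rw [promptLaw, Measure.map_map (by fun_prop) measurable_respond,
    Measure.map_map measurable_respond (by fun_prop)]
  congr 1
  ext q <;> simp

/-- Rotating the prompt rotates its context, so the probability depends on `b` only through its
norm. It therefore equals its average over directions of `b` uniform on the sphere. Exchanging the
integrals freezes the context and leaves a spherical tail. -/
theorem promptLaw_context_inner_gt_le {L D : ℕ} (hD : 0 < D) (τ : ℝ≥0) (b : Vec D) {t : ℝ}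
    (ht : 0 ≤ t) :
    promptLaw L D τ {E | t * (‖b‖ * ‖context E‖) < |inner ℝ b (context E)|} ≤
      ENNReal.ofReal (2 * Real.exp (-(D * t ^ 2 / 4))) := by
  have := isProbabilityMeasure_uniformSphere hD
  have := isProbabilityMeasure_promptLaw L τ hD
  have hm : ∀ a : Vec D, MeasurableSet {E : Prompt L D | t * (‖b‖ * ‖context E‖) <
      |inner ℝ a (context E)|} := fun a => measurableSet_lt (by fun_prop) (by fun_prop)
  have hrot : ∀ a : Vec D, ‖a‖ = ‖b‖ →
      promptLaw L D τ {E | t * (‖b‖ * ‖context E‖) < |inner ℝ b (context E)|} =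
      promptLaw L D τ {E | t * (‖b‖ * ‖context E‖) < |inner ℝ a (context E)|} := by
    intro a ha
    obtain ⟨O, rfl⟩ := exists_linearIsometryEquiv_apply_eq ha
    have hO : Measurable O := O.continuous.measurable
    conv_lhs => rw [← promptLaw_map_rotate hD τ O]
    rw [Measure.map_apply (by fun_prop) (hm _)]
    congr 1
    ext E
    have : context ((fun i => O (E.1 i), E.2) : Prompt L D) = O (context E) := by
      simp [context, map_sum]
    simp [this]
  have h2 : (uniformSphere D).prod (promptLaw L D τ)
      {q | t * (‖b‖ * ‖context q.2‖) < |inner ℝ (‖b‖ • q.1) (context q.2)|} =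
      promptLaw L D τ {E | t * (‖b‖ * ‖context E‖) < |inner ℝ b (context E)|} := by
    rw [Measure.prod_apply (measurableSet_lt (by fun_prop) (by fun_prop))]
    have : ∀ᵐ x ∂(uniformSphere D), promptLaw L D τ (Prod.mk x ⁻¹'
        {q | t * (‖b‖ * ‖context q.2‖) < |inner ℝ (‖b‖ • q.1) (context q.2)|}) =
        promptLaw L D τ {E | t * (‖b‖ * ‖context E‖) < |inner ℝ b (context E)|} := by
      filter_upwards [ae_norm_eq_one_uniformSphere D] with x hx
      exact (hrot (‖b‖ • x) (by rw [norm_smul, hx]; simp)).symm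
    rw [lintegral_congr_ae this]
    simp
  rw [← h2]
  refine measure_prod_le_of_ae_right (measurableSet_lt (by fun_prop) (by fun_prop))
    (ae_of_all _ fun E => ?_)
  have h3 := uniformSphere_inner_gt_le hD (‖b‖ • context E) ht
  rw [norm_smul, norm_norm] at h3
  refine le_trans (le_of_eq ?_) h3
  congr 1
  ext x
  simp only [Set.mem_ofPred, real_inner_smul_left, real_inner_comm x]

/-! ### The norm of the context -/

/-- Both sides are the squared Frobenius norm of a Gram matrix. The left side is the total variance
that the weight vector gives to the coordinates of the context sum. -/
theorem sum_norm_sq_gram {D L : ℕ} (x : Fin L → Vec D) :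
    ∑ j, ‖∑ l, x l j • x l‖ ^ 2 = ∑ l, ∑ m, inner ℝ (x l) (x m) ^ 2 := by
  have h : ∀ j, ‖∑ l, x l j • x l‖ ^ 2 = ∑ l, ∑ m, x l j * x m j * inner ℝ (x l) (x m) := fun j => by
    rw [← real_inner_self_eq_norm_sq, sum_inner]
    refine Finset.sum_congr rfl fun l _ => ?_
    rw [inner_sum]
    refine Finset.sum_congr rfl fun m _ => ?_
    rw [real_inner_smul_left, real_inner_smul_right]; ring
  simp_rw [h]
  rw [Finset.sum_comm]
  refine Finset.sum_congr rfl fun l _ => ?_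
  rw [Finset.sum_comm]
  refine Finset.sum_congr rfl fun m _ => ?_
  rw [← Finset.sum_mul, sq]
  congr 1
  rw [PiLp.inner_apply]
  exact Finset.sum_congr rfl fun j _ => by simp [mul_comm]

/-- The hypothesis sums over all other covariates, the query included, because it comes from
splitting one coordinate off an i.i.d. family of `L + 1`. The surplus query term is nonnegative and
is dropped. -/
theorem sum_inner_sq_castSucc_le {D L : ℕ} {x : Fin (L + 1) → Vec D} (hx : ∀ i, ‖x i‖ = 1) {A : ℝ}
    (hA : ∀ l : Fin L, ∑ j, inner ℝ (x l.castSucc) (x (l.castSucc.succAbove j)) ^ 2 ≤ A) :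
    ∑ l : Fin L, ∑ m : Fin L, inner ℝ (x l.castSucc) (x m.castSucc) ^ 2 ≤ L * (1 + A) := by
  calc _ ≤ ∑ _l : Fin L, (1 + A) := by
        refine Finset.sum_le_sum fun l _ => ?_
        have h1 := Fin.sum_univ_castSucc fun i : Fin (L + 1) => inner ℝ (x l.castSucc) (x i) ^ 2
        have h2 := Fin.sum_univ_succAbove (fun i : Fin (L + 1) => inner ℝ (x l.castSucc) (x i) ^ 2)
          l.castSucc
        rw [real_inner_self_eq_norm_sq, hx] at h2
        have := hA l
        nlinarith [sq_nonneg (inner ℝ (x l.castSucc) (x (Fin.last L)) : ℝ)]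
    _ = _ := by rw [Finset.sum_const, Finset.card_univ, Fintype.card_fin, nsmul_eq_mul]

theorem pi_uniformSphere_exists_sum_inner_sq_gt_le {D : ℕ} (hD : 0 < D) (L : ℕ) :
    (Measure.pi fun _ : Fin (L + 1) => uniformSphere D) {x | ∃ l : Fin L, 8 * (L : ℝ) / D <
      ∑ j, inner ℝ (x l.castSucc) (x (l.castSucc.succAbove j)) ^ 2} ≤
      ENNReal.ofReal (L * Real.exp (-L)) := by
  have := isProbabilityMeasure_uniformSphere hD
  have h := measure_exists_le_card_mul (μ := Measure.pi fun _ : Fin (L + 1) => uniformSphere D)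
    (S := fun l : Fin L => {x | 8 * (L : ℝ) / D <
      ∑ j, inner ℝ (x l.castSucc) (x (l.castSucc.succAbove j)) ^ 2}) (Real.exp_nonneg (-(L : ℝ)))
    fun l => by
      have hS : MeasurableSet {q : Vec D × (Fin L → Vec D) |
          8 * (L : ℝ) / D < ∑ j, inner ℝ q.1 (q.2 j) ^ 2} :=
        measurableSet_lt (by fun_prop) (by fun_prop)
      have h1 := pi_apply_succAbove (uniformSphere D) l.castSucc hS
      simp only [Set.mem_ofPred] at h1
      rw [h1]
      refine measure_prod_le_of_ae_left hS ?_
      filter_upwards [ae_norm_eq_one_uniformSphere D] with a ha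
      exact pi_uniformSphere_sum_inner_sq_gt_le hD L ha
  simpa using h

/-- Given covariates with controlled Gram matrix, each coordinate of the sum is a centred Gaussian.
If no coordinate exceeds `s` standard deviations, the squared norm is at most `s ^ 2` times the sum
of the variances. The first probability term pays for bad covariates, the second for the union over
the `D` coordinates. -/
theorem promptLaw_norm_sum_gt_le {L D : ℕ} (hD : 0 < D) (τ : ℝ≥0) {s : ℝ} (hs : 0 ≤ s) :
    promptLaw L D τ {E | s ^ 2 * (L * (1 + 8 * L / D + τ ^ 2) + 1) <
        ‖∑ i : Fin L, E.2 i.castSucc • E.1 i.castSucc‖ ^ 2} ≤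
      ENNReal.ofReal (L * Real.exp (-L) + D * (2 * Real.exp (-(s ^ 2 / 2)))) := by
  have hD' : (0 : ℝ) < D := by exact_mod_cast hD
  set S := {E : Prompt L D | s ^ 2 * (L * (1 + 8 * L / D + τ ^ 2) + 1) <
        ‖∑ i : Fin L, E.2 i.castSucc • E.1 i.castSucc‖ ^ 2}
  set X := {x : Fin (L + 1) → Vec D | ∃ l : Fin L, 8 * (L : ℝ) / D <
      ∑ j, inner ℝ (x l.castSucc) (x (l.castSucc.succAbove j)) ^ 2}
  have hS : MeasurableSet S := measurableSet_lt (by fun_prop) (by fun_prop)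
  have hX : MeasurableSet X := by
    simp only [X, Set.ofPred_exists]
    exact MeasurableSet.iUnion fun l => measurableSet_lt (by fun_prop) (by fun_prop)
  have hX' : MeasurableSet (Prod.fst ⁻¹' X : Set (Prompt L D)) := measurable_fst hX
  have h1 : promptLaw L D τ (Prod.fst ⁻¹' X) ≤ ENNReal.ofReal (L * Real.exp (-L)) := by
    rw [← Measure.map_apply measurable_fst hX, map_fst_promptLaw hD]
    exact pi_uniformSphere_exists_sum_inner_sq_gt_le hD L
  have h2 : promptLaw L D τ (S \ Prod.fst ⁻¹' X) ≤
      ENNReal.ofReal (D * (2 * Real.exp (-(s ^ 2 / 2)))) := by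
    refine promptLaw_le_of_ae hD τ (hS.diff hX') ?_
    filter_upwards [ae_norm_covariate L hD] with x hx
    by_cases hxX : x ∈ X
    · have : {q : Vec D × (Fin (L + 1) → ℝ) | ((x, fun i => inner ℝ q.1 (x i) + q.2 i) : Prompt L D) ∈
          S \ Prod.fst ⁻¹' X} = ∅ := by ext q; simp [hxX]
      rw [this]; simp
    have hA : ∀ l : Fin L, ∑ j, inner ℝ (x l.castSucc) (x (l.castSucc.succAbove j)) ^ 2 ≤
        8 * (L : ℝ) / D := fun l => le_of_not_gt fun h => hxX ⟨l, h⟩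
    -- The label noise of the query token does not enter the context sum, hence the last coefficient
    -- `0`.
    set c : Fin D → Fin (L + 1) → ℝ := fun j => Fin.snoc (fun l : Fin L => x l.castSucc j) 0
    set w : Fin D → Vec D := fun j => ∑ l : Fin L, x l.castSucc j • x l.castSucc
    -- The summand `1 / D` only makes each variance bound positive; over all coordinates it accounts
    -- for the `+ 1` in the statement.
    set V : Fin D → ℝ := fun j => ‖w j‖ ^ 2 + τ ^ 2 * ∑ i, c j i ^ 2 + 1 / D
    have hc : ∀ j, ∑ i, c j i ^ 2 = ∑ l : Fin L, x l.castSucc j ^ 2 := fun j => by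
      rw [Fin.sum_univ_castSucc]; simp [c]
    have hV : ∀ j, 0 < V j := fun j => by
      have : 0 ≤ ∑ i, c j i ^ 2 := Finset.sum_nonneg fun _ _ => sq_nonneg _
      positivity
    have hVsum : ∑ j, V j ≤ L * (1 + 8 * L / D + τ ^ 2) + 1 := by
      have e1 : ∑ j, V j = ∑ j, ‖w j‖ ^ 2 + τ ^ 2 * ∑ j, ∑ i, c j i ^ 2 + 1 := by
        simp only [V, Finset.sum_add_distrib, ← Finset.mul_sum]
        simp [hD'.ne']
      have e2 : ∑ j, ∑ i, c j i ^ 2 = L := by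
        simp_rw [hc]
        rw [Finset.sum_comm]
        simp_rw [← EuclideanSpace.real_norm_sq_eq, hx]
        simp
      have e3 := sum_inner_sq_castSucc_le hx hA
      rw [← sum_norm_sq_gram fun l : Fin L => x l.castSucc] at e3
      rw [e1, e2]
      linarith
    have hcoord : ∀ (q : Vec D × (Fin (L + 1) → ℝ)) (j : Fin D),
        (∑ i : Fin L, (inner ℝ q.1 (x i.castSucc) + q.2 i.castSucc) • x i.castSucc) j =
          inner ℝ q.1 (w j) + ∑ i, c j i * q.2 i := fun q j => by
      rw [Fin.sum_univ_castSucc]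
      simp [c, w, inner_sum, real_inner_smul_right, ← Finset.sum_add_distrib]
      refine Finset.sum_congr rfl fun i _ => by ring
    have hsub : {q : Vec D × (Fin (L + 1) → ℝ) |
        ((x, fun i => inner ℝ q.1 (x i) + q.2 i) : Prompt L D) ∈ S \ Prod.fst ⁻¹' X} ⊆
        {q | ∃ j, q ∈ {q : Vec D × (Fin (L + 1) → ℝ) |
          s * Real.sqrt (V j) < |inner ℝ q.1 (w j) + ∑ i, c j i * q.2 i|}} := by
      rintro q ⟨hq, -⟩
      by_contra hcon
      simp only [Set.mem_ofPred, not_exists, not_lt] at hcon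
      have hq' : s ^ 2 * (L * (1 + 8 * L / D + τ ^ 2) + 1) <
        ‖∑ i : Fin L, (inner ℝ q.1 (x i.castSucc) + q.2 i.castSucc) • x i.castSucc‖ ^ 2 := hq
      rw [EuclideanSpace.real_norm_sq_eq] at hq'
      have : ∑ j, (∑ i : Fin L, (inner ℝ q.1 (x i.castSucc) + q.2 i.castSucc) • x i.castSucc) j ^ 2 ≤
          ∑ j, s ^ 2 * V j := by
        refine Finset.sum_le_sum fun j _ => ?_
        rw [hcoord, ← sq_abs]
        calc _ ≤ (s * Real.sqrt (V j)) ^ 2 := by gcongr; exact hcon j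
          _ = _ := by rw [mul_pow, Real.sq_sqrt (hV j).le]
      rw [← Finset.mul_sum] at this
      have := this.trans (mul_le_mul_of_nonneg_left hVsum (sq_nonneg s))
      linarith
    refine (measure_mono hsub).trans ?_
    have := measure_exists_le_card_mul (μ := (stdGaussian (Vec D)).prod
      (Measure.pi fun _ : Fin (L + 1) => gaussianReal 0 (τ ^ 2)))
      (by positivity : 0 ≤ 2 * Real.exp (-(s ^ 2 / 2)))
      fun j => prod_gaussian_linear_gt_le τ (w j) (c j) hs (hV j) (by
        simp only [V]; have : 0 < 1 / (D : ℝ) := by positivity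
        linarith)
    simpa using this
  calc _ ≤ promptLaw L D τ (Prod.fst ⁻¹' X ∪ (S \ Prod.fst ⁻¹' X)) :=
        measure_mono fun E hE => by by_cases h : E ∈ (Prod.fst ⁻¹' X : Set (Prompt L D)) <;> simp_all
    _ ≤ _ := (measure_union_le _ _).trans (add_le_add h1 h2)
    _ = _ := by rw [← ENNReal.ofReal_add (by positivity) (by positivity)]

/-! ### Rank-one matrices -/

theorem inner_outer_outer {D : ℕ} (a b c d : Vec D) :
    inner ℝ (outer a b) (outer c d) = inner ℝ a c * (inner ℝ b d : ℝ) := by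
  simp only [PiLp.inner_apply, outer, Fintype.sum_prod_type, Finset.sum_mul_sum]
  refine Finset.sum_congr rfl fun i _ => Finset.sum_congr rfl fun j _ => ?_
  simp; ring

theorem norm_outer {D : ℕ} (a b : Vec D) : ‖outer a b‖ = ‖a‖ * ‖b‖ := by
  rw [← sq_eq_sq₀ (norm_nonneg _) (by positivity), ← real_inner_self_eq_norm_sq, inner_outer_outer,
    real_inner_self_eq_norm_sq, real_inner_self_eq_norm_sq, mul_pow]

theorem outer_smul_right {D : ℕ} (c : ℝ) (a b : Vec D) : outer a (c • b) = c • outer a b := by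
  ext p; simp [outer]; ring

theorem feature_eq_outer {L D : ℕ} (E : Prompt L D) : feature E = outer (query E) (context E) := by
  rw [feature, context, outer_smul_right, query]

/-- The product of a matrix with a vector. -/
noncomputable def matVec {D : ℕ} (H : Mat D) (u : Vec D) : Vec D :=
  WithLp.toLp 2 fun i => ∑ j, H (i, j) * u j

/-- The `i`-th row of a matrix. -/
noncomputable def row {D : ℕ} (H : Mat D) (i : Fin D) : Vec D := WithLp.toLp 2 fun j => H (i, j)

@[fun_prop]
theorem measurable_matVec {D : ℕ} (H : Mat D) : Measurable (matVec H) := by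
  unfold matVec; fun_prop

theorem inner_outer_right {D : ℕ} (H : Mat D) (a b : Vec D) :
    inner ℝ H (outer a b) = (inner ℝ (matVec H b) a : ℝ) := by
  simp only [PiLp.inner_apply, outer, Fintype.sum_prod_type, matVec]
  refine Finset.sum_congr rfl fun i _ => ?_
  simp [Finset.mul_sum]
  exact Finset.sum_congr rfl fun j _ => by ring

theorem matVec_apply {D : ℕ} (H : Mat D) (u : Vec D) (i : Fin D) :
    matVec H u i = inner ℝ (row H i) u := by
  simp only [PiLp.inner_apply, row, matVec]
  exact Finset.sum_congr rfl fun j _ => by simp [mul_comm]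

theorem sum_norm_row_sq {D : ℕ} (H : Mat D) : ∑ i, ‖row H i‖ ^ 2 = ‖H‖ ^ 2 := by
  simp [EuclideanSpace.real_norm_sq_eq, row, Fintype.sum_prod_type]

/-- Near orthogonality of `u` to each row gains a factor `t` over Cauchy–Schwarz. In `⟨H, a uᵀ⟩ = ⟨H
u, a⟩` the independent direction `a` gains a second one. -/
theorem norm_matVec_le {D : ℕ} {H : Mat D} {u : Vec D} {t : ℝ} (ht : 0 ≤ t)
    (h : ∀ i, |inner ℝ (row H i) u| ≤ t * (‖row H i‖ * ‖u‖)) : ‖matVec H u‖ ≤ t * ‖H‖ * ‖u‖ := by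
  rw [← sq_le_sq₀ (norm_nonneg _) (by positivity), EuclideanSpace.real_norm_sq_eq]
  calc _ ≤ ∑ i, (t * (‖row H i‖ * ‖u‖)) ^ 2 := by
        refine Finset.sum_le_sum fun i _ => ?_
        rw [matVec_apply, ← sq_abs]
        gcongr
        exact h i
    _ = _ := by
        simp_rw [mul_pow, ← mul_assoc]
        rw [← Finset.sum_mul, ← Finset.mul_sum, sum_norm_row_sq]

/-- A fixed matrix is nearly orthogonal to the feature of a fresh prompt. -/
theorem promptLaw_inner_feature_gt_le {L D : ℕ} (hD : 0 < D) (τ : ℝ≥0) (H : Mat D) {t : ℝ}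
    (ht : 0 ≤ t) :
    promptLaw L D τ {E | t ^ 2 * (‖H‖ * ‖context E‖) < |inner ℝ H (feature E)|} ≤
      ENNReal.ofReal ((D + 1) * (2 * Real.exp (-(D * t ^ 2 / 4)))) := by
  have h1 := promptLaw_query_inner_gt_le (L := L) hD τ (measurable_matVec H) ht
  have h2 := measure_exists_le_card_mul (μ := promptLaw L D τ)
    (by positivity : 0 ≤ 2 * Real.exp (-(D * t ^ 2 / 4)))
    fun i => promptLaw_context_inner_gt_le (L := L) hD τ (row H i) ht
  rw [Fintype.card_fin] at h2
  rw [add_mul, one_mul, ENNReal.ofReal_add (by positivity) (by positivity)]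
  refine (measure_mono ?_).trans ((measure_union_le _ _).trans (add_le_add h2 h1))
  intro E hE
  by_contra hcon
  simp only [Set.mem_union, Set.mem_ofPred, not_or, not_exists, not_lt] at hcon hE
  rw [feature_eq_outer, inner_outer_right] at hE
  have h3 := norm_matVec_le ht hcon.1
  have h4 := hcon.2
  nlinarith [mul_le_mul_of_nonneg_left h3 ht]

/-- The norm of a combination of nearly orthogonal rank-one matrices. -/
theorem norm_sum_smul_outer_sq_le {D N : ℕ} {φ : Fin N → ℝ} {x u : Fin N → Vec D} {B U t : ℝ}
    (ht : 0 ≤ t) (hφ : ∀ k, |φ k| ≤ B) (hx : ∀ k, ‖x k‖ = 1) (hu : ∀ k, ‖u k‖ ≤ U)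
    (hxx : ∀ k k', k ≠ k' → |inner ℝ (x k) (x k')| ≤ t)
    (huu : ∀ k k', k ≠ k' → |inner ℝ (u k) (u k')| ≤ t * (‖u k‖ * ‖u k'‖)) :
    ‖∑ k, φ k • outer (x k) (u k)‖ ^ 2 ≤ B ^ 2 * U ^ 2 * (N + N ^ 2 * t ^ 2) := by
  -- Both factors of a rank-one matrix contribute a small cosine, so off-diagonal Gram entries are
  -- of order `t ^ 2`, not `t`.
  have hterm : ∀ k k', φ k * (φ k' * (inner ℝ (x k) (x k') * inner ℝ (u k) (u k'))) ≤
      B ^ 2 * U ^ 2 * ((if k = k' then 1 else 0) + t ^ 2) := fun k k' => by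
    have hB : 0 ≤ B := (abs_nonneg _).trans (hφ k)
    have hU : 0 ≤ U := (norm_nonneg _).trans (hu k)
    have hbb : |φ k| * |φ k'| ≤ B * B := mul_le_mul (hφ k) (hφ k') (abs_nonneg _) hB
    have huu' : ‖u k‖ * ‖u k'‖ ≤ U * U := mul_le_mul (hu k) (hu k') (norm_nonneg _) hU
    refine (le_abs_self _).trans ?_
    rw [abs_mul, abs_mul, abs_mul]
    by_cases h : k = k'
    · subst h
      have h1 : |inner ℝ (x k) (x k)| * |inner ℝ (u k) (u k)| ≤ U ^ 2 := by
        rw [real_inner_self_eq_norm_sq, real_inner_self_eq_norm_sq, hx]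
        simpa [abs_of_nonneg] using pow_le_pow_left₀ (norm_nonneg _) (hu k) 2
      calc _ = |φ k| * |φ k| * (|inner ℝ (x k) (x k)| * |inner ℝ (u k) (u k)|) := by ring
        _ ≤ B * B * U ^ 2 := by gcongr
        _ ≤ _ := by simp; nlinarith [mul_nonneg (mul_nonneg (sq_nonneg B) (sq_nonneg U)) (sq_nonneg t)]
    · have h1 : |inner ℝ (x k) (x k')| * |inner ℝ (u k) (u k')| ≤ t * (t * (U * U)) := by
        refine mul_le_mul (hxx k k' h) ((huu k k' h).trans ?_) (abs_nonneg _) ht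
        gcongr
      calc _ = |φ k| * |φ k'| * (|inner ℝ (x k) (x k')| * |inner ℝ (u k) (u k')|) := by ring
        _ ≤ B * B * (t * (t * (U * U))) := by gcongr
        _ = _ := by simp [h]; ring
  rw [← real_inner_self_eq_norm_sq, sum_inner]
  simp_rw [inner_sum, real_inner_smul_left, real_inner_smul_right, inner_outer_outer]
  calc _ ≤ ∑ k : Fin N, ∑ k' : Fin N, B ^ 2 * U ^ 2 * ((if k = k' then 1 else 0) + t ^ 2) :=
        Finset.sum_le_sum fun k _ => Finset.sum_le_sum fun k' _ => hterm k k'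
    _ = _ := by
        simp_rw [← Finset.mul_sum, Finset.sum_add_distrib, Finset.sum_ite_eq]
        simp; ring_nf; simp

/-! ### Clipping and projection -/

theorem clip_of_abs_le {B t : ℝ} (h : |t| ≤ B) : clip B t = t := by
  obtain ⟨h1, h2⟩ := abs_le.mp h
  simp [clip, h1, h2]

theorem abs_clip_le {B : ℝ} (hB : 0 ≤ B) (t : ℝ) : |clip B t| ≤ B :=
  abs_le.mpr (clip_nearest hB t).1

/-- Projection onto a centred ball is multiplication by a scalar in `[0, 1]`. This removes the
nonlinearity from the analysis of the algorithm. -/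
theorem abs_inner_proj_le {D : ℕ} {R : ℝ} (hR : 0 ≤ R) (X V : Mat D) :
    |inner ℝ (proj R X) V| ≤ |inner ℝ X V| := by
  have h0 : 0 ≤ min 1 (R / ‖X‖) := le_min zero_le_one (by positivity)
  rw [proj, real_inner_smul_left, abs_mul, abs_of_nonneg h0]
  exact mul_le_of_le_one_left (abs_nonneg _) (min_le_left _ _)

theorem clippedFeature_eq_proj {L D : ℕ} {B : ℝ} (G : ℝ) {E : Prompt L D}
    (h : ∀ i, |E.2 i| ≤ B) : clippedFeature B G E = proj G (feature E) := by
  simp only [clippedFeature, feature, clip_of_abs_le (h _)]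

/-! ### The ridge estimator -/

theorem ridge_spec {N L D : ℕ} {lam : ℝ} (hlam : 0 < lam) (hN : 0 < N) (E : Fin N → Prompt L D) :
    (lam * N) • ridge lam E + ∑ k, inner ℝ (ridge lam E) (feature (E k)) • feature (E k) =
      ∑ k, queryResponse (E k) • feature (E k) := by
  set M := ((lam * N) • (1 : Matrix (Fin D × Fin D) (Fin D × Fin D) ℝ)
        + ∑ k, Matrix.vecMulVec (feature (E k)).ofLp (feature (E k)).ofLp) with hM
  set b := ∑ k, queryResponse (E k) • (feature (E k)).ofLp with hb
  have hpos : M.PosDef := by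
    refine Matrix.PosDef.add_posSemidef (Matrix.PosDef.one.smul (by positivity)) ?_
    refine Matrix.posSemidef_sum _ fun k _ => ?_
    simpa using Matrix.posSemidef_vecMulVec_self_star (feature (E k)).ofLp
  have hr : (ridge lam E).ofLp = M⁻¹.mulVec b := rfl
  have h1 : M.mulVec (ridge lam E).ofLp = b := by
    rw [hr, Matrix.mulVec_mulVec, Matrix.mul_nonsing_inv _ ((Matrix.isUnit_iff_isUnit_det _).mp hpos.isUnit), Matrix.one_mulVec]
  apply (WithLp.linearEquiv 2 ℝ _).injective
  have h2 : ∀ k, Matrix.mulVec (Matrix.vecMulVec (feature (E k)).ofLp (feature (E k)).ofLp)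
      (ridge lam E).ofLp = (inner ℝ (ridge lam E) (feature (E k)) : ℝ) • (feature (E k)).ofLp :=
      fun k => by
    ext i
    simp only [Matrix.mulVec, Matrix.vecMulVec_apply, dotProduct, PiLp.inner_apply, Pi.smul_apply,
      smul_eq_mul, Finset.sum_mul]
    exact Finset.sum_congr rfl fun j _ => by simp; ring
  rw [hM, Matrix.add_mulVec, Matrix.smul_mulVec, Matrix.one_mulVec, Matrix.sum_mulVec] at h1
  simp_rw [h2] at h1
  simpa [hb] using h1

/-! ### Damped gradient iteration -/

section Damped

variable {E : Type*} [NormedAddCommGroup E] [InnerProductSpace ℝ E] {N : ℕ}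

/-- The linear part `X ↦ ρ X - β ∑_k ⟨X, Z_k⟩ Z_k` of a regularized gradient step. -/
noncomputable def damped (ρ β : ℝ) (Z : Fin N → E) (X : E) : E :=
  ρ • X - β • ∑ k, (inner ℝ X (Z k) : ℝ) • Z k

theorem inner_damped (ρ β : ℝ) (Z : Fin N → E) (X Y : E) :
    inner ℝ (damped ρ β Z X) Y = (inner ℝ X (damped ρ β Z Y) : ℝ) := by
  simp only [damped, inner_sub_left, inner_sub_right, real_inner_smul_left, real_inner_smul_right,
    sum_inner, inner_sum]
  congr 2
  refine Finset.sum_congr rfl fun k _ => ?_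
  rw [real_inner_comm Y (Z k)]; ring

theorem norm_sum_inner_smul_le {Z : Fin N → E} {U : ℝ} (hZ : ∀ k, ‖Z k‖ ≤ U) (X : E) :
    ‖∑ k, (inner ℝ X (Z k) : ℝ) • Z k‖ ≤ N * U ^ 2 * ‖X‖ := by
  calc _ ≤ ∑ _k : Fin N, U ^ 2 * ‖X‖ := by
        refine norm_sum_le_of_le _ fun k _ => ?_
        rw [norm_smul]
        have hU : 0 ≤ U := (norm_nonneg _).trans (hZ k)
        calc _ ≤ (‖X‖ * ‖Z k‖) * ‖Z k‖ := by
              gcongr; exact norm_inner_le_norm _ _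
          _ ≤ (‖X‖ * U) * U := by gcongr <;> exact hZ k
          _ = _ := by ring
    _ = _ := by simp; ring

variable {ρ β q U : ℝ} {Z : Fin N → E}

theorem norm_damped_le (hρ : 0 ≤ ρ) (hβ : 0 ≤ β) (hZ : ∀ k, ‖Z k‖ ≤ U)
    (hq : ρ + β * (N * U ^ 2) ≤ q) (X : E) : ‖damped ρ β Z X‖ ≤ q * ‖X‖ := by
  calc _ ≤ ‖ρ • X‖ + ‖β • ∑ k, (inner ℝ X (Z k) : ℝ) • Z k‖ := norm_sub_le _ _
    _ ≤ ρ * ‖X‖ + β * (N * U ^ 2 * ‖X‖) := by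
        rw [norm_smul, norm_smul, Real.norm_of_nonneg hρ, Real.norm_of_nonneg hβ]
        gcongr
        exact norm_sum_inner_smul_le hZ X
    _ = (ρ + β * (N * U ^ 2)) * ‖X‖ := by ring
    _ ≤ _ := by gcongr

theorem norm_damped_iterate_le (hρ : 0 ≤ ρ) (hβ : 0 ≤ β) (hZ : ∀ k, ‖Z k‖ ≤ U)
    (hq : ρ + β * (N * U ^ 2) ≤ q) (X : E) (j : ℕ) : ‖(damped ρ β Z)^[j] X‖ ≤ q ^ j * ‖X‖ := by
  have hq0 : 0 ≤ q := le_trans (by positivity) hq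
  induction j with
  | zero => simp
  | succ j ih =>
    rw [Function.iterate_succ_apply']
    refine (norm_damped_le hρ hβ hZ hq _).trans ?_
    rw [pow_succ', mul_assoc]
    gcongr

/-- The iterates of the linear part are close to multiples of the starting point. -/
theorem norm_damped_iterate_sub_le (hρ : 0 ≤ ρ) (hβ : 0 ≤ β) (hZ : ∀ k, ‖Z k‖ ≤ U)
    (hq : ρ + β * (N * U ^ 2) ≤ q) (hq2 : 1 / 2 ≤ q) (X : E) (j : ℕ) :
    ‖(damped ρ β Z)^[j] X - ρ ^ j • X‖ ≤ 2 * j * q ^ j * (β * (N * U ^ 2)) * ‖X‖ := by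
  have hρq : ρ ≤ q := le_trans (by have : 0 ≤ β * (N * U ^ 2) := by positivity
                                   linarith) hq
  induction j with
  | zero => simp
  | succ j ih =>
    set Y := (damped ρ β Z)^[j] X with hY
    have hYn := norm_damped_iterate_le hρ hβ hZ hq X j
    have e1 : (damped ρ β Z)^[j + 1] X - ρ ^ (j + 1) • X =
        ρ • (Y - ρ ^ j • X) - β • ∑ k, (inner ℝ Y (Z k) : ℝ) • Z k := by
      rw [Function.iterate_succ_apply', ← hY, damped, smul_sub, smul_smul, pow_succ']
      abel
    rw [e1]
    have hb : 0 ≤ β * (N * U ^ 2) := by positivity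
    have hqj : 0 ≤ q ^ j := by positivity
    calc _ ≤ ‖ρ • (Y - ρ ^ j • X)‖ + ‖β • ∑ k, (inner ℝ Y (Z k) : ℝ) • Z k‖ := norm_sub_le _ _
      _ ≤ q * (2 * j * q ^ j * (β * (N * U ^ 2)) * ‖X‖) + β * (N * U ^ 2 * (q ^ j * ‖X‖)) := by
          rw [norm_smul, norm_smul, Real.norm_of_nonneg hρ, Real.norm_of_nonneg hβ]
          gcongr
          exact (norm_sum_inner_smul_le hZ Y).trans (by gcongr)
      _ = (2 * j * q * q ^ j + q ^ j) * (β * (N * U ^ 2)) * ‖X‖ := by ring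
      -- Here `1 ≤ 2 * q` supplies the missing factor `q`; this is the origin of the constant `2`.
      _ ≤ (2 * j * q * q ^ j + 2 * q * q ^ j) * (β * (N * U ^ 2)) * ‖X‖ := by
          gcongr; nlinarith
      _ = _ := by push_cast; ring

end Damped

theorem sum_pow_rev_mul_le {ρ : ℝ} (h0 : 0 ≤ ρ) (h1 : ρ < 1) (T : ℕ) :
    ∑ t : Fin T, ρ ^ (t.rev : ℕ) ≤ 1 / (1 - ρ) := by
  have e : ∑ t : Fin T, ρ ^ (t.rev : ℕ) = ∑ t : Fin T, ρ ^ (t : ℕ) :=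
    Equiv.sum_comp Fin.revPerm fun t : Fin T => ρ ^ (t : ℕ)
  rw [e, Fin.sum_univ_eq_sum_range (fun t => ρ ^ t), le_div_iff₀ (by linarith)]
  have := geom_sum_mul_neg ρ T
  rw [this]
  have : 0 ≤ ρ ^ T := by positivity
  linarith

theorem sum_succ_mul_pow_rev_le {q : ℝ} (h0 : 0 ≤ q) (h1 : q < 1) (T : ℕ) :
    ∑ t : Fin T, ((t.rev : ℕ) + 1 : ℝ) * q ^ (t.rev : ℕ) ≤ 1 / (1 - q) ^ 2 := by
  have e : ∑ t : Fin T, ((t.rev : ℕ) + 1 : ℝ) * q ^ (t.rev : ℕ) =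
      ∑ t : Fin T, (((t : ℕ) : ℝ) + 1) * q ^ (t : ℕ) :=
    Equiv.sum_comp Fin.revPerm fun t : Fin T => (((t : ℕ) : ℝ) + 1) * q ^ (t : ℕ)
  rw [e, Fin.sum_univ_eq_sum_range (fun t => ((t : ℝ) + 1) * q ^ t), le_div_iff₀ (by nlinarith)]
  have h : ∀ T : ℕ, (∑ t ∈ Finset.range T, ((t : ℝ) + 1) * q ^ t) * (1 - q) ^ 2 =
      1 - q ^ T * (1 + T * (1 - q)) := fun T => by
    induction T with
    | zero => simp
    | succ T ih => rw [Finset.sum_range_succ, add_mul, ih]; push_cast; ring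
  rw [h]
  have : 0 ≤ q ^ T * (1 + T * (1 - q)) := by
    have : 0 ≤ 1 - q := by linarith
    positivity
  linarith

/-! ### Unrolling the private algorithm -/

section Unroll

variable {N L D : ℕ} (B G R lam η₀ : ℝ) (E : Fin N → Prompt L D)

/-- The linear part of an update of the private algorithm. -/
noncomputable def linearPart : Mat D → Mat D :=
  damped (1 - 2 * lam * η₀) (η₀ * (N : ℝ)⁻¹) fun k => clippedFeature B G (E k)

/-- The moment `∑_k clip_B(y_k) Z̃_k`. -/
noncomputable def clippedMoment : Mat D :=
  ∑ k, clip B (queryResponse (E k)) • clippedFeature B G (E k)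

theorem step_eq (Γ z : Mat D) : step B G R lam η₀ E Γ z =
    proj R (linearPart B G lam η₀ E Γ + (η₀ * (N : ℝ)⁻¹) • clippedMoment B G E + z) := by
  rw [step, linearPart, damped, clippedMoment]
  congr 2
  simp_rw [sub_smul, Finset.sum_sub_distrib]
  rw [smul_sub]; abel

/-- Peel off the last update: discard its projection, move its self-adjoint linear part onto `V`,
and apply the induction hypothesis to the moved vector. The noise of step `t` then meets the iterate
of order `t.rev`, the number of updates still to come. -/
theorem abs_inner_noisyHead_le {R : ℝ} (hR : 0 ≤ R) (Γ₀ V : Mat D) {T : ℕ} (z : Fin T → Mat D) :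
    |inner ℝ (noisyHead B G R lam η₀ Γ₀ E z) V| ≤
      |inner ℝ Γ₀ ((linearPart B G lam η₀ E)^[T] V)| +
      ∑ t : Fin T, (|inner ℝ ((η₀ * (N : ℝ)⁻¹) • clippedMoment B G E)
          ((linearPart B G lam η₀ E)^[(t.rev : ℕ)] V)| +
        |inner ℝ (z t) ((linearPart B G lam η₀ E)^[(t.rev : ℕ)] V)|) := by
  induction T generalizing V with
  | zero => simp [noisyHead]
  | succ T ih =>
    have h1 : noisyHead B G R lam η₀ Γ₀ E z = step B G R lam η₀ E
        (noisyHead B G R lam η₀ Γ₀ E fun t => z t.castSucc) (z (Fin.last T)) := by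
      rw [noisyHead, Fin.foldl_succ_last, noisyHead]
    rw [h1, step_eq, Fin.sum_univ_castSucc]
    refine (abs_inner_proj_le hR _ _).trans ?_
    rw [inner_add_left, inner_add_left, linearPart, inner_damped, ← linearPart]
    refine (abs_add_le _ _).trans ?_
    have h2 := ih (linearPart B G lam η₀ E V) fun t => z t.castSucc
    have h3 := abs_add_le (inner ℝ (noisyHead B G R lam η₀ Γ₀ E fun t => z t.castSucc)
      (linearPart B G lam η₀ E V)) (inner ℝ ((η₀ * (N : ℝ)⁻¹) • clippedMoment B G E) V)
    simp_rw [← Function.iterate_succ_apply] at h2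
    simp only [Fin.rev_castSucc, Fin.val_succ, Fin.rev_last, Fin.val_zero,
      Function.iterate_zero, id] 
    linarith

end Unroll

/-! ### Deterministic bounds on the two predictions -/

theorem norm_sum_smul_le {E : Type*} [NormedAddCommGroup E] [NormedSpace ℝ E] {N : ℕ}
    {φ : Fin N → ℝ} {Z : Fin N → E} {B U : ℝ} (hφ : ∀ k, |φ k| ≤ B) (hZ : ∀ k, ‖Z k‖ ≤ U) :
    ‖∑ k, φ k • Z k‖ ≤ N * (B * U) := by
  calc _ ≤ ∑ _k : Fin N, B * U := by
        refine norm_sum_le_of_le _ fun k _ => ?_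
        rw [norm_smul]
        exact mul_le_mul (hφ k) (hZ k) (norm_nonneg _) ((abs_nonneg _).trans (hφ k))
    _ = _ := by simp

/-- The data term has two estimates. Contraction alone gives `B U² / λ`. Replacing the linear part
by the scalar `ρ` gives the inner product of the moment with `Z`, up to an error of higher order in
`U ^ 2 / λ`. The noise hypothesis grows linearly in the remaining time, which the geometric decay
absorbs. -/
theorem abs_inner_noisyHead_le_of_bounds {N L D T : ℕ} {B G R lam η₀ U s : ℝ}
    {E : Fin N → Prompt L D} {Γ₀ Z : Mat D} {z : Fin T → Mat D} (hN : 0 < N) (hR : 0 ≤ R)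
    (hB : 0 ≤ B) (hlam : 0 < lam) (hη : 0 < η₀) (hlη : lam * η₀ ≤ 1 / 4) (hs : 0 ≤ s)
    (hUl : U ^ 2 ≤ lam) (hE : ∀ k, ‖clippedFeature B G (E k)‖ ≤ U) (hZ : ‖Z‖ ≤ U) (hΓ : ‖Γ₀‖ ≤ R)
    (hz : ∀ t, |inner ℝ (z t) ((linearPart B G lam η₀ E)^[(t.rev : ℕ)] Z)| ≤
      ((t.rev : ℕ) + 1) * s * ‖(linearPart B G lam η₀ E)^[(t.rev : ℕ)] Z‖) :
    |inner ℝ (noisyHead B G R lam η₀ Γ₀ E z) Z| ≤ (1 - η₀ * lam) ^ T * (R * U) +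
      min (B * U ^ 2 / lam) (|inner ℝ (clippedMoment B G E) Z| / (lam * N) +
        2 * (B * U ^ 4) / lam ^ 2) + s * U / (lam * η₀) ^ 2 := by
  set A := linearPart B G lam η₀ E with hA
  set b := (η₀ * (N : ℝ)⁻¹) • clippedMoment B G E with hb
  set q := 1 - η₀ * lam with hq
  set ρ := 1 - 2 * lam * η₀ with hρ
  have hU : 0 ≤ U := (norm_nonneg _).trans hZ
  have hN' : (0 : ℝ) < N := by exact_mod_cast hN
  have hlη0 : 0 < lam * η₀ := by positivity
  have hq0 : 1 / 2 ≤ q := by rw [hq]; linarith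
  have hq1 : q < 1 := by rw [hq]; linarith
  have hρ0 : 0 ≤ ρ := by rw [hρ]; linarith
  have hρ1 : ρ < 1 := by rw [hρ]; linarith
  have hβ : 0 ≤ η₀ * (N : ℝ)⁻¹ := by positivity
  have hβU : η₀ * (N : ℝ)⁻¹ * (N * U ^ 2) = η₀ * U ^ 2 := by field_simp
  -- The penalty shrinks by `2 * lam * η₀`; the data term can undo at most half of it, leaving the
  -- contraction factor `q`.
  have hηU : η₀ * U ^ 2 ≤ η₀ * lam := by gcongr
  have hρq : ρ + η₀ * (N : ℝ)⁻¹ * (N * U ^ 2) ≤ q := by rw [hβU, hρ, hq]; linarith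
  have hAn : ∀ j : ℕ, ‖A^[j] Z‖ ≤ q ^ j * U := fun j =>
    (norm_damped_iterate_le hρ0 hβ hE hρq Z j).trans (by gcongr)
  have hbn : ‖b‖ ≤ η₀ * (B * U) := by
    rw [hb, norm_smul, Real.norm_of_nonneg hβ]
    calc _ ≤ η₀ * (N : ℝ)⁻¹ * (N * (B * U)) := by
          gcongr
          exact norm_sum_smul_le (fun k => abs_clip_le hB _) hE
      _ = _ := by field_simp
  have h1q : 1 - q = lam * η₀ := by rw [hq]; ring
  have h1ρ : 1 - ρ = 2 * (lam * η₀) := by rw [hρ]; ring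
  have hsum1 : ∑ t : Fin T, |inner ℝ b (A^[(t.rev : ℕ)] Z)| ≤ B * U ^ 2 / lam := by
    calc _ ≤ ∑ t : Fin T, η₀ * (B * U) * U * q ^ (t.rev : ℕ) := by
          refine Finset.sum_le_sum fun t _ => ?_
          calc _ ≤ ‖b‖ * ‖A^[(t.rev : ℕ)] Z‖ := abs_real_inner_le_norm _ _
            _ ≤ η₀ * (B * U) * (q ^ (t.rev : ℕ) * U) := by gcongr; exact hAn _
            _ = _ := by ring
      _ ≤ η₀ * (B * U) * U * (1 / (1 - q)) := by
          rw [← Finset.mul_sum]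
          gcongr
          exact sum_pow_rev_mul_le (by linarith) hq1 T
      _ = _ := by rw [h1q]; field_simp
  have hsum2 : ∑ t : Fin T, |inner ℝ b (A^[(t.rev : ℕ)] Z)| ≤
      |inner ℝ (clippedMoment B G E) Z| / (lam * N) + 2 * (B * U ^ 4) / lam ^ 2 := by
    calc _ ≤ ∑ t : Fin T, (|inner ℝ b Z| * ρ ^ (t.rev : ℕ) +
          2 * (η₀ * U ^ 2) * (η₀ * (B * U)) * U * (((t.rev : ℕ) + 1 : ℝ) * q ^ (t.rev : ℕ))) := by
          refine Finset.sum_le_sum fun t _ => ?_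
          set j := (t.rev : ℕ)
          have e : inner ℝ b (A^[j] Z) = ρ ^ j * inner ℝ b Z + inner ℝ b (A^[j] Z - ρ ^ j • Z) := by
            rw [inner_sub_right, real_inner_smul_right]; ring
          have h1 := norm_damped_iterate_sub_le hρ0 hβ hE hρq hq0 Z j
          rw [hβU] at h1
          have h2 : |inner ℝ b (A^[j] Z - ρ ^ j • Z)| ≤
              η₀ * (B * U) * (2 * ((j : ℝ) + 1) * q ^ j * (η₀ * U ^ 2) * U) := by
            refine (abs_real_inner_le_norm _ _).trans ?_
            refine mul_le_mul hbn (h1.trans ?_) (norm_nonneg _) (by positivity)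
            have : 0 ≤ q := by linarith
            gcongr
            linarith
          rw [e]
          refine (abs_add_le _ _).trans ?_
          rw [abs_mul, abs_of_nonneg (by positivity : 0 ≤ ρ ^ j)]
          linarith
      _ ≤ |inner ℝ b Z| * (1 / (1 - ρ)) +
          2 * (η₀ * U ^ 2) * (η₀ * (B * U)) * U * (1 / (1 - q) ^ 2) := by
          rw [Finset.sum_add_distrib, ← Finset.mul_sum, ← Finset.mul_sum]
          gcongr
          · exact sum_pow_rev_mul_le hρ0 hρ1 T
          · exact sum_succ_mul_pow_rev_le (by linarith) hq1 T
      _ = |inner ℝ (clippedMoment B G E) Z| / (2 * (lam * N)) + 2 * (B * U ^ 4) / lam ^ 2 := by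
          rw [h1q, h1ρ, hb, real_inner_smul_left, abs_mul, abs_of_nonneg hβ]
          field_simp
      _ ≤ _ := by
          have : 0 < lam * N := by positivity
          exact add_le_add (div_le_div_of_nonneg_left (abs_nonneg _) this (by linarith)) le_rfl
  have hsum3 : ∑ t : Fin T, |inner ℝ (z t) (A^[(t.rev : ℕ)] Z)| ≤ s * U / (lam * η₀) ^ 2 := by
    calc _ ≤ ∑ t : Fin T, s * U * (((t.rev : ℕ) + 1 : ℝ) * q ^ (t.rev : ℕ)) := by
          refine Finset.sum_le_sum fun t _ => (hz t).trans ?_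
          calc _ ≤ (((t.rev : ℕ) : ℝ) + 1) * s * (q ^ (t.rev : ℕ) * U) := by gcongr; exact hAn _
            _ = _ := by ring
      _ ≤ s * U * (1 / (1 - q) ^ 2) := by
          rw [← Finset.mul_sum]
          gcongr
          exact sum_succ_mul_pow_rev_le (by linarith) hq1 T
      _ = _ := by rw [h1q]; ring
  have h0 : |inner ℝ Γ₀ (A^[T] Z)| ≤ q ^ T * (R * U) := by
    calc _ ≤ ‖Γ₀‖ * ‖A^[T] Z‖ := abs_real_inner_le_norm _ _
      _ ≤ R * (q ^ T * U) := by gcongr; exact hAn _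
      _ = _ := by ring
  refine (abs_inner_noisyHead_le B G lam η₀ E hR Γ₀ Z z).trans ?_
  rw [Finset.sum_add_distrib]
  have := le_min hsum1 hsum2
  linarith

/-- Pairing the normal equation with the estimator and dropping the nonnegative quadratic term gives
`‖Γ‖ ≤ B U / λ`, hence the first bound. Pairing it with `Z` and treating the data term as a
perturbation gives the second. -/
theorem abs_inner_ridge_le_of_bounds {N L D : ℕ} {B lam U : ℝ} {E : Fin N → Prompt L D} {Z : Mat D}
    (hN : 0 < N) (hlam : 0 < lam) (hy : ∀ k, |queryResponse (E k)| ≤ B)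
    (hE : ∀ k, ‖feature (E k)‖ ≤ U) (hZ : ‖Z‖ ≤ U) :
    |inner ℝ (ridge lam E) Z| ≤ min (B * U ^ 2 / lam)
      (|inner ℝ (∑ k, queryResponse (E k) • feature (E k)) Z| / (lam * N) +
        B * U ^ 4 / lam ^ 2) := by
  have hN' : (0 : ℝ) < N := by exact_mod_cast hN
  have hU : 0 ≤ U := (norm_nonneg _).trans hZ
  have hlN : 0 < lam * N := by positivity
  have hB : 0 ≤ B := (abs_nonneg _).trans (hy ⟨0, hN⟩)
  have hspec := ridge_spec hlam hN E
  set Γ := ridge lam E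
  set H := ∑ k, queryResponse (E k) • feature (E k) with hH
  have hHn : ‖H‖ ≤ N * (B * U) := norm_sum_smul_le hy hE
  have hΓn : ‖Γ‖ ≤ B * U / lam := by
    have h1 : lam * N * ‖Γ‖ ^ 2 ≤ ‖Γ‖ * ‖H‖ := by
      calc _ ≤ inner ℝ Γ H := by
            rw [← hspec, inner_add_right, real_inner_smul_right, real_inner_self_eq_norm_sq,
              inner_sum]
            have : 0 ≤ ∑ k, inner ℝ Γ ((inner ℝ Γ (feature (E k)) : ℝ) • feature (E k)) :=
              Finset.sum_nonneg fun k _ => by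
                rw [real_inner_smul_right]; exact mul_self_nonneg _
            linarith
        _ ≤ _ := real_inner_le_norm _ _
    rcases (norm_nonneg Γ).eq_or_lt with h0 | h0
    · rw [← h0]; positivity
    · rw [le_div_iff₀ hlam]
      have h2 : lam * N * ‖Γ‖ ≤ N * (B * U) := by
        refine le_trans ?_ hHn
        refine le_of_mul_le_mul_left ?_ h0
        linarith
      refine le_of_mul_le_mul_left ?_ hN'
      linarith
  refine le_min ?_ ?_
  · calc _ ≤ ‖Γ‖ * ‖Z‖ := abs_real_inner_le_norm _ _
      _ ≤ B * U / lam * U := by gcongr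
      _ = _ := by ring
  · have h1 : lam * N * inner ℝ Γ Z = inner ℝ H Z -
        inner ℝ (∑ k, (inner ℝ Γ (feature (E k)) : ℝ) • feature (E k)) Z := by
      rw [← hspec, inner_add_left, real_inner_smul_left]; ring
    have h2 : |inner ℝ (∑ k, (inner ℝ Γ (feature (E k)) : ℝ) • feature (E k)) Z| ≤
        N * U ^ 2 * (B * U / lam) * U := by
      refine (abs_real_inner_le_norm _ _).trans ?_
      gcongr
      exact (norm_sum_inner_smul_le hE Γ).trans (by gcongr)
    have h3 : lam * N * |inner ℝ Γ Z| ≤ |inner ℝ H Z| + N * U ^ 2 * (B * U / lam) * U := by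
      have e : lam * N * |inner ℝ Γ Z| = |lam * N * inner ℝ Γ Z| := by
        rw [abs_mul, abs_of_pos hlN]
      rw [e, h1]
      exact (abs_sub _ _).trans (add_le_add le_rfl h2)
    calc |inner ℝ Γ Z| ≤ (|inner ℝ H Z| + N * U ^ 2 * (B * U / lam) * U) / (lam * N) := by
          rw [le_div_iff₀ hlN]; linarith
      _ = _ := by field_simp

/-! ### The good event -/

/-- The moment `∑_k y_k Z_k`. -/
noncomputable def rawMoment {N L D : ℕ} (E : Fin N → Prompt L D) : Mat D :=
  ∑ k, queryResponse (E k) • feature (E k)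

/-- The training prompts are bounded and pairwise nearly orthogonal. -/
structure GoodTraining {N L D : ℕ} (B U t : ℝ) (E : Fin N → Prompt L D) : Prop where
  response : ∀ k i, |(E k).2 i| ≤ B
  norm_query : ∀ k, ‖query (E k)‖ = 1
  norm_context : ∀ k, ‖context (E k)‖ ≤ U
  inner_query : ∀ k k', k ≠ k' → |inner ℝ (query (E k)) (query (E k'))| ≤ t
  inner_context : ∀ k k', k ≠ k' → |inner ℝ (context (E k)) (context (E k'))| ≤
    t * (‖context (E k)‖ * ‖context (E k')‖)

/-- The test prompt is bounded and nearly orthogonal to the matrix `H`. -/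
structure GoodTest {L D : ℕ} (U t : ℝ) (H : Mat D) (E : Prompt L D) : Prop where
  norm_query : ‖query E‖ = 1
  norm_context : ‖context E‖ ≤ U
  inner_feature : |inner ℝ H (feature E)| ≤ t ^ 2 * (‖H‖ * ‖context E‖)

theorem GoodTest.norm_feature {L D : ℕ} {U t : ℝ} {H : Mat D} {E : Prompt L D}
    (h : GoodTest U t H E) : ‖feature E‖ ≤ U := by
  rw [feature_eq_outer, norm_outer, h.norm_query, one_mul]; exact h.norm_context

section

variable {N L D : ℕ} {B G U t : ℝ} {E : Fin N → Prompt L D}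

theorem GoodTraining.norm_feature (h : GoodTraining B U t E) (k : Fin N) :
    ‖feature (E k)‖ ≤ U := by
  rw [feature_eq_outer, norm_outer, h.norm_query, one_mul]; exact h.norm_context k

/-- Arbitrary bounded coefficients are allowed so that one estimate serves both the raw and the
clipped moment. -/
theorem GoodTraining.norm_combination_le (h : GoodTraining B U t E) (hN : 0 < N) (ht : 0 ≤ t)
    (hNt : 1 ≤ N * t ^ 2) {φ : Fin N → ℝ} (hφ : ∀ k, |φ k| ≤ B) :
    ‖∑ k, φ k • feature (E k)‖ ≤ 2 * (N * B * t * U) := by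
  have hB : 0 ≤ B := (abs_nonneg _).trans (hφ ⟨0, hN⟩)
  have hU : 0 ≤ U := (norm_nonneg _).trans (h.norm_context ⟨0, hN⟩)
  have h1 := norm_sum_smul_outer_sq_le ht hφ h.norm_query h.norm_context h.inner_query
    h.inner_context
  simp_rw [← feature_eq_outer] at h1
  rw [← sq_le_sq₀ (norm_nonneg _) (by positivity)]
  refine h1.trans ?_
  -- `N t² ≥ 1` lets the off-diagonal part of the Gram sum absorb the diagonal one.
  have h2 : (N : ℝ) ≤ N ^ 2 * t ^ 2 := by
    have : (N : ℝ) * 1 ≤ N * (N * t ^ 2) := by gcongr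
    linarith
  calc _ ≤ B ^ 2 * U ^ 2 * (N ^ 2 * t ^ 2 + N ^ 2 * t ^ 2) := by gcongr
    _ ≤ _ := by
      have : 0 ≤ B ^ 2 * U ^ 2 * (N ^ 2 * t ^ 2) := by positivity
      nlinarith

theorem GoodTraining.norm_rawMoment_le (h : GoodTraining B U t E) (hN : 0 < N) (ht : 0 ≤ t)
    (hNt : 1 ≤ N * t ^ 2) : ‖rawMoment E‖ ≤ 2 * (N * B * t * U) :=
  h.norm_combination_le hN ht hNt fun k => h.response k _

/-- On the good event no response is clipped. The projection of a feature may still act, but only as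
a scalar at most `1`, which is absorbed in the coefficient. -/
theorem GoodTraining.norm_clippedMoment_le (h : GoodTraining B U t E) (hN : 0 < N) (ht : 0 ≤ t)
    (hNt : 1 ≤ N * t ^ 2) (hG : 0 ≤ G) : ‖clippedMoment B G E‖ ≤ 2 * (N * B * t * U) := by
  have hB : 0 ≤ B := (abs_nonneg _).trans (h.response ⟨0, hN⟩ 0)
  have e : clippedMoment B G E =
      ∑ k, (clip B (queryResponse (E k)) * min 1 (G / ‖feature (E k)‖)) • feature (E k) := by
    refine Finset.sum_congr rfl fun k _ => ?_
    rw [clippedFeature_eq_proj G (h.response k), proj, smul_smul]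
  rw [e]
  refine h.norm_combination_le hN ht hNt fun k => ?_
  have h0 : 0 ≤ min 1 (G / ‖feature (E k)‖) := le_min zero_le_one (by positivity)
  rw [abs_mul, abs_of_nonneg h0]
  exact (mul_le_of_le_one_right (abs_nonneg _) (min_le_left _ _)).trans (abs_clip_le hB _)

/-- The difference of the two predictions on the good event. -/
theorem abs_inner_sub_le_of_good {T : ℕ} {R lam η₀ s : ℝ} {Γ₀ : Mat D} {E' : Prompt L D}
    {z : Fin T → Mat D} (hN : 0 < N) (hR : 0 ≤ R) (hlam : 0 < lam) (hη : 0 < η₀)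
    (hlη : lam * η₀ ≤ 1 / 4) (hs : 0 ≤ s) (hUl : U ^ 2 ≤ lam) (hG : 0 ≤ G) (hGU : G ≤ U)
    (hΓ : ‖Γ₀‖ ≤ R) (ht : 0 ≤ t) (hNt : 1 ≤ N * t ^ 2) (hE : GoodTraining B U t E)
    (hE₁ : GoodTest U t (rawMoment E) E') (hE₂ : GoodTest U t (clippedMoment B G E) E')
    (hz : ∀ i, |inner ℝ (z i) ((linearPart B G lam η₀ E)^[(i.rev : ℕ)] (feature E'))| ≤
      ((i.rev : ℕ) + 1) * s * ‖(linearPart B G lam η₀ E)^[(i.rev : ℕ)] (feature E')‖) :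
    |inner ℝ (noisyHead B G R lam η₀ Γ₀ E z) (feature E') - inner ℝ (ridge lam E) (feature E')| ≤
      (1 - η₀ * lam) ^ T * (R * U) + 2 * min (B * U ^ 2 / lam)
        (2 * (B * t ^ 3 * U ^ 2) / lam + 2 * (B * U ^ 4) / lam ^ 2) +
        s * U / (lam * η₀) ^ 2 := by
  have hN' : (0 : ℝ) < N := by exact_mod_cast hN
  have hB : 0 ≤ B := (abs_nonneg _).trans (hE.response ⟨0, hN⟩ 0)
  have hU : 0 ≤ U := hG.trans hGU
  have hlN : 0 < lam * N := by positivity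
  have h1 := abs_inner_noisyHead_le_of_bounds hN hR hB hlam hη hlη hs hUl
    (fun k => (proj_nearest hG _).1.trans hGU) hE₁.norm_feature hΓ hz
  have h2 := abs_inner_ridge_le_of_bounds hN hlam (fun k => hE.response k _) hE.norm_feature
    hE₁.norm_feature
  have hF : ∀ H : Mat D, GoodTest U t H E' → ‖H‖ ≤ 2 * (N * B * t * U) →
      |inner ℝ H (feature E')| / (lam * N) ≤ 2 * (B * t ^ 3 * U ^ 2) / lam := by
    intro H hH hHn
    rw [div_le_div_iff₀ hlN hlam]
    calc _ ≤ t ^ 2 * (2 * (N * B * t * U) * U) * lam := by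
          gcongr
          exact hH.inner_feature.trans (by gcongr; exact hH.norm_context)
      _ = _ := by ring
  have hF1 := hF _ hE₁ (hE.norm_rawMoment_le hN ht hNt)
  have hF2 := hF _ hE₂ (hE.norm_clippedMoment_le hN ht hNt hG)
  rw [rawMoment] at hF1
  have h5 : 0 ≤ B * U ^ 4 / lam ^ 2 := by positivity
  have h6 : 2 * (B * U ^ 4) / lam ^ 2 = 2 * (B * U ^ 4 / lam ^ 2) := by ring
  have h3 : min (B * U ^ 2 / lam) (|inner ℝ (clippedMoment B G E) (feature E')| / (lam * N) +
        2 * (B * U ^ 4) / lam ^ 2) ≤ min (B * U ^ 2 / lam)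
        (2 * (B * t ^ 3 * U ^ 2) / lam + 2 * (B * U ^ 4) / lam ^ 2) :=
    min_le_min le_rfl (by linarith)
  have h4 : min (B * U ^ 2 / lam) (|inner ℝ (∑ k, queryResponse (E k) • feature (E k))
        (feature E')| / (lam * N) + B * U ^ 4 / lam ^ 2) ≤ min (B * U ^ 2 / lam)
        (2 * (B * t ^ 3 * U ^ 2) / lam + 2 * (B * U ^ 4) / lam ^ 2) :=
    min_le_min le_rfl (by linarith)
  refine (abs_sub _ _).trans ?_
  linarith

end

/-! ### Measurability -/

@[fun_prop]
theorem measurable_outer {D : ℕ} : Measurable fun p : Vec D × Vec D => outer p.1 p.2 := by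
  unfold outer; fun_prop

@[fun_prop]
theorem measurable_feature {L D : ℕ} : Measurable (feature : Prompt L D → Mat D) := by
  have : (feature : Prompt L D → Mat D) = fun E => outer (query E) (context E) :=
    funext feature_eq_outer
  rw [this]
  exact measurable_outer.comp (by fun_prop : Measurable fun E : Prompt L D => (query E, context E))

theorem measurable_proj {D : ℕ} (R : ℝ) : Measurable (proj R : Mat D → Mat D) := by
  unfold proj; fun_prop

@[fun_prop]
theorem measurable_clip (B : ℝ) : Measurable (clip B) := by
  unfold clip; fun_prop

@[fun_prop]
theorem measurable_clippedFeature {L D : ℕ} (B G : ℝ) :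
    Measurable (clippedFeature B G : Prompt L D → Mat D) := by
  have h := measurable_outer.comp (by fun_prop : Measurable fun E : Prompt L D =>
    (E.1 (Fin.last L), ∑ i : Fin L, clip B (E.2 i.castSucc) • E.1 i.castSucc))
  exact (measurable_proj G).comp (h.const_smul ((L : ℝ)⁻¹))

@[fun_prop]
theorem measurable_rawMoment {N L D : ℕ} :
    Measurable (rawMoment : (Fin N → Prompt L D) → Mat D) := by
  unfold rawMoment; fun_prop

@[fun_prop]
theorem measurable_clippedMoment {N L D : ℕ} (B G : ℝ) :
    Measurable (clippedMoment B G : (Fin N → Prompt L D) → Mat D) := by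
  unfold clippedMoment; fun_prop

theorem measurable_linearPart_iterate {Ω : Type*} [MeasurableSpace Ω] {N L D : ℕ}
    (B G lam η₀ : ℝ) {f : Ω → Fin N → Prompt L D} {g : Ω → Mat D} (hf : Measurable f)
    (hg : Measurable g) (j : ℕ) :
    Measurable fun ω => (linearPart B G lam η₀ (f ω))^[j] (g ω) := by
  have h : ∀ V : Ω → Mat D, Measurable V →
      Measurable fun ω => linearPart B G lam η₀ (f ω) (V ω) := fun V hV => by
    unfold linearPart damped; fun_prop
  induction j with
  | zero => exact hg
  | succ j ih =>
    simp_rw [Function.iterate_succ_apply']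
    exact h _ ih

/-! ### Probability of the good event -/

theorem isProbabilityMeasure_noiseLaw (D : ℕ) (v : ℝ) : IsProbabilityMeasure (noiseLaw D v) :=
  Measure.isProbabilityMeasure_map (by fun_prop)

theorem noiseLaw_inner_gt_le {D : ℕ} (v : ℝ) (V : Mat D) {r : ℝ} (hr : 0 ≤ r) :
    noiseLaw D v {g | r * Real.sqrt v * ‖V‖ < |inner ℝ g V|} ≤
      ENNReal.ofReal (2 * Real.exp (-(r ^ 2 / 2))) := by
  rw [noiseLaw, Measure.map_apply (by fun_prop) (measurableSet_lt (by fun_prop) (by fun_prop))]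
  rcases eq_or_ne V 0 with rfl | hV
  · simp
  have hpos : 0 < ‖V‖ := norm_pos_iff.mpr hV
  have h := HasSubgaussianMGF.measure_abs_gt_le (hasSubgaussianMGF_inner_stdGaussian V) hr
    (V := ‖V‖ ^ 2) (by positivity) (by simp)
  refine (measure_mono fun g hg => ?_).trans h
  have hg' : r * Real.sqrt v * ‖V‖ < |inner ℝ (Real.sqrt v • g) V| := hg
  rw [real_inner_smul_left, abs_mul, abs_of_nonneg (Real.sqrt_nonneg v)] at hg'
  rw [Set.mem_ofPred, Real.sqrt_sq hpos.le]
  refine lt_of_mul_lt_mul_left ?_ (Real.sqrt_nonneg v)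
  linarith

/-- Thresholds growing with the number of remaining steps make the union bound free of `T`: since
`(j + 1)² ≥ j + 1`, the tails are dominated by a geometric series whose ratio `exp (-D / 2)` is at
most `2 / 3`. -/
theorem sum_exp_neg_sq_le {D : ℕ} (hD : 0 < D) (T : ℕ) :
    ∑ t : Fin T, 2 * Real.exp (-((((t.rev : ℕ) + 1) * Real.sqrt D) ^ 2 / 2)) ≤
      6 * Real.exp (-(D / 2)) := by
  have hD' : (1 : ℝ) ≤ D := by exact_mod_cast hD
  set ρ := Real.exp (-(D / 2 : ℝ)) with hρ
  have h1 : ρ ≤ 2 / 3 := by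
    have h2 : (3 / 2 : ℝ) ≤ Real.exp (D / 2) := by
      have := Real.add_one_le_exp (D / 2 : ℝ); linarith
    rw [hρ, Real.exp_neg]
    calc _ ≤ (3 / 2 : ℝ)⁻¹ := inv_anti₀ (by norm_num) h2
      _ = _ := by norm_num
  calc _ ≤ ∑ t : Fin T, 2 * ρ * ρ ^ (t.rev : ℕ) := by
        refine Finset.sum_le_sum fun t _ => ?_
        rw [mul_assoc, ← pow_succ', hρ, ← Real.exp_nat_mul, mul_pow, Real.sq_sqrt (by positivity)]
        gcongr
        push_cast
        have : (0 : ℝ) ≤ (t.rev : ℕ) := by positivity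
        nlinarith [mul_nonneg this (by linarith : (0 : ℝ) ≤ D), mul_nonneg (mul_nonneg this this)
          (by linarith : (0 : ℝ) ≤ D)]
    _ ≤ 2 * ρ * (1 / (1 - ρ)) := by
        rw [← Finset.mul_sum]
        gcongr
        exact sum_pow_rev_mul_le (Real.exp_nonneg _) (by linarith) T
    _ ≤ 2 * ρ * 3 := by
        gcongr
        rw [div_le_iff₀ (by linarith)]; linarith
    _ = _ := by ring

/-- The noise matrices are nearly orthogonal to fixed directions. -/
theorem pi_noiseLaw_exists_inner_gt_le {D : ℕ} (hD : 0 < D) {T : ℕ} (v : ℝ) (V : Fin T → Mat D) :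
    (Measure.pi fun _ : Fin T => noiseLaw D v)
      {z | ∃ t, ((t.rev : ℕ) + 1) * (Real.sqrt D * Real.sqrt v) * ‖V t‖ < |inner ℝ (z t) (V t)|} ≤
      ENNReal.ofReal (6 * Real.exp (-(D / 2))) := by
  have := isProbabilityMeasure_noiseLaw D v
  have e : {z : Fin T → Mat D | ∃ t, ((t.rev : ℕ) + 1) * (Real.sqrt D * Real.sqrt v) * ‖V t‖ <
      |inner ℝ (z t) (V t)|} = ⋃ t, {z | z t ∈ {g | (((t.rev : ℕ) + 1) * Real.sqrt D) *
        Real.sqrt v * ‖V t‖ < |inner ℝ g (V t)|}} := by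
    ext z; simp [mul_assoc]
  rw [e]
  refine (measure_iUnion_fintype_le _ _).trans (le_trans ?_
    (ENNReal.ofReal_le_ofReal (sum_exp_neg_sq_le hD T)))
  rw [ENNReal.ofReal_sum_of_nonneg fun _ _ => by positivity]
  refine Finset.sum_le_sum fun t _ => ?_
  rw [pi_eval_apply _ _ (measurableSet_lt (by fun_prop) (by fun_prop))]
  exact noiseLaw_inner_gt_le v (V t) (by positivity)

section

variable {L D : ℕ} {τ : ℝ≥0} {B U s t p : ℝ}

theorem pi_promptLaw_not_goodTraining_le (N : ℕ) (hD : 0 < D) (hs : 0 ≤ s) (ht : 0 ≤ t)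
    (hB : s * Real.sqrt (1 + τ ^ 2) ≤ B) (hp : 0 ≤ p)
    (hU : promptLaw L D τ {E | U < ‖context E‖} ≤ ENNReal.ofReal p) :
    (Measure.pi fun _ : Fin N => promptLaw L D τ) {E | ¬ GoodTraining B U t E} ≤
      ENNReal.ofReal (N * (L + 1) * (2 * Real.exp (-(s ^ 2 / 2))) + N * p +
        2 * (N * N * (2 * Real.exp (-(D * t ^ 2 / 4))))) := by
  have := isProbabilityMeasure_promptLaw L τ hD
  set μ := Measure.pi fun _ : Fin N => promptLaw L D τ
  have m1 : ∀ i : Fin (L + 1), MeasurableSet {E : Prompt L D | B < |E.2 i|} := fun i =>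
    measurableSet_lt (by fun_prop) (by fun_prop)
  have h1 := measure_exists_le_card_mul (μ := μ)
    (S := fun q : Fin N × Fin (L + 1) => {E | B < |(E q.1).2 q.2|})
    (by positivity : 0 ≤ 2 * Real.exp (-(s ^ 2 / 2))) fun q => by
      refine (pi_eval_apply _ q.1 (m1 q.2)).trans_le (le_trans (measure_mono ?_)
        (promptLaw_response_gt_le hD τ q.2 hs))
      intro E hE
      exact hB.trans_lt hE
  have h2 := measure_exists_le_card_mul (μ := μ)
    (S := fun k : Fin N => {E | U < ‖context (E k)‖}) hp fun k =>
      (pi_eval_apply _ k (measurableSet_lt measurable_const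
        measurable_context.norm)).trans_le hU
  have h3 := measure_exists_le_card_mul (μ := μ)
    (S := fun q : Fin N × Fin N => {E | q.1 ≠ q.2 ∧
      t * ‖query (E q.2)‖ < |inner ℝ (query (E q.2)) (query (E q.1))|})
    (by positivity : 0 ≤ 2 * Real.exp (-(D * t ^ 2 / 4))) fun q => by
      by_cases hq : q.1 = q.2
      · simp [hq]
      · simp only [ne_eq, hq, not_false_eq_true, true_and]
        have hpr := isProbabilityMeasure_uniformSphere hD
        refine pi_pair_le (promptLaw L D τ) hq (S := {r | t * ‖query r.2‖ <
          |inner ℝ (query r.2) (query r.1)|}) (measurableSet_lt (by fun_prop) (by fun_prop))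
          fun b => ?_
        have := promptLaw_query_inner_gt_le (L := L) hD τ (M := fun _ => query b) measurable_const ht
        exact this
  have h4 := measure_exists_le_card_mul (μ := μ)
    (S := fun q : Fin N × Fin N => {E | q.1 ≠ q.2 ∧
      t * (‖context (E q.2)‖ * ‖context (E q.1)‖) <
        |inner ℝ (context (E q.2)) (context (E q.1))|})
    (by positivity : 0 ≤ 2 * Real.exp (-(D * t ^ 2 / 4))) fun q => by
      by_cases hq : q.1 = q.2
      · simp [hq]
      · simp only [ne_eq, hq, not_false_eq_true, true_and]
        refine pi_pair_le (promptLaw L D τ) hq (S := {r | t * (‖context r.2‖ * ‖context r.1‖) <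
          |inner ℝ (context r.2) (context r.1)|}) (measurableSet_lt (by fun_prop) (by fun_prop))
          fun b => ?_
        exact promptLaw_context_inner_gt_le hD τ (context b) ht
  have h5 : μ {E | ¬ ∀ k, ‖query (E k)‖ = 1} = 0 := by
    have : ∀ᵐ E ∂μ, ∀ k, ‖query (E k)‖ = 1 := by
      rw [ae_all_iff]
      exact fun k => (measurePreserving_eval (fun _ : Fin N => promptLaw L D τ) k).quasiMeasurePreserving.ae
        (ae_norm_query hD τ)
    exact this
  simp only [Fintype.card_prod, Fintype.card_fin, Nat.cast_mul, Nat.cast_add, Nat.cast_one]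
    at h1 h2 h3 h4
  have hsub : {E : Fin N → Prompt L D | ¬ GoodTraining B U t E} ⊆
      ((({E | ∃ q : Fin N × Fin (L + 1), E ∈ {E : Fin N → Prompt L D | B < |(E q.1).2 q.2|}} ∪
      {E | ∃ k : Fin N, E ∈ {E : Fin N → Prompt L D | U < ‖context (E k)‖}}) ∪
      {E | ∃ q : Fin N × Fin N, E ∈ {E : Fin N → Prompt L D | q.1 ≠ q.2 ∧
        t * ‖query (E q.2)‖ < |inner ℝ (query (E q.2)) (query (E q.1))|}}) ∪
      {E | ∃ q : Fin N × Fin N, E ∈ {E : Fin N → Prompt L D | q.1 ≠ q.2 ∧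
        t * (‖context (E q.2)‖ * ‖context (E q.1)‖) <
          |inner ℝ (context (E q.2)) (context (E q.1))|}}) ∪
      {E | ¬ ∀ k, ‖query (E k)‖ = 1} := by
    intro E hE
    by_contra hcon
    simp only [Set.mem_union, Set.mem_ofPred, not_or, not_exists, not_lt, not_not, not_and,
      Prod.forall] at hcon
    obtain ⟨⟨⟨⟨c1, c2⟩, c3⟩, c4⟩, c5⟩ := hcon
    refine hE ⟨c1, c5, c2, fun k k' h => ?_, fun k k' h => ?_⟩
    · have := c3 k k' h
      rwa [c5, mul_one, real_inner_comm] at this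
    · have := c4 k k' h
      rwa [real_inner_comm, mul_comm ‖context (E k')‖] at this
  refine (measure_mono hsub).trans ?_
  refine (measure_union_le _ _).trans ?_
  rw [h5, add_zero]
  refine (measure_union_le _ _).trans ((add_le_add ((measure_union_le _ _).trans
    (add_le_add ((measure_union_le _ _).trans (add_le_add h1 h2)) h3)) h4).trans ?_)
  rw [← ENNReal.ofReal_add (by positivity) (by positivity),
    ← ENNReal.ofReal_add (by positivity) (by positivity),
    ← ENNReal.ofReal_add (by positivity) (by positivity)]
  exact ENNReal.ofReal_le_ofReal (by linarith)

theorem promptLaw_not_goodTest_le (hD : 0 < D) (ht : 0 ≤ t) (hp : 0 ≤ p)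
    (hU : promptLaw L D τ {E | U < ‖context E‖} ≤ ENNReal.ofReal p) (H : Mat D) :
    promptLaw L D τ {E | ¬ GoodTest U t H E} ≤
      ENNReal.ofReal (p + (D + 1) * (2 * Real.exp (-(D * t ^ 2 / 4)))) := by
  have h1 := promptLaw_inner_feature_gt_le (L := L) hD τ H ht
  have h2 : promptLaw L D τ {E | ¬ ‖query E‖ = 1} = 0 := ae_norm_query hD τ
  have hsub : {E : Prompt L D | ¬ GoodTest U t H E} ⊆ ({E | U < ‖context E‖} ∪
      {E | t ^ 2 * (‖H‖ * ‖context E‖) < |inner ℝ H (feature E)|}) ∪ {E | ¬ ‖query E‖ = 1} := by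
    intro E hE
    by_contra hcon
    simp only [Set.mem_union, Set.mem_ofPred, not_or, not_lt, not_not] at hcon
    exact hE ⟨hcon.2, hcon.1.1, hcon.1.2⟩
  refine (measure_mono hsub).trans ((measure_union_le _ _).trans ?_)
  rw [h2, add_zero, ENNReal.ofReal_add hp (by positivity)]
  exact (measure_union_le _ _).trans (add_le_add hU h1)

/-- The good event of the whole sample. -/
structure GoodSample {N L D T : ℕ} (B G U t lam η₀ v : ℝ)
    (s : (Fin N → Prompt L D) × Prompt L D × (Fin T → Mat D)) : Prop where
  training : GoodTraining B U t s.1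
  test_raw : GoodTest U t (rawMoment s.1) s.2.1
  test_clipped : GoodTest U t (clippedMoment B G s.1) s.2.1
  noise : ∀ i, |inner ℝ (s.2.2 i) ((linearPart B G lam η₀ s.1)^[(i.rev : ℕ)] (feature s.2.1))| ≤
    ((i.rev : ℕ) + 1) * (Real.sqrt D * Real.sqrt v) *
      ‖(linearPart B G lam η₀ s.1)^[(i.rev : ℕ)] (feature s.2.1)‖

theorem measurableSet_goodTest {N : ℕ} {H : (Fin N → Prompt L D) → Mat D} (hH : Measurable H) :
    MeasurableSet {q : (Fin N → Prompt L D) × Prompt L D | ¬ GoodTest U t (H q.1) q.2} := by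
  have e : {q : (Fin N → Prompt L D) × Prompt L D | ¬ GoodTest U t (H q.1) q.2} =
      ({q | ‖query q.2‖ = 1} ∩ {q | ‖context q.2‖ ≤ U} ∩
        {q | |inner ℝ (H q.1) (feature q.2)| ≤ t ^ 2 * (‖H q.1‖ * ‖context q.2‖)})ᶜ := by
    ext q
    simp only [Set.mem_ofPred, Set.mem_compl_iff, Set.mem_inter_iff, not_iff_not]
    exact ⟨fun h => ⟨⟨h.1, h.2⟩, h.3⟩, fun h => ⟨h.1.1, h.1.2, h.2⟩⟩
  rw [e]
  exact (((measurableSet_eq_fun (by fun_prop) (by fun_prop)).inter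
    (measurableSet_le (by fun_prop) (by fun_prop))).inter
    (measurableSet_le (by fun_prop) (by fun_prop))).compl

theorem prod_fst_apply {α β : Type*} [MeasurableSpace α] [MeasurableSpace β] (ρ : Measure α)
    (κ : Measure β) [SFinite ρ] [IsProbabilityMeasure κ] (S : Set α) :
    (ρ.prod κ) {q | q.1 ∈ S} = ρ S := by
  have : {q : α × β | q.1 ∈ S} = S ×ˢ Set.univ := by ext; simp
  rw [this, Measure.prod_prod, measure_univ, mul_one]

theorem sampleLaw_not_goodTraining_le (N T : ℕ) (v : ℝ) (hD : 0 < D) (hs : 0 ≤ s) (ht : 0 ≤ t)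
    (hB : s * Real.sqrt (1 + τ ^ 2) ≤ B) (hp : 0 ≤ p)
    (hU : promptLaw L D τ {E | U < ‖context E‖} ≤ ENNReal.ofReal p) :
    sampleLaw N L D T τ v {q | ¬ GoodTraining B U t q.1} ≤
      ENNReal.ofReal (N * (L + 1) * (2 * Real.exp (-(s ^ 2 / 2))) + N * p +
        2 * (N * N * (2 * Real.exp (-(D * t ^ 2 / 4))))) := by
  have := isProbabilityMeasure_promptLaw L τ hD
  have := isProbabilityMeasure_noiseLaw D v
  refine le_trans (le_of_eq ?_) (pi_promptLaw_not_goodTraining_le N hD hs ht hB hp hU)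
  exact prod_fst_apply (Measure.pi fun _ : Fin N => promptLaw L D τ)
    ((promptLaw L D τ).prod (Measure.pi fun _ : Fin T => noiseLaw D v))
    {E | ¬ GoodTraining B U t E}

theorem sampleLaw_not_goodTest_le {N : ℕ} (T : ℕ) (v : ℝ) (hD : 0 < D) (ht : 0 ≤ t) (hp : 0 ≤ p)
    (hU : promptLaw L D τ {E | U < ‖context E‖} ≤ ENNReal.ofReal p)
    {H : (Fin N → Prompt L D) → Mat D} (hH : Measurable H) :
    sampleLaw N L D T τ v {q | ¬ GoodTest U t (H q.1) q.2.1} ≤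
      ENNReal.ofReal (p + (D + 1) * (2 * Real.exp (-(D * t ^ 2 / 4)))) := by
  have := isProbabilityMeasure_promptLaw L τ hD
  have := isProbabilityMeasure_noiseLaw D v
  have hm : Measurable fun q : (Fin N → Prompt L D) × Prompt L D × (Fin T → Mat D) =>
    (q.1, q.2.1) := by fun_prop
  refine measure_prod_le_of_ae_left (hm (measurableSet_goodTest hH)) (ae_of_all _ fun E => ?_)
  refine le_trans (le_of_eq ?_) (promptLaw_not_goodTest_le hD ht hp hU (H E))
  exact prod_fst_apply (promptLaw L D τ) (Measure.pi fun _ : Fin T => noiseLaw D v)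
    {E' | ¬ GoodTest U t (H E) E'}

/-- The event that the noise is large along the propagated test feature. -/
def noiseExcess (N L D T : ℕ) (B G lam η₀ v : ℝ) :
    Set ((Fin N → Prompt L D) × Prompt L D × (Fin T → Mat D)) :=
  {q | ∃ i, ((i.rev : ℕ) + 1) * (Real.sqrt D * Real.sqrt v) *
    ‖(linearPart B G lam η₀ q.1)^[(i.rev : ℕ)] (feature q.2.1)‖ <
    |inner ℝ (q.2.2 i) ((linearPart B G lam η₀ q.1)^[(i.rev : ℕ)] (feature q.2.1))|}

theorem measurableSet_noiseExcess (N L D T : ℕ) (B G lam η₀ v : ℝ) :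
    MeasurableSet (noiseExcess N L D T B G lam η₀ v) := by
  have hf : Measurable fun q : (Fin N → Prompt L D) × Prompt L D × (Fin T → Mat D) =>
    feature q.2.1 := by fun_prop
  have hV := measurable_linearPart_iterate B G lam η₀ (f := Prod.fst) measurable_fst hf
  rw [noiseExcess, Set.ofPred_exists]
  refine MeasurableSet.iUnion fun i => measurableSet_lt ((hV _).norm.const_mul _) ?_
  have hz : Measurable fun q : (Fin N → Prompt L D) × Prompt L D × (Fin T → Mat D) => q.2.2 i := by
    fun_prop
  exact (Measurable.inner (𝕜 := ℝ) hz (hV _)).norm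

/-- The propagated test features are functions of the prompts alone, so they are fixed directions
for the independent noise. -/
theorem sampleLaw_noiseExcess_le (N T : ℕ) (G lam η₀ v : ℝ) (hD : 0 < D) :
    sampleLaw N L D T τ v (noiseExcess N L D T B G lam η₀ v) ≤
      ENNReal.ofReal (6 * Real.exp (-(D / 2))) := by
  have := isProbabilityMeasure_promptLaw L τ hD
  have := isProbabilityMeasure_noiseLaw D v
  have m := measurableSet_noiseExcess N L D T B G lam η₀ v
  refine measure_prod_le_of_ae_left m (ae_of_all _ fun E => ?_)
  refine measure_prod_le_of_ae_left (measurable_prodMk_left m) (ae_of_all _ fun E' => ?_)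
  exact pi_noiseLaw_exists_inner_gt_le hD v fun i : Fin T =>
    (linearPart B G lam η₀ E)^[(i.rev : ℕ)] (feature E')

theorem sampleLaw_not_goodSample_le (N T : ℕ) (G lam η₀ v : ℝ) (hD : 0 < D) (hs : 0 ≤ s)
    (ht : 0 ≤ t) (hB : s * Real.sqrt (1 + τ ^ 2) ≤ B) (hp : 0 ≤ p)
    (hU : promptLaw L D τ {E | U < ‖context E‖} ≤ ENNReal.ofReal p) :
    (sampleLaw N L D T τ v) {q | ¬ GoodSample B G U t lam η₀ v q} ≤
      ENNReal.ofReal (N * (L + 1) * (2 * Real.exp (-(s ^ 2 / 2))) + (N + 2) * p +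
        2 * ((N * N + D + 1) * (2 * Real.exp (-(D * t ^ 2 / 4)))) + 6 * Real.exp (-(D / 2))) := by
  have h1 := sampleLaw_not_goodTraining_le N T v hD hs ht hB hp hU
  have h2 := sampleLaw_not_goodTest_le (N := N) T v hD ht hp hU measurable_rawMoment
  have h3 := sampleLaw_not_goodTest_le (N := N) T v hD ht hp hU (measurable_clippedMoment B G)
  have h4 := sampleLaw_noiseExcess_le (L := L) (τ := τ) (B := B) N T G lam η₀ v hD
  have hsub : {q : (Fin N → Prompt L D) × Prompt L D × (Fin T → Mat D) |
      ¬ GoodSample B G U t lam η₀ v q} ⊆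
      (({q | ¬ GoodTraining B U t q.1} ∪ {q | ¬ GoodTest U t (rawMoment q.1) q.2.1}) ∪
        {q | ¬ GoodTest U t (clippedMoment B G q.1) q.2.1}) ∪
      noiseExcess N L D T B G lam η₀ v := by
    intro q hq
    by_contra hcon
    simp only [Set.mem_union, Set.mem_ofPred, not_or, not_not] at hcon
    exact hq ⟨hcon.1.1.1, hcon.1.1.2, hcon.1.2, fun i => le_of_not_gt fun h => hcon.2 ⟨i, h⟩⟩
  refine (measure_mono hsub).trans ((measure_union_le _ _).trans ((add_le_add
    ((measure_union_le _ _).trans (add_le_add ((measure_union_le _ _).trans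
      (add_le_add h1 h2)) h3)) h4).trans ?_))
  rw [← ENNReal.ofReal_add (by positivity) (by positivity),
    ← ENNReal.ofReal_add (by positivity) (by positivity),
    ← ENNReal.ofReal_add (by positivity) (by positivity)]
  exact ENNReal.ofReal_le_ofReal (by linarith)

end

/-! ### The parameter regime -/

/-- The assumptions on the hyperparameters, together with a largeness assumption on `N`. -/
structure Regime (K c : ℝ) (N L D T : ℕ) (ν κ lam η₀ B G R σ ε δ r : ℝ) : Prop where
  one_le_K : 1 ≤ K
  one_lt_c : 1 < c
  N_pos : 0 < N
  L_pos : 0 < L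
  D_pos : 0 < D
  T_pos : 0 < T
  N_L : Comparable K N ((L : ℝ) ^ 2)
  N_D : Comparable K N ((D : ℝ) ^ 2)
  lam_comparable : Comparable K lam (N / D)
  one_le_ν : 1 ≤ ν
  κ_pos : 0 < κ
  κ_lt_one : κ < 1
  κ_ge : K⁻¹ * ((N : ℝ) * L)⁻¹ ≤ κ
  B_eq : B = clipLevel N L ν κ
  G_eq : G = featureRadius N L D ν κ
  R_comparable : Comparable K R (iterateRadiusOrder N L D ν κ lam)
  σ_comparable : Comparable K σ (2 * G * (B + R * G))
  η₀_gt : lam / (c * (2 * lam + G ^ 2) ^ 2) < η₀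
  η₀_lt : η₀ < lam / (2 * lam + G ^ 2) ^ 2
  ε_pos : 0 < ε
  δ_pos : 0 < δ
  δ_lt_one : δ < 1
  one_lt_r : 1 < r
  T_eq : (T : ℝ) = Real.log r / Real.log ((1 - η₀ * lam)⁻¹)
  N_large : 100 * K ^ 4 ≤ N
  log_small : 100 * K ^ 4 * ν * Real.log (N * L) ≤ Real.sqrt N

/-- A bound on the norm of the features that holds with high probability. -/
noncomputable def featureBound (K : ℝ) (N L : ℕ) (ν : ℝ) : ℝ :=
  Real.sqrt (80 * K ^ 2 * ν * Real.log (N * L) / L)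

theorem featureBound_nonneg (K : ℝ) (N L : ℕ) (ν : ℝ) : 0 ≤ featureBound K N L ν :=
  Real.sqrt_nonneg _

/-- A bound on the cosine of the angle between two independent directions that holds with high
probability. -/
noncomputable def angleBound (N L D : ℕ) : ℝ := Real.sqrt (16 * Real.log (N * L) / D)

namespace Regime

variable {K c : ℝ} {N L D T : ℕ} {ν κ lam η₀ B G R σ ε δ r : ℝ}
  (h : Regime K c N L D T ν κ lam η₀ B G R σ ε δ r)
include h

theorem N_real_pos : (0 : ℝ) < N := by exact_mod_cast h.N_pos
theorem L_real_pos : (0 : ℝ) < L := by exact_mod_cast h.L_pos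
theorem D_real_pos : (0 : ℝ) < D := by exact_mod_cast h.D_pos
theorem one_le_L : (1 : ℝ) ≤ L := by exact_mod_cast h.L_pos
theorem one_le_D : (1 : ℝ) ≤ D := by exact_mod_cast h.D_pos
theorem K_pos : 0 < K := by linarith [h.one_le_K]
theorem ν_pos : 0 < ν := by linarith [h.one_le_ν]

theorem K_le_N : K ≤ N := by
  have h1 : K ^ 1 ≤ K ^ 4 := pow_le_pow_right₀ h.one_le_K (by norm_num)
  have := h.N_large
  have := h.K_pos
  nlinarith

theorem L_sq_le : (L : ℝ) ^ 2 ≤ K * N := by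
  have := h.N_L.1
  rwa [inv_mul_le_iff₀ h.K_pos] at this

theorem D_sq_le : (D : ℝ) ^ 2 ≤ K * N := by
  have := h.N_D.1
  rwa [inv_mul_le_iff₀ h.K_pos] at this

theorem L_le_N : (L : ℝ) ≤ N := by
  have h1 := h.L_sq_le
  have h2 := mul_le_mul_of_nonneg_right h.K_le_N h.N_real_pos.le
  exact le_of_sq_le_sq (by nlinarith) h.N_real_pos.le

theorem D_le_N : (D : ℝ) ≤ N := by
  have h1 := h.D_sq_le
  have h2 := mul_le_mul_of_nonneg_right h.K_le_N h.N_real_pos.le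
  exact le_of_sq_le_sq (by nlinarith) h.N_real_pos.le

theorem sqrt_le_L : Real.sqrt N ≤ K * L := by
  rw [Real.sqrt_le_left (by have := h.K_pos; positivity)]
  have h1 := h.N_L.2
  have : K * (L : ℝ) ^ 2 ≤ K * (K * (L : ℝ) ^ 2) := by
    have := h.K_pos
    have := mul_le_mul_of_nonneg_right h.one_le_K (by positivity : 0 ≤ (L : ℝ) ^ 2)
    gcongr; linarith
  linarith

theorem sqrt_le_D : Real.sqrt N ≤ K * D := by
  rw [Real.sqrt_le_left (by have := h.K_pos; positivity)]
  have h1 := h.N_D.2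
  have : K * (D : ℝ) ^ 2 ≤ K * (K * (D : ℝ) ^ 2) := by
    have := h.K_pos
    have := mul_le_mul_of_nonneg_right h.one_le_K (by positivity : 0 ≤ (D : ℝ) ^ 2)
    gcongr; linarith
  linarith

theorem L_le_D : (L : ℝ) ≤ K * D := by
  have h1 := h.L_sq_le
  have h2 := h.N_D.2
  have hK := h.K_pos
  have hD := h.D_real_pos
  refine le_of_sq_le_sq ?_ (by positivity)
  nlinarith [mul_le_mul_of_nonneg_left h2 hK.le]

theorem D_le_L : (D : ℝ) ≤ K * L := by
  have h1 := h.D_sq_le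
  have h2 := h.N_L.2
  have hK := h.K_pos
  have hD := h.L_real_pos
  refine le_of_sq_le_sq ?_ (by positivity)
  nlinarith [mul_le_mul_of_nonneg_left h2 hK.le]

theorem one_le_K4 : 1 ≤ K ^ 4 := one_le_pow₀ h.one_le_K

theorem N_le_NL : (N : ℝ) ≤ N * L := by
  nlinarith [h.N_real_pos, h.one_le_L]

theorem one_le_log : 1 ≤ Real.log (N * L) := by
  rw [Real.le_log_iff_exp_le (by have := h.N_real_pos; have := h.L_real_pos; positivity)]
  have := Real.exp_one_lt_d9
  have := h.N_large
  have := h.one_le_K4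
  have := h.N_le_NL
  linarith

theorem log_le_two_log : Real.log (N * L) ≤ 2 * Real.log N := by
  have hN := h.N_real_pos
  have hL := h.L_real_pos
  rw [Real.log_mul hN.ne' hL.ne']
  have := Real.log_le_log hL h.L_le_N
  linarith

/-- The lower bound on `κ` gives `N L / κ ≤ K (N L)²`, and `K ≤ N L`. -/
theorem log_div_κ_le : Real.log (N * L / κ) ≤ 3 * Real.log (N * L) := by
  have hN := h.N_real_pos
  have hL := h.L_real_pos
  have hK := h.K_pos
  have hκ := h.κ_pos
  have hm : 0 < (N : ℝ) * L := by positivity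
  have h1 : (N : ℝ) * L / κ ≤ (N * L) ^ 3 := by
    rw [div_le_iff₀ hκ]
    have h2 := h.κ_ge
    calc (N : ℝ) * L = (N * L) ^ 2 * ((N : ℝ) * L)⁻¹ := by field_simp
      _ ≤ (N * L) ^ 2 * (K * κ) := by
          gcongr
          rw [← inv_mul_le_iff₀ hK]; exact h2
      _ ≤ (N * L) ^ 2 * ((N * L) * κ) := by
          gcongr
          exact h.K_le_N.trans h.N_le_NL
      _ = _ := by ring
  calc _ ≤ Real.log ((N * L) ^ 3) := Real.log_le_log (by positivity) h1
    _ = _ := by rw [Real.log_pow]; norm_num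

theorem log_le_log_div_κ : Real.log (N * L) ≤ Real.log (N * L / κ) := by
  have hN := h.N_real_pos
  have hL := h.L_real_pos
  have hκ := h.κ_pos
  refine Real.log_le_log (by positivity) ?_
  rw [le_div_iff₀ hκ]
  exact mul_le_of_le_one_right (by positivity) h.κ_lt_one.le

theorem log_le_L : 4 * Real.log (N * L) ≤ L := by
  have h1 := h.log_small
  have h2 := h.sqrt_le_L
  have hK := h.K_pos
  have hl := h.one_le_log
  have h3 : K ≤ K ^ 4 := by simpa using pow_le_pow_right₀ h.one_le_K (by norm_num : 1 ≤ 4)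
  have h4 : 100 * K * 1 * Real.log (N * L) ≤ 100 * K ^ 4 * ν * Real.log (N * L) := by
    gcongr; exact h.one_le_ν
  refine le_of_mul_le_mul_left ?_ hK
  nlinarith

theorem log_le_D : 4 * Real.log (N * L) ≤ D := by
  have h1 := h.log_small
  have h2 := h.sqrt_le_D
  have hK := h.K_pos
  have hl := h.one_le_log
  have h3 : K ≤ K ^ 4 := by simpa using pow_le_pow_right₀ h.one_le_K (by norm_num : 1 ≤ 4)
  have h4 : 100 * K * 1 * Real.log (N * L) ≤ 100 * K ^ 4 * ν * Real.log (N * L) := by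
    gcongr; exact h.one_le_ν
  refine le_of_mul_le_mul_left ?_ hK
  nlinarith

theorem B_nonneg : 0 ≤ B := by rw [h.B_eq]; exact Real.sqrt_nonneg _

theorem B_sq : B ^ 2 = 2 * ν * Real.log (N * L / κ) := by
  have := h.log_le_log_div_κ
  have := h.one_le_log
  have := h.ν_pos
  rw [h.B_eq, clipLevel, Real.sq_sqrt (mul_nonneg (by positivity) (by linarith))]

theorem B_sq_le : B ^ 2 ≤ 6 * ν * Real.log (N * L) := by
  rw [h.B_sq]
  have := h.log_div_κ_le
  have := h.ν_pos
  nlinarith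

/-- Used with `x = N` for `G` and `x = 1` for `R`: both correction factors are at most `2`. -/
theorem one_add_sqrt_log_le {x : ℝ} (hx : 0 < x) (hxN : x ≤ N * L) :
    0 ≤ Real.sqrt (Real.log (x / κ)) / D ∧ 1 + Real.sqrt (Real.log (x / κ)) / D ≤ 2 := by
  have hD := h.D_real_pos
  have hκ := h.κ_pos
  refine ⟨by positivity, ?_⟩
  have h1 : Real.sqrt (Real.log (x / κ)) ≤ D := by
    rw [Real.sqrt_le_left hD.le]
    calc Real.log (x / κ) ≤ Real.log (N * L / κ) :=
          Real.log_le_log (by positivity) (by gcongr)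
      _ ≤ 4 * Real.log (N * L) := by linarith [h.log_div_κ_le, h.one_le_log]
      _ ≤ D := h.log_le_D
      _ ≤ D ^ 2 := by nlinarith [h.one_le_D]
  have : Real.sqrt (Real.log (x / κ)) / D ≤ 1 := (div_le_one hD).mpr h1
  linarith

theorem G_nonneg : 0 ≤ G := by
  rw [h.G_eq, featureRadius, ← h.B_eq]
  have := (h.one_add_sqrt_log_le h.N_real_pos h.N_le_NL).1
  have := h.B_nonneg
  positivity

theorem G_le : G ≤ 2 * B / Real.sqrt L := by
  rw [h.G_eq, featureRadius, ← h.B_eq]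
  have h1 := (h.one_add_sqrt_log_le h.N_real_pos h.N_le_NL).2
  have h2 : 0 ≤ B / Real.sqrt L := div_nonneg h.B_nonneg (Real.sqrt_nonneg _)
  calc _ ≤ B / Real.sqrt L * 2 := by gcongr
    _ = _ := by ring

theorem G_sq_le : G ^ 2 ≤ 24 * ν * Real.log (N * L) / L := by
  have hL := h.L_real_pos
  calc G ^ 2 ≤ (2 * B / Real.sqrt L) ^ 2 := pow_le_pow_left₀ h.G_nonneg h.G_le 2
    _ = 4 * B ^ 2 / L := by rw [div_pow, Real.sq_sqrt hL.le]; ring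
    _ ≤ _ := div_le_div_of_nonneg_right (by linarith [h.B_sq_le]) hL.le

theorem featureBound_sq : featureBound K N L ν ^ 2 = 80 * K ^ 2 * ν * Real.log (N * L) / L := by
  have := h.one_le_log
  have := h.ν_pos
  have := h.L_real_pos
  rw [featureBound, Real.sq_sqrt (by positivity)]

theorem G_le_featureBound : G ≤ featureBound K N L ν := by
  have hl := h.one_le_log
  have hν := h.ν_pos
  have hL := h.L_real_pos
  refine le_of_sq_le_sq ?_ (featureBound_nonneg K N L ν)
  rw [h.featureBound_sq]
  refine h.G_sq_le.trans ?_
  have : 1 ≤ K ^ 2 := one_le_pow₀ h.one_le_K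
  have h2 : 24 * ν * Real.log (N * L) ≤ 80 * K ^ 2 * ν * Real.log (N * L) := by
    gcongr; linarith
  gcongr

theorem lam_ge : N / (K * D) ≤ lam := by
  have := h.lam_comparable.1
  rwa [← div_eq_inv_mul, div_div, mul_comm (D : ℝ)] at this

theorem lam_pos : 0 < lam := by
  have := h.N_real_pos
  have := h.D_real_pos
  have := h.K_pos
  exact lt_of_lt_of_le (by positivity) h.lam_ge

theorem inv_lam_le : lam⁻¹ ≤ K * D / N := by
  have := h.N_real_pos
  have := h.D_real_pos
  have := h.K_pos
  rw [← one_div, div_le_div_iff₀ h.lam_pos h.N_real_pos]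
  have := h.lam_ge
  rw [div_le_iff₀ (by positivity)] at this
  linarith

theorem sqrt_le_lam : Real.sqrt N ≤ K ^ 2 * lam := by
  have hN := h.N_real_pos
  have hD := h.D_real_pos
  have hK := h.K_pos
  have h1 := h.lam_ge
  rw [div_le_iff₀ (by positivity)] at h1
  have hs : Real.sqrt N * Real.sqrt N = N := Real.mul_self_sqrt hN.le
  have hsp : 0 < Real.sqrt N := Real.sqrt_pos.mpr hN
  have h2 : (D : ℝ) ≤ K * Real.sqrt N := by
    refine le_of_sq_le_sq ?_ (by positivity)
    rw [mul_pow, Real.sq_sqrt hN.le]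
    refine h.D_sq_le.trans ?_
    gcongr
    nlinarith [h.one_le_K]
  refine le_of_mul_le_mul_left ?_ hsp
  rw [hs]
  refine h1.trans ?_
  have := h.lam_pos
  calc lam * (K * D) ≤ lam * (K * (K * Real.sqrt N)) := by gcongr
    _ = _ := by ring

/-- This is where the penalty is seen to dominate the data: `lam` is at least `√N / K ^ 2`, while
the squared feature norm is logarithmic even before dividing by `L`. -/
theorem featureBound_sq_le_lam : featureBound K N L ν ^ 2 ≤ lam := by
  have hl := h.one_le_log
  have hν := h.ν_pos
  have hL := h.L_real_pos
  have hK := h.K_pos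
  rw [h.featureBound_sq]
  refine le_of_mul_le_mul_left ?_ (by positivity : 0 < K ^ 2)
  refine le_trans ?_ (h.log_small.trans h.sqrt_le_lam)
  calc K ^ 2 * (80 * K ^ 2 * ν * Real.log (N * L) / L)
      ≤ K ^ 2 * (80 * K ^ 2 * ν * Real.log (N * L)) := by
        gcongr; exact div_le_self (by positivity) h.one_le_L
    _ = 80 * K ^ 4 * ν * Real.log (N * L) := by ring
    _ ≤ _ := by gcongr; norm_num

theorem G_sq_le_lam : G ^ 2 ≤ lam :=
  (pow_le_pow_left₀ h.G_nonneg h.G_le_featureBound 2).trans h.featureBound_sq_le_lam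

theorem η₀_pos : 0 < η₀ := by
  refine lt_trans ?_ h.η₀_gt
  have := h.lam_pos
  have := h.one_lt_c
  positivity

theorem lam_mul_η₀_le : lam * η₀ ≤ 1 / 4 := by
  have hl := h.lam_pos
  have h1 := h.η₀_lt
  rw [lt_div_iff₀ (by positivity)] at h1
  have h2 : (2 * lam) ^ 2 ≤ (2 * lam + G ^ 2) ^ 2 := by gcongr; nlinarith [sq_nonneg G]
  have h3 := mul_le_mul_of_nonneg_left h2 h.η₀_pos.le
  refine le_of_mul_le_mul_left ?_ hl
  nlinarith

/-- As `G ^ 2 ≤ lam`, the denominator `(2 * lam + G ^ 2) ^ 2` is at most `9 * lam ^ 2`. A step size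
of order `1 / lam` makes each update contract by a fixed factor, so that `T` is logarithmic in `r`.
-/
theorem le_lam_mul_η₀ : 1 / (9 * c) ≤ lam * η₀ := by
  have hl := h.lam_pos
  have hc : 0 < c := by linarith [h.one_lt_c]
  have h1 := h.η₀_gt
  rw [div_lt_iff₀ (by positivity)] at h1
  have h2 : (2 * lam + G ^ 2) ^ 2 ≤ (3 * lam) ^ 2 := by gcongr; linarith [h.G_sq_le_lam]
  have h3 := mul_le_mul_of_nonneg_left h2 (mul_nonneg h.η₀_pos.le hc.le)
  rw [div_le_iff₀ (by positivity)]
  refine le_of_mul_le_mul_left ?_ hl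
  nlinarith

theorem iterateRadiusOrder_nonneg : 0 ≤ iterateRadiusOrder N L D ν κ lam := by
  rw [iterateRadiusOrder]
  have := (h.one_add_sqrt_log_le one_pos (by linarith [h.N_le_NL, h.N_large, h.one_le_K4])).1
  have := h.lam_pos
  positivity

theorem R_nonneg : 0 ≤ R :=
  le_trans (mul_nonneg (inv_nonneg.mpr h.K_pos.le) h.iterateRadiusOrder_nonneg) h.R_comparable.1

theorem R_le : R ≤ 12 * K * ν * Real.log (N * L) * Real.sqrt (N / L) / lam := by
  have hl := h.lam_pos
  have hK := h.K_pos
  refine h.R_comparable.2.trans ?_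
  rw [iterateRadiusOrder, ← h.B_eq]
  have h1 := h.one_add_sqrt_log_le one_pos (by linarith [h.N_le_NL, h.N_large, h.one_le_K4])
  calc _ ≤ K * (lam⁻¹ * (6 * ν * Real.log (N * L)) * Real.sqrt (N / L) * 2) := by
        have := h.B_sq_le
        have h3 : 0 ≤ 6 * ν * Real.log (N * L) := (sq_nonneg B).trans this
        have := h1.1
        have := h1.2
        gcongr
    _ = _ := by field_simp; ring

/-- It shows that the predictions inside the ball stay below the clipping level, so `σ` is of order
`G * B`. -/
theorem R_mul_G_le : R * G ≤ B := by
  have hl := h.lam_pos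
  have hK := h.K_pos
  have hN := h.N_real_pos
  have hL := h.L_real_pos
  have hν := h.ν_pos
  have hlog := h.one_le_log
  have hsL : 0 < Real.sqrt L := Real.sqrt_pos.mpr hL
  have hsN : 0 < Real.sqrt N := Real.sqrt_pos.mpr hN
  have h1 : R * 2 / Real.sqrt L ≤ 1 := by
    have e1 : Real.sqrt (N / L) / Real.sqrt L = Real.sqrt N / L := by
      rw [Real.sqrt_div hN.le, div_div, Real.mul_self_sqrt hL.le]
    calc R * 2 / Real.sqrt L
        ≤ 12 * K * ν * Real.log (N * L) * Real.sqrt (N / L) / lam * 2 / Real.sqrt L := by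
          gcongr; exact h.R_le
      _ = 24 * K * ν * Real.log (N * L) * (Real.sqrt (N / L) / Real.sqrt L) / lam := by ring
      _ = 24 * K * ν * Real.log (N * L) * Real.sqrt N / (L * lam) := by rw [e1]; field_simp
      _ ≤ 1 := by
          rw [div_le_one (by positivity)]
          calc 24 * K * ν * Real.log (N * L) * Real.sqrt N
              ≤ 24 * K * ν * Real.log (N * L) * (K ^ 2 * lam) := by gcongr; exact h.sqrt_le_lam
            _ = 24 * K ^ 3 * ν * Real.log (N * L) * lam := by ring
            _ ≤ L * lam := by
                gcongr
                refine le_of_mul_le_mul_left ?_ hK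
                refine le_trans ?_ (h.log_small.trans h.sqrt_le_L)
                calc K * (24 * K ^ 3 * ν * Real.log (N * L)) = 24 * K ^ 4 * ν * Real.log (N * L) := by
                      ring
                  _ ≤ _ := by gcongr; norm_num
  calc R * G ≤ R * (2 * B / Real.sqrt L) := mul_le_mul_of_nonneg_left h.G_le h.R_nonneg
    _ = B * (R * 2 / Real.sqrt L) := by ring
    _ ≤ B * 1 := mul_le_mul_of_nonneg_left h1 h.B_nonneg
    _ = B := mul_one B

theorem σ_sq_le : σ ^ 2 ≤ 2304 * K ^ 2 * ν ^ 2 * Real.log (N * L) ^ 2 / L := by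
  have hK := h.K_pos
  have hG := h.G_nonneg
  have hB := h.B_nonneg
  have hR := h.R_nonneg
  have hL := h.L_real_pos
  have h0 : 0 ≤ σ := le_trans (by positivity) h.σ_comparable.1
  have h1 : σ ≤ 4 * K * G * B := by
    refine h.σ_comparable.2.trans ?_
    calc K * (2 * G * (B + R * G)) ≤ K * (2 * G * (B + B)) := by
          gcongr; exact h.R_mul_G_le
      _ = _ := by ring
  calc σ ^ 2 ≤ (4 * K * G * B) ^ 2 := by gcongr
    _ = 16 * K ^ 2 * G ^ 2 * B ^ 2 := by ring
    _ ≤ 16 * K ^ 2 * (24 * ν * Real.log (N * L) / L) * (6 * ν * Real.log (N * L)) := by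
        gcongr
        · have := (sq_nonneg G).trans h.G_sq_le; positivity
        · exact h.G_sq_le
        · exact h.B_sq_le
    _ = _ := by ring

theorem pow_T : (1 - η₀ * lam) ^ T = 1 / r := by
  have h1 := h.lam_mul_η₀_le
  have h2 : 0 < lam * η₀ := mul_pos h.lam_pos h.η₀_pos
  have h3 : 0 < 1 - η₀ * lam := by linarith
  have h4 : 0 < Real.log ((1 - η₀ * lam)⁻¹) :=
    Real.log_pos ((one_lt_inv₀ h3).mpr (by linarith))
  have hr : 0 < r := by linarith [h.one_lt_r]
  have h5 : T * Real.log ((1 - η₀ * lam)⁻¹) = Real.log r := by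
    rw [h.T_eq, div_mul_cancel₀ _ h4.ne']
  rw [Real.log_inv] at h5
  rw [← Real.exp_log (pow_pos h3 T), Real.log_pow, ← Real.exp_log (by positivity : 0 < 1 / r),
    one_div, Real.log_inv]
  congr 1
  linarith

theorem log_r_pos : 0 < Real.log r := Real.log_pos h.one_lt_r

theorem T_le : (T : ℝ) ≤ 9 * c * Real.log r := by
  have h1 := h.lam_mul_η₀_le
  have h3 : 0 < 1 - η₀ * lam := by linarith
  have h4 : lam * η₀ ≤ Real.log ((1 - η₀ * lam)⁻¹) := by
    rw [Real.log_inv]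
    have := Real.log_le_sub_one_of_pos h3
    linarith
  have hc : 0 < c := by linarith [h.one_lt_c]
  have h5 : 1 / (9 * c) ≤ Real.log ((1 - η₀ * lam)⁻¹) := h.le_lam_mul_η₀.trans h4
  have h6 : 0 < 1 / (9 * c) := by positivity
  rw [h.T_eq]
  calc _ ≤ Real.log r / (1 / (9 * c)) := div_le_div_of_nonneg_left h.log_r_pos.le h6 h5
    _ = _ := by field_simp

theorem log_r_le_T : Real.log r ≤ T := by
  have h1 := h.lam_mul_η₀_le
  have h2 : 0 < lam * η₀ := mul_pos h.lam_pos h.η₀_pos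
  have h3 : 0 < 1 - η₀ * lam := by linarith
  have h4 : 0 < Real.log ((1 - η₀ * lam)⁻¹) :=
    Real.log_pos ((one_lt_inv₀ h3).mpr (by linarith))
  have h5 : Real.log ((1 - η₀ * lam)⁻¹) ≤ 1 := by
    have h6 : (1 - η₀ * lam)⁻¹ ≤ 4 / 3 := by
      rw [inv_le_comm₀ h3 (by norm_num)]; linarith
    have := Real.log_le_sub_one_of_pos (inv_pos.mpr h3)
    linarith
  rw [h.T_eq, le_div_iff₀ h4]
  nlinarith [h.log_r_pos]

theorem one_le_T : (1 : ℝ) ≤ T := by exact_mod_cast h.T_pos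

theorem log_inv_δ_pos : 0 < Real.log (1 / δ) :=
  Real.log_pos ((one_lt_div h.δ_pos).mpr h.δ_lt_one)

/-- A sum of two logarithms is turned into a product: `log (1 / δ)` is bounded below by `d₁`, and
`log r` by `1 / (9 * c)` because `T ≥ 1`. -/
theorem log_T_div_δ_le {d₁ : ℝ} (hd : 0 < d₁) (hδ : d₁ ≤ Real.log (1 / δ)) :
    Real.log (1.25 * T / δ) ≤ (9 * c + 12 * c / d₁) * (Real.log r * Real.log (1 / δ)) := by
  have hT := h.one_le_T
  have hc : 0 < c := by linarith [h.one_lt_c]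
  have hr := h.log_r_pos
  have hδ' := h.log_inv_δ_pos
  have e : Real.log (1.25 * T / δ) = Real.log (1.25 * T) + Real.log (1 / δ) := by
    rw [← Real.log_mul (by positivity) (by have := h.δ_pos; positivity)]
    congr 1; ring
  have h1 : Real.log (1.25 * T) ≤ 12 * c * Real.log r := by
    have := Real.log_le_sub_one_of_pos (by positivity : (0 : ℝ) < 1.25 * T)
    have := h.T_le
    nlinarith [mul_pos hc hr]
  have h2 : 12 * c * Real.log r ≤ 12 * c / d₁ * (Real.log r * Real.log (1 / δ)) := by
    calc 12 * c * Real.log r = 12 * c / d₁ * (Real.log r * d₁) := by field_simp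
      _ ≤ _ := by gcongr
  have h3 : Real.log (1 / δ) ≤ 9 * c * (Real.log r * Real.log (1 / δ)) := by
    have := h.T_le
    calc Real.log (1 / δ) = 1 * Real.log (1 / δ) := by ring
      _ ≤ (9 * c * Real.log r) * Real.log (1 / δ) := by gcongr; linarith
      _ = _ := by ring
  rw [e]
  linarith

end Regime

/-! ### Probability of the good event -/

theorem angleBound_sq {N L D : ℕ} (h : 0 ≤ Real.log (N * L)) :
    angleBound N L D ^ 2 = 16 * Real.log (N * L) / D := by
  rw [angleBound, Real.sq_sqrt (by positivity)]

theorem norm_sum_eq_mul_norm_context {L D : ℕ} (hL : 0 < L) (E : Prompt L D) :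
    ‖∑ i : Fin L, E.2 i.castSucc • E.1 i.castSucc‖ = L * ‖context E‖ := by
  have hL' : (0 : ℝ) < L := by exact_mod_cast hL
  rw [context, norm_smul, norm_inv, Real.norm_of_nonneg hL'.le, mul_inv_cancel_left₀ hL'.ne']

namespace Regime

section Probability

variable {K c : ℝ} {N L D T : ℕ} {ν κ lam η₀ B G R σ ε δ r : ℝ}

theorem exp_neg_four_log (h : Regime K c N L D T ν κ lam η₀ B G R σ ε δ r) :
    Real.exp (-(4 * Real.log (N * L))) = (((N : ℝ) * L) ^ 4)⁻¹ := by
  have := h.N_real_pos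
  have := h.L_real_pos
  rw [Real.exp_neg, mul_comm, Real.exp_mul, Real.exp_log (by positivity)]
  norm_cast

theorem promptLaw_lt_norm_context_le (h : Regime K c N L D T ν κ lam η₀ B G R σ ε δ r)
    {τ : ℝ≥0} (hτ : ν = 1 + (τ : ℝ) ^ 2) :
    promptLaw L D τ {E | featureBound K N L ν < ‖context E‖} ≤
      ENNReal.ofReal (3 * N * (((N : ℝ) * L) ^ 4)⁻¹) := by
  have hN := h.N_real_pos
  have hL := h.L_real_pos
  have hD := h.D_real_pos
  have hK := h.one_le_K
  have hν := h.one_le_ν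
  have hl := h.one_le_log
  -- Deviation `s ^ 2 = 8 * log (N * L)` makes each Gaussian tail `(N * L) ^ (-4)`. The `80` in
  -- `featureBound` is this `8` times the `10` bounding the variance factor.
  have hs : Real.sqrt (8 * Real.log (N * L)) ^ 2 = 8 * Real.log (N * L) :=
    Real.sq_sqrt (by positivity)
  refine (measure_mono ?_).trans ((promptLaw_norm_sum_gt_le h.D_pos τ
    (Real.sqrt_nonneg (8 * Real.log (N * L)))).trans (ENNReal.ofReal_le_ofReal ?_))
  · intro E hE
    rw [Set.mem_ofPred] at hE ⊢
    rw [norm_sum_eq_mul_norm_context h.L_pos, hs, mul_pow]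
    have h1 : featureBound K N L ν ^ 2 < ‖context E‖ ^ 2 :=
      pow_lt_pow_left₀ hE (featureBound_nonneg K N L ν) two_ne_zero
    refine lt_of_le_of_lt ?_ (mul_lt_mul_of_pos_left h1 (by positivity : (0 : ℝ) < (L : ℝ) ^ 2))
    rw [h.featureBound_sq]
    have h2 : (L : ℝ) / D ≤ K := (div_le_iff₀ hD).mpr h.L_le_D
    have h3 : ν + 8 * K + 1 ≤ 10 * K ^ 2 * ν := by
      have h4 : K ≤ K ^ 2 := by nlinarith
      have h5 : K ^ 2 ≤ K ^ 2 * ν := le_mul_of_one_le_right (by positivity) hν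
      have h6 : ν ≤ K ^ 2 * ν := le_mul_of_one_le_left (by positivity) (one_le_pow₀ hK)
      linarith
    calc 8 * Real.log (N * L) * (L * (1 + 8 * L / D + (τ : ℝ) ^ 2) + 1)
        = 8 * Real.log (N * L) * (L * (ν + 8 * (L / D)) + 1) := by rw [hτ]; ring
      _ ≤ 8 * Real.log (N * L) * (L * (ν + 8 * K) + L) := by
          gcongr; exact h.one_le_L
      _ = 8 * Real.log (N * L) * L * (ν + 8 * K + 1) := by ring
      _ ≤ 8 * Real.log (N * L) * L * (10 * K ^ 2 * ν) := by gcongr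
      _ = (L : ℝ) ^ 2 * (80 * K ^ 2 * ν * Real.log (N * L) / L) := by field_simp; ring
  · rw [hs]
    have e1 : Real.exp (-(8 * Real.log (N * L) / 2)) = (((N : ℝ) * L) ^ 4)⁻¹ := by
      rw [← h.exp_neg_four_log]; congr 1; ring
    have e2 : Real.exp (-L) ≤ (((N : ℝ) * L) ^ 4)⁻¹ := by
      rw [← h.exp_neg_four_log]
      exact Real.exp_le_exp.mpr (by linarith [h.log_le_L])
    rw [e1]
    have h1 : (L : ℝ) * Real.exp (-L) ≤ N * (((N : ℝ) * L) ^ 4)⁻¹ :=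
      mul_le_mul h.L_le_N e2 (Real.exp_pos _).le hN.le
    have h2 : (D : ℝ) * (2 * (((N : ℝ) * L) ^ 4)⁻¹) ≤ N * (2 * (((N : ℝ) * L) ^ 4)⁻¹) :=
      mul_le_mul_of_nonneg_right h.D_le_N (by positivity)
    linarith

theorem sampleLaw_not_goodSample_le (h : Regime K c N L D T ν κ lam η₀ B G R σ ε δ r)
    {τ : ℝ≥0} (hτ : ν = 1 + (τ : ℝ) ^ 2) (v : ℝ) :
    sampleLaw N L D T τ v
        {q | ¬ GoodSample B G (featureBound K N L ν) (angleBound N L D) lam η₀ v q} ≤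
      ENNReal.ofReal (4 * κ + 6 * Real.exp (-(D / 2))) := by
  have hN := h.N_real_pos
  have hL := h.L_real_pos
  have hD := h.D_real_pos
  have hK := h.one_le_K
  have hκ := h.κ_pos
  have hl := h.one_le_log
  have hlκ := h.log_le_log_div_κ
  have hs : Real.sqrt (2 * Real.log (N * L / κ)) ^ 2 = 2 * Real.log (N * L / κ) :=
    Real.sq_sqrt (by linarith)
  have hB : Real.sqrt (2 * Real.log (N * L / κ)) * Real.sqrt (1 + (τ : ℝ) ^ 2) ≤ B := by
    rw [h.B_eq, clipLevel, ← Real.sqrt_mul (by linarith), ← hτ]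
    exact le_of_eq (congrArg _ (by ring))
  refine (NoisyHead.sampleLaw_not_goodSample_le N T G lam η₀ v h.D_pos (Real.sqrt_nonneg _)
    (Real.sqrt_nonneg _) hB (by positivity) (h.promptLaw_lt_norm_context_le hτ)).trans
    (ENNReal.ofReal_le_ofReal ?_)
  have e1 : Real.exp (-(Real.sqrt (2 * Real.log (N * L / κ)) ^ 2 / 2)) = κ / (N * L) := by
    rw [hs, mul_div_cancel_left₀ _ two_ne_zero, Real.exp_neg, Real.exp_log (by positivity),
      inv_div]
  have e2 : Real.exp (-(D * angleBound N L D ^ 2 / 4)) = (((N : ℝ) * L) ^ 4)⁻¹ := by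
    rw [angleBound_sq (by positivity), ← h.exp_neg_four_log]
    congr 1; field_simp; ring
  rw [angleBound] at e2
  rw [e1, e2]
  -- The responses of all training tokens use up three of the four multiples of `κ`.
  have h1 : (N : ℝ) * (L + 1) * (2 * (κ / (N * L))) ≤ 3 * κ := by
    have h2 : (4 : ℝ) ≤ L := by linarith [h.log_le_L]
    calc (N : ℝ) * (L + 1) * (2 * (κ / (N * L))) = κ * ((2 * L + 2) / L) := by field_simp
      _ ≤ κ * 3 := by
          gcongr
          rw [div_le_iff₀ hL]; linarith
      _ = _ := by ring
  have hN1 : (100 : ℝ) ≤ N := by linarith [h.N_large, h.one_le_K4]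
  -- Contexts and angles fail with probability at most `21 / (N L)²`, which fits in the last `κ`
  -- because `κ` is at least a multiple of `1 / (N L)`.
  have h2 : ((N : ℝ) + 2) * (3 * N * (((N : ℝ) * L) ^ 4)⁻¹) +
      2 * ((N * N + D + 1) * (2 * (((N : ℝ) * L) ^ 4)⁻¹)) ≤ κ := by
    have h3 : ((N : ℝ) + 2) * (3 * N) + 4 * (N * N + D + 1) ≤ 21 * N ^ 2 := by
      nlinarith [h.D_le_N]
    have h4 : 21 * K ≤ N * L := by
      have h5 : K ^ 1 ≤ K ^ 4 := pow_le_pow_right₀ hK (by norm_num)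
      linarith [h.N_le_NL, h.N_large]
    calc _ = (((N : ℝ) + 2) * (3 * N) + 4 * (N * N + D + 1)) * (((N : ℝ) * L) ^ 4)⁻¹ := by ring
      _ ≤ 21 * N ^ 2 * (((N : ℝ) * L) ^ 4)⁻¹ := by gcongr
      _ ≤ 21 * (N * L) ^ 2 * (((N : ℝ) * L) ^ 4)⁻¹ := by
          gcongr
          exact h.N_le_NL
      _ = K⁻¹ * ((N : ℝ) * L)⁻¹ * (21 * K / (N * L)) := by
          have := h.K_pos
          field_simp
      _ ≤ K⁻¹ * ((N : ℝ) * L)⁻¹ * 1 := by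
          have := h.K_pos
          gcongr
          exact (div_le_one (by positivity)).mpr h4
      _ ≤ κ := by rw [mul_one]; exact h.κ_ge
  linarith

end Probability

/-! ### The deterministic bound in the parameter regime -/

section Bounds

variable {K c : ℝ} {N L D T : ℕ} {ν κ lam η₀ B G R σ ε δ r : ℝ}

theorem D_le_sqrt (h : Regime K c N L D T ν κ lam η₀ B G R σ ε δ r) :
    (D : ℝ) ≤ K * Real.sqrt N := by
  have hN := h.N_real_pos
  have hK := h.K_pos
  refine le_of_sq_le_sq ?_ (by positivity)
  rw [mul_pow, Real.sq_sqrt hN.le]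
  refine h.D_sq_le.trans ?_
  gcongr
  nlinarith [h.one_le_K]

theorem optimization_sq_le (h : Regime K c N L D T ν κ lam η₀ B G R σ ε δ r) :
    ((1 - η₀ * lam) ^ T * (R * featureBound K N L ν)) ^ 2 ≤
      11520 * K ^ 6 * (ν ^ 5 * Real.log (N * L) ^ 3 * ((D : ℝ) ^ 2 / (N * L ^ 2 * r))) := by
  have hN := h.N_real_pos
  have hL := h.L_real_pos
  have hD := h.D_real_pos
  have hK := h.K_pos
  have hν := h.ν_pos
  have hν1 := h.one_le_ν
  have hl := h.one_le_log
  have hr1 := h.one_lt_r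
  have hr : 0 < r := by linarith
  have hlam := h.lam_pos
  have hR := h.R_nonneg
  have h1 : R ^ 2 ≤ 144 * K ^ 4 * ν ^ 2 * Real.log (N * L) ^ 2 * (D ^ 2 / (N * L)) := by
    calc R ^ 2 ≤ (12 * K * ν * Real.log (N * L) * Real.sqrt (N / L) / lam) ^ 2 :=
          pow_le_pow_left₀ hR h.R_le 2
      _ = 144 * K ^ 2 * ν ^ 2 * Real.log (N * L) ^ 2 * (N / L) * lam⁻¹ ^ 2 := by
          rw [div_pow, mul_pow _ (Real.sqrt _), Real.sq_sqrt (by positivity)]; ring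
      _ ≤ 144 * K ^ 2 * ν ^ 2 * Real.log (N * L) ^ 2 * (N / L) * (K * D / N) ^ 2 := by
          gcongr; exact h.inv_lam_le
      _ = _ := by field_simp
  rw [h.pow_T, mul_pow, mul_pow, h.featureBound_sq]
  -- The square of the initial term decays like `1 / r ^ 2`; the claim needs only one factor.
  have h2 : (1 / r) ^ 2 ≤ 1 / r := by
    rw [sq]; exact mul_le_of_le_one_right (by positivity) ((div_le_one hr).mpr hr1.le)
  have h3 : ν ^ 3 ≤ ν ^ 5 := pow_le_pow_right₀ hν1 (by norm_num)
  calc _ ≤ (1 / r) * (144 * K ^ 4 * ν ^ 2 * Real.log (N * L) ^ 2 * (D ^ 2 / (N * L)) *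
        (80 * K ^ 2 * ν * Real.log (N * L) / L)) := by gcongr
    _ = 11520 * K ^ 6 * (ν ^ 3 * Real.log (N * L) ^ 3 * ((D : ℝ) ^ 2 / (N * L ^ 2 * r))) := by
        field_simp; ring
    _ ≤ _ := by gcongr

/-- The crude bound squares to order `D² / (N² L²)` up to logarithms, and `r ≤ K * N` lets one
factor `N` be traded for `r`. -/
theorem bias_sq_le_of_le (h : Regime K c N L D T ν κ lam η₀ B G R σ ε δ r) (hrN : r ≤ K * N) :
    (2 * (B * featureBound K N L ν ^ 2 / lam)) ^ 2 ≤
      153600 * K ^ 7 * (ν ^ 5 * Real.log (N * L) ^ 3 * ((D : ℝ) ^ 2 / (N * L ^ 2 * r))) := by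
  have hN := h.N_real_pos
  have hL := h.L_real_pos
  have hD := h.D_real_pos
  have hK := h.K_pos
  have hν := h.ν_pos
  have hl := h.one_le_log
  have hr : 0 < r := by linarith [h.one_lt_r]
  have h3 : ν ^ 3 ≤ ν ^ 5 := pow_le_pow_right₀ h.one_le_ν (by norm_num)
  have hlam := h.lam_pos
  calc (2 * (B * featureBound K N L ν ^ 2 / lam)) ^ 2
      = 4 * B ^ 2 * (featureBound K N L ν ^ 2) ^ 2 * lam⁻¹ ^ 2 := by ring
    _ ≤ 4 * (6 * ν * Real.log (N * L)) * (featureBound K N L ν ^ 2) ^ 2 * (K * D / N) ^ 2 := by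
        gcongr
        · exact h.B_sq_le
        · exact h.inv_lam_le
    _ = 153600 * K ^ 6 * (ν ^ 3 * Real.log (N * L) ^ 3 * ((D : ℝ) ^ 2 / (N * L ^ 2 * N))) := by
        rw [h.featureBound_sq]; field_simp; ring
    _ ≤ 153600 * K ^ 6 * (ν ^ 5 * Real.log (N * L) ^ 3 *
          ((D : ℝ) ^ 2 / (N * L ^ 2 * (r / K)))) := by
        gcongr
        rw [div_le_iff₀ hK]; linarith
    _ = _ := by field_simp

/-- Both parts of the refined bound square to order `D³ / (N⁴ L²)` up to logarithms. This is the
size of the privacy term, from which `r` cancels. -/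
theorem bias_sq_le_of_lt (h : Regime K c N L D T ν κ lam η₀ B G R σ ε δ r) (hrN : K * N < r)
    (hε : ε ≤ K) {d₁ : ℝ} (hd : 0 < d₁) (hδ : d₁ ≤ Real.log (1 / δ)) :
    (2 * (2 * (B * angleBound N L D ^ 3 * featureBound K N L ν ^ 2) / lam +
        2 * (B * featureBound K N L ν ^ 4) / lam ^ 2)) ^ 2 ≤
      103179878400 * K ^ 15 / d₁ *
        (ν ^ 5 * Real.log (N * L) ^ 3 * ((D : ℝ) ^ 2 / (N * L ^ 2 * r)) *
          (r * Real.log r ^ 3 * ((D : ℝ) / N ^ 3) * (Real.log (1 / δ) / ε ^ 2))) := by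
  have hN := h.N_real_pos
  have hL := h.L_real_pos
  have hL1 := h.one_le_L
  have hD := h.D_real_pos
  have hK := h.K_pos
  have hK1 := h.one_le_K
  have hν := h.ν_pos
  have hl := h.one_le_log
  have hr : 0 < r := by linarith [h.one_lt_r]
  have hlam := h.lam_pos
  have hε0 := h.ε_pos
  have hlδ := h.log_inv_δ_pos
  have hlr := h.log_r_pos
  have h3 : ν ^ 3 ≤ ν ^ 5 := pow_le_pow_right₀ h.one_le_ν (by norm_num)
  have hK13 : K ^ 8 ≤ K ^ 13 := pow_le_pow_right₀ hK1 (by norm_num)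
  have hl5 : Real.log (N * L) ^ 5 ≤ Real.log (N * L) ^ 6 := pow_le_pow_right₀ hl (by norm_num)
  -- The refined bound carries three more powers of `log (N * L)` than the claim allows; for `r > K
  -- * N` they are charged to `log r ^ 3`.
  have hlogr : Real.log (N * L) / 2 ≤ Real.log r := by
    have : Real.log N ≤ Real.log r := Real.log_le_log hN (by nlinarith)
    linarith [h.log_le_two_log]
  have hND : (N : ℝ) ^ 2 ≤ K ^ 2 * D ^ 4 := by
    calc (N : ℝ) ^ 2 ≤ (K * D ^ 2) ^ 2 := pow_le_pow_left₀ hN.le h.N_D.2 2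
      _ = _ := by ring
  have ha : (B * angleBound N L D ^ 3 * featureBound K N L ν ^ 2 / lam) ^ 2 ≤
      157286400 * K ^ 13 * (ν ^ 5 * Real.log (N * L) ^ 6 * (D ^ 3 / (N ^ 4 * L ^ 2))) := by
    calc (B * angleBound N L D ^ 3 * featureBound K N L ν ^ 2 / lam) ^ 2
        = B ^ 2 * (angleBound N L D ^ 2) ^ 3 * (featureBound K N L ν ^ 2) ^ 2 *
            lam⁻¹ ^ 2 := by ring
      _ ≤ (6 * ν * Real.log (N * L)) * (angleBound N L D ^ 2) ^ 3 *
            (featureBound K N L ν ^ 2) ^ 2 * (K * D / N) ^ 2 := by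
          gcongr
          · exact h.B_sq_le
          · exact h.inv_lam_le
      _ = 157286400 * K ^ 6 * (ν ^ 3 * Real.log (N * L) ^ 6 *
            (N ^ 2 / (D * (N ^ 4 * L ^ 2)))) := by
          rw [h.featureBound_sq, angleBound_sq (by positivity)]; field_simp; ring
      _ ≤ 157286400 * K ^ 6 * (ν ^ 5 * Real.log (N * L) ^ 6 *
            ((K ^ 2 * D ^ 4) / (D * (N ^ 4 * L ^ 2)))) := by gcongr
      _ = 157286400 * K ^ 8 * (ν ^ 5 * Real.log (N * L) ^ 6 * (D ^ 3 / (N ^ 4 * L ^ 2))) := by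
          field_simp
      _ ≤ _ := by gcongr
  have hb : (B * featureBound K N L ν ^ 4 / lam ^ 2) ^ 2 ≤
      245760000 * K ^ 13 * (ν ^ 5 * Real.log (N * L) ^ 6 * (D ^ 3 / (N ^ 4 * L ^ 2))) := by
    calc (B * featureBound K N L ν ^ 4 / lam ^ 2) ^ 2
        = B ^ 2 * (featureBound K N L ν ^ 2) ^ 4 * lam⁻¹ ^ 4 := by ring
      _ ≤ (6 * ν * Real.log (N * L)) * (featureBound K N L ν ^ 2) ^ 4 * (K * D / N) ^ 4 := by
          gcongr
          · exact h.B_sq_le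
          · exact h.inv_lam_le
      _ = 245760000 * K ^ 12 * (ν ^ 5 * Real.log (N * L) ^ 5 *
            (D ^ 3 * D / (N ^ 4 * L ^ 4))) := by
          rw [h.featureBound_sq]; field_simp; ring
      _ ≤ 245760000 * K ^ 12 * (ν ^ 5 * Real.log (N * L) ^ 6 *
            (D ^ 3 * (K * L ^ 2) / (N ^ 4 * L ^ 4))) := by
          gcongr
          exact h.D_le_L.trans (by gcongr; nlinarith)
      _ = _ := by field_simp
  have hc : ν ^ 5 * Real.log (N * L) ^ 6 * (D ^ 3 / (N ^ 4 * L ^ 2)) ≤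
      8 * K ^ 2 / d₁ * (ν ^ 5 * Real.log (N * L) ^ 3 * ((D : ℝ) ^ 2 / (N * L ^ 2 * r)) *
          (r * Real.log r ^ 3 * ((D : ℝ) / N ^ 3) * (Real.log (1 / δ) / ε ^ 2))) := by
    -- Bounded `ε` and `δ` away from `1` keep the privacy term from vanishing.
    have h5 : d₁ / K ^ 2 ≤ Real.log (1 / δ) / ε ^ 2 := by gcongr
    calc ν ^ 5 * Real.log (N * L) ^ 6 * (D ^ 3 / (N ^ 4 * L ^ 2))
        = 8 * K ^ 2 / d₁ * (ν ^ 5 * Real.log (N * L) ^ 3 * ((D : ℝ) ^ 2 / (N * L ^ 2 * r)) *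
          (r * (Real.log (N * L) / 2) ^ 3 * ((D : ℝ) / N ^ 3) * (d₁ / K ^ 2))) := by
          field_simp; ring
      _ ≤ _ := by gcongr
  have key : ∀ x y : ℝ, (2 * (2 * x + 2 * y)) ^ 2 ≤ 32 * (x ^ 2 + y ^ 2) := fun x y => by
    nlinarith [sq_nonneg (x - y)]
  calc _ = (2 * (2 * (B * angleBound N L D ^ 3 * featureBound K N L ν ^ 2 / lam) +
        2 * (B * featureBound K N L ν ^ 4 / lam ^ 2))) ^ 2 := by ring
    _ ≤ _ := key _ _
    _ ≤ 12897484800 * K ^ 13 *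
        (ν ^ 5 * Real.log (N * L) ^ 6 * (D ^ 3 / (N ^ 4 * L ^ 2))) := by linarith
    _ ≤ _ := mul_le_mul_of_nonneg_left hc (by positivity)
    _ = _ := by ring

theorem noiseVar_nonneg (h : Regime K c N L D T ν κ lam η₀ B G R σ ε δ r) :
    0 ≤ noiseVar N T η₀ σ ε δ := by
  have h1 := h.one_le_T
  have : 0 ≤ Real.log (1.25 * T / δ) := by
    refine Real.log_nonneg ?_
    rw [le_div_iff₀ h.δ_pos]
    linarith [h.δ_lt_one]
  rw [noiseVar]
  positivity

theorem noiseVar_le (h : Regime K c N L D T ν κ lam η₀ B G R σ ε δ r) {d₁ : ℝ} (hd : 0 < d₁)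
    (hδ : d₁ ≤ Real.log (1 / δ)) :
    noiseVar N T η₀ σ ε δ ≤ 23328 * c ^ 2 * (9 * c + 12 * c / d₁) * K ^ 4 *
      (ν ^ 2 * Real.log (N * L) ^ 2 * Real.log r ^ 3 * (D ^ 2 / (N ^ 4 * L)) *
        (Real.log (1 / δ) / ε ^ 2)) := by
  have hN := h.N_real_pos
  have hL := h.L_real_pos
  have hD := h.D_real_pos
  have hK := h.K_pos
  have hν := h.ν_pos
  have hl := h.one_le_log
  have hlam := h.lam_pos
  have hη := h.η₀_pos
  have hε := h.ε_pos
  have hc : 0 < c := by linarith [h.one_lt_c]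
  have hlr := h.log_r_pos
  have hlδ := h.log_inv_δ_pos
  have h1 : η₀ ≤ K * D / (4 * N) := by
    have h2 := h.inv_lam_le
    have h3 : η₀ ≤ lam⁻¹ / 4 := by
      rw [← one_div, div_div, le_div_iff₀ (by positivity)]
      linarith [h.lam_mul_η₀_le]
    calc η₀ ≤ lam⁻¹ / 4 := h3
      _ ≤ K * D / N / 4 := by gcongr
      _ = _ := by ring
  have h4 : (T : ℝ) ^ 2 ≤ (9 * c * Real.log r) ^ 2 := by gcongr; exact h.T_le
  have h5 := h.log_T_div_δ_le hd hδ
  have h6 := h.σ_sq_le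
  rw [noiseVar]
  calc _ ≤ 2 * η₀ ^ 2 * ((T : ℝ) ^ 2 * σ ^ 2 / (ε ^ 2 * (N : ℝ) ^ 2)) *
        ((9 * c + 12 * c / d₁) * (Real.log r * Real.log (1 / δ))) := by gcongr
    _ ≤ 2 * (K * D / (4 * N)) ^ 2 * ((9 * c * Real.log r) ^ 2 *
          (2304 * K ^ 2 * ν ^ 2 * Real.log (N * L) ^ 2 / L) / (ε ^ 2 * (N : ℝ) ^ 2)) *
        ((9 * c + 12 * c / d₁) * (Real.log r * Real.log (1 / δ))) := by gcongr
    _ = _ := by field_simp; ring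

/-- Three powers of `log r` appear: two from `T ^ 2` and one from the logarithm in the noise
variance. -/
theorem noise_sq_le (h : Regime K c N L D T ν κ lam η₀ B G R σ ε δ r) {d₁ : ℝ} (hd : 0 < d₁)
    (hδ : d₁ ≤ Real.log (1 / δ)) :
    (Real.sqrt D * Real.sqrt (noiseVar N T η₀ σ ε δ) * featureBound K N L ν /
        (lam * η₀) ^ 2) ^ 2 ≤
      12244400640 * c ^ 6 * (9 * c + 12 * c / d₁) * K ^ 6 *
        (ν ^ 5 * Real.log (N * L) ^ 3 * ((D : ℝ) ^ 2 / (N * L ^ 2 * r)) *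
          (r * Real.log r ^ 3 * ((D : ℝ) / N ^ 3) * (Real.log (1 / δ) / ε ^ 2))) := by
  have hN := h.N_real_pos
  have hL := h.L_real_pos
  have hD := h.D_real_pos
  have hK := h.K_pos
  have hν := h.ν_pos
  have hl := h.one_le_log
  have hlam := h.lam_pos
  have hη := h.η₀_pos
  have hε := h.ε_pos
  have hc : 0 < c := by linarith [h.one_lt_c]
  have hlr := h.log_r_pos
  have hlδ := h.log_inv_δ_pos
  have hr : 0 < r := by linarith [h.one_lt_r]
  have hv := h.noiseVar_nonneg
  have h3 : ν ^ 3 ≤ ν ^ 5 := pow_le_pow_right₀ h.one_le_ν (by norm_num)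
  have h1 : 1 / (lam * η₀) ≤ 9 * c := by
    have := h.le_lam_mul_η₀
    rw [div_le_iff₀ (by positivity)] at this ⊢
    linarith
  calc _ = D * noiseVar N T η₀ σ ε δ * featureBound K N L ν ^ 2 * (1 / (lam * η₀)) ^ 4 := by
        rw [div_pow, mul_pow, mul_pow, Real.sq_sqrt hD.le, Real.sq_sqrt hv]; ring
    _ ≤ D * (23328 * c ^ 2 * (9 * c + 12 * c / d₁) * K ^ 4 *
          (ν ^ 2 * Real.log (N * L) ^ 2 * Real.log r ^ 3 * (D ^ 2 / (N ^ 4 * L)) *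
            (Real.log (1 / δ) / ε ^ 2))) * featureBound K N L ν ^ 2 * (9 * c) ^ 4 := by
        gcongr
        exact h.noiseVar_le hd hδ
    _ = 12244400640 * c ^ 6 * (9 * c + 12 * c / d₁) * K ^ 6 *
        (ν ^ 3 * Real.log (N * L) ^ 3 * ((D : ℝ) ^ 2 / (N * L ^ 2 * r)) *
          (r * Real.log r ^ 3 * ((D : ℝ) / N ^ 3) * (Real.log (1 / δ) / ε ^ 2))) := by
        rw [h.featureBound_sq]; field_simp; ring
    _ ≤ _ := by gcongr

/-- The constant in the bound on the cost of privacy. -/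
noncomputable def _root_.NoisyHead.costConstant (K c d₁ : ℝ) : ℝ :=
  3 * (11520 * K ^ 6 + 153600 * K ^ 7 + 103179878400 * K ^ 15 / d₁ +
    12244400640 * c ^ 6 * (9 * c + 12 * c / d₁) * K ^ 6)

theorem costOfPrivacy_le (h : Regime K c N L D T ν κ lam η₀ B G R σ ε δ r)
    {d₁ : ℝ} (hd : 0 < d₁) (hδ : d₁ ≤ Real.log (1 / δ)) (hεr : ε ≤ K ∨ r ≤ K * N)
    {Γ₀ : Mat D} (hΓ : ‖Γ₀‖ ≤ R)
    {s : (Fin N → Prompt L D) × Prompt L D × (Fin T → Mat D)}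
    (hs : GoodSample B G (featureBound K N L ν) (angleBound N L D) lam η₀
      (noiseVar N T η₀ σ ε δ) s) :
    costOfPrivacy B G R lam η₀ Γ₀ s ≤ costConstant K c d₁ *
      (ν ^ 5 * Real.log (N * L) ^ 3 * ((D : ℝ) ^ 2 / (N * L ^ 2 * r)) *
        (1 + r * Real.log r ^ 3 * ((D : ℝ) / N ^ 3) * (Real.log (1 / δ) / ε ^ 2))) := by
  have hN := h.N_real_pos
  have hL := h.L_real_pos
  have hD := h.D_real_pos
  have hK := h.K_pos
  have hν := h.ν_pos
  have hl := h.one_le_log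
  have hc : 0 < c := by linarith [h.one_lt_c]
  have hr : 0 < r := by linarith [h.one_lt_r]
  have hlr := h.log_r_pos
  have hlδ := h.log_inv_δ_pos
  have hlam := h.lam_pos
  have hB := h.B_nonneg
  have hU := featureBound_nonneg K N L ν
  have ht : 0 ≤ angleBound N L D := Real.sqrt_nonneg _
  have hNt : 1 ≤ N * angleBound N L D ^ 2 := by
    rw [angleBound_sq (by positivity), mul_div_assoc', one_le_div hD]
    nlinarith [h.D_le_N]
  have hsv : 0 ≤ Real.sqrt D * Real.sqrt (noiseVar N T η₀ σ ε δ) := by positivity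
  have key := abs_inner_sub_le_of_good h.N_pos h.R_nonneg hlam h.η₀_pos h.lam_mul_η₀_le hsv
    h.featureBound_sq_le_lam h.G_nonneg h.G_le_featureBound hΓ ht hNt hs.training hs.test_raw
    hs.test_clipped hs.noise
  have ha := h.optimization_sq_le
  have he := h.noise_sq_le hd hδ
  set Q := ν ^ 5 * Real.log (N * L) ^ 3 * ((D : ℝ) ^ 2 / (N * L ^ 2 * r)) with hQ
  set X := r * Real.log r ^ 3 * ((D : ℝ) / N ^ 3) * (Real.log (1 / δ) / ε ^ 2) with hX
  have hQ0 : 0 ≤ Q := by positivity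
  have hX0 : 0 ≤ X := by positivity
  set a := (1 - η₀ * lam) ^ T * (R * featureBound K N L ν)
  set e := Real.sqrt D * Real.sqrt (noiseVar N T η₀ σ ε δ) * featureBound K N L ν /
    (lam * η₀) ^ 2
  set m₁ := B * featureBound K N L ν ^ 2 / lam with hm₁
  set m₂ := 2 * (B * angleBound N L D ^ 3 * featureBound K N L ν ^ 2) / lam +
    2 * (B * featureBound K N L ν ^ 4) / lam ^ 2 with hm₂
  have hm0 : 0 ≤ min m₁ m₂ := by positivity
  have hm : (2 * min m₁ m₂) ^ 2 ≤
      153600 * K ^ 7 * Q + 103179878400 * K ^ 15 / d₁ * (Q * X) := by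
    -- The minimum of the two data estimates is used through its first entry for small `r` and
    -- through its second otherwise.
    rcases le_or_gt r (K * N) with hrN | hrN
    · calc (2 * min m₁ m₂) ^ 2 ≤ (2 * m₁) ^ 2 := by gcongr; exact min_le_left _ _
        _ ≤ 153600 * K ^ 7 * Q := h.bias_sq_le_of_le hrN
        _ ≤ _ := le_add_of_nonneg_right (by positivity)
    · have hεK : ε ≤ K := hεr.resolve_right (not_le.mpr hrN)
      calc (2 * min m₁ m₂) ^ 2 ≤ (2 * m₂) ^ 2 := by gcongr; exact min_le_right _ _
        _ ≤ 103179878400 * K ^ 15 / d₁ * (Q * X) := h.bias_sq_le_of_lt hrN hεK hd hδ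
        _ ≤ _ := le_add_of_nonneg_left (by positivity)
  have h3 : (a + 2 * min m₁ m₂ + e) ^ 2 ≤ 3 * (a ^ 2 + (2 * min m₁ m₂) ^ 2 + e ^ 2) := by
    nlinarith [sq_nonneg (a - 2 * min m₁ m₂), sq_nonneg (a - e), sq_nonneg (2 * min m₁ m₂ - e)]
  rw [costOfPrivacy, ← sq_abs]
  refine (pow_le_pow_left₀ (abs_nonneg _) key 2).trans (h3.trans ?_)
  rw [costConstant]
  have p1 : 0 ≤ 11520 * K ^ 6 * (Q * X) := by positivity
  have p2 : 0 ≤ 153600 * K ^ 7 * (Q * X) := by positivity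
  have p3 : 0 ≤ 103179878400 * K ^ 15 / d₁ * Q := by positivity
  have p4 : 0 ≤ 12244400640 * c ^ 6 * (9 * c + 12 * c / d₁) * K ^ 6 * Q := by positivity
  linarith

/-- With the number of updates tuned to `r ≍ N`, the bound on the cost of privacy simplifies. -/
theorem bound_le_of_comparable (h : Regime K c N L D T ν κ lam η₀ B G R σ ε δ r)
    (hrN : Comparable K r N)
    (hεδ : Real.log (1 / δ) / ε ^ 2 * Real.log N ^ 3 ≤ K * Real.sqrt N ^ 3) :
    ν ^ 5 * Real.log (N * L) ^ 3 * ((D : ℝ) ^ 2 / (N * L ^ 2 * r)) *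
        (1 + r * Real.log r ^ 3 * ((D : ℝ) / N ^ 3) * (Real.log (1 / δ) / ε ^ 2)) ≤
      K * (1 + 8 * K ^ 3) *
        (ν ^ 5 * Real.log (N * L) ^ 3 * ((D : ℝ) ^ 2 / ((N : ℝ) ^ 2 * L ^ 2))) := by
  have hN := h.N_real_pos
  have hL := h.L_real_pos
  have hD := h.D_real_pos
  have hK := h.K_pos
  have hν := h.ν_pos
  have hl := h.one_le_log
  have hr : 0 < r := by linarith [h.one_lt_r]
  have hlr := h.log_r_pos
  have hlδ := h.log_inv_δ_pos
  have hε := h.ε_pos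
  have hsN : 0 < Real.sqrt N := Real.sqrt_pos.mpr hN
  have hsq : Real.sqrt N ^ 2 = N := Real.sq_sqrt hN.le
  have h1 : Real.log r ≤ 2 * Real.log N := by
    have h2 : Real.log r ≤ Real.log (N * N) :=
      Real.log_le_log hr (hrN.2.trans (by gcongr; exact h.K_le_N))
    rw [Real.log_mul hN.ne' hN.ne'] at h2
    linarith
  have hX : r * Real.log r ^ 3 * ((D : ℝ) / N ^ 3) * (Real.log (1 / δ) / ε ^ 2) ≤ 8 * K ^ 3 := by
    have e4 : (N : ℝ) ^ 2 = Real.sqrt N ^ 4 := by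
      rw [show 4 = 2 * 2 from rfl, pow_mul, hsq]
    calc _ ≤ (K * N) * (2 * Real.log N) ^ 3 * ((D : ℝ) / N ^ 3) *
          (Real.log (1 / δ) / ε ^ 2) := by
          gcongr
          exact hrN.2
      _ = 8 * K * (D / N ^ 2) * (Real.log (1 / δ) / ε ^ 2 * Real.log N ^ 3) := by
          field_simp; ring
      _ ≤ 8 * K * ((K * Real.sqrt N) / N ^ 2) * (K * Real.sqrt N ^ 3) := by
          gcongr
          exact h.D_le_sqrt
      _ = 8 * K ^ 3 := by rw [e4]; field_simp
  have hQ : (D : ℝ) ^ 2 / (N * L ^ 2 * r) ≤ K * ((D : ℝ) ^ 2 / ((N : ℝ) ^ 2 * L ^ 2)) := by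
    calc (D : ℝ) ^ 2 / (N * L ^ 2 * r) ≤ (D : ℝ) ^ 2 / (N * L ^ 2 * (K⁻¹ * N)) := by
          gcongr; exact hrN.1
      _ = _ := by field_simp
  calc _ ≤ ν ^ 5 * Real.log (N * L) ^ 3 * (K * ((D : ℝ) ^ 2 / ((N : ℝ) ^ 2 * L ^ 2))) *
        (1 + 8 * K ^ 3) := by gcongr
    _ = _ := by ring

/-- `T` is comparable to `log r` by the step size bounds, and `K ^ 2 ≤ N` places `log r` between
half and twice `log N`. -/
theorem comparable_T_log (h : Regime K c N L D T ν κ lam η₀ B G R σ ε δ r)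
    (hrN : Comparable K r N) {C : ℝ} (hC : 18 * c + 2 ≤ C) : Comparable C T (Real.log N) := by
  have hN := h.N_real_pos
  have hK := h.K_pos
  have hc := h.one_lt_c
  have hr : 0 < r := by linarith [h.one_lt_r]
  have hl : 0 ≤ Real.log N := Real.log_nonneg (by linarith [h.N_large, h.one_le_K4])
  have h1 : Real.log r ≤ 2 * Real.log N := by
    have h2 : Real.log r ≤ Real.log (N * N) :=
      Real.log_le_log hr (hrN.2.trans (by gcongr; exact h.K_le_N))
    rw [Real.log_mul hN.ne' hN.ne'] at h2
    linarith
  have h2 : Real.log N / 2 ≤ Real.log r := by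
    have h3 : Real.log (K⁻¹ * N) ≤ Real.log r := Real.log_le_log (by positivity) hrN.1
    rw [Real.log_mul (by positivity) hN.ne', Real.log_inv] at h3
    have h4 : Real.log (K ^ 2) ≤ Real.log N := by
      refine Real.log_le_log (by positivity) ?_
      have : K ^ 2 ≤ K ^ 4 := pow_le_pow_right₀ h.one_le_K (by norm_num)
      linarith [h.N_large, h.one_le_K4]
    rw [Real.log_pow] at h4
    push_cast at h4
    linarith
  have hC0 : 0 < C := by linarith
  refine ⟨?_, ?_⟩
  · rw [inv_mul_le_iff₀ hC0]
    have h5 := h.log_r_le_T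
    have : 2 * (T : ℝ) ≤ C * T := by gcongr; linarith
    linarith
  · calc (T : ℝ) ≤ 9 * c * Real.log r := h.T_le
      _ ≤ 9 * c * (2 * Real.log N) := by gcongr
      _ = 18 * c * Real.log N := by ring
      _ ≤ C * Real.log N := by gcongr; linarith

end Bounds

end Regime

/-! ### Threshold in `N` and assembly of the theorem. -/

/-- The largeness assumptions hold for all `N` beyond a threshold. -/
theorem exists_threshold (K ν : ℝ) (hK : 1 ≤ K) (hν : 1 ≤ ν) :
    ∃ N₀ : ℕ, ∀ N L : ℕ, N₀ ≤ N → 0 < L → (L : ℝ) ^ 2 ≤ K * N →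
      100 * K ^ 4 ≤ N ∧ 100 * K ^ 4 * ν * Real.log (N * L) ≤ Real.sqrt N := by
  have hpos : 0 < 1 / (200 * K ^ 4 * ν) := by positivity
  have h1 := (isLittleO_log_rpow_atTop (r := 1 / 2) (by norm_num)).bound hpos
  have h2 := tendsto_natCast_atTop_atTop (R := ℝ) |>.eventually
    (h1.and (Filter.eventually_ge_atTop (100 * K ^ 4)))
  obtain ⟨N₀, hN₀⟩ := Filter.eventually_atTop.mp h2
  refine ⟨N₀, fun N L hN hL hLN => ?_⟩
  obtain ⟨h3, h4⟩ := hN₀ N hN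
  refine ⟨h4, ?_⟩
  have hK4 : K ^ 1 ≤ K ^ 4 := pow_le_pow_right₀ hK (by norm_num)
  have hN1 : (1 : ℝ) ≤ N := by linarith
  have hL' : (0 : ℝ) < L := by exact_mod_cast hL
  have hLN' : (L : ℝ) ≤ N := by
    refine le_of_sq_le_sq ?_ (by positivity)
    nlinarith
  rw [← Real.sqrt_eq_rpow, Real.norm_of_nonneg (Real.log_nonneg hN1),
    Real.norm_of_nonneg (Real.sqrt_nonneg _), one_div_mul_eq_div,
    le_div_iff₀ (by positivity)] at h3
  have h5 : Real.log (N * L) ≤ 2 * Real.log N := by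
    rw [Real.log_mul (by positivity) hL'.ne']
    linarith [Real.log_le_log hL' hLN']
  calc 100 * K ^ 4 * ν * Real.log (N * L) ≤ 100 * K ^ 4 * ν * (2 * Real.log N) := by gcongr
    _ = Real.log N * (200 * K ^ 4 * ν) := by ring
    _ ≤ _ := h3

theorem one_sub_le_real_of_forall {Ω : Type*} [MeasurableSpace Ω] (μ : Measure Ω)
    [IsProbabilityMeasure μ] {p : Ω → Prop} {S : Set Ω} {x : ℝ} (hx : 0 ≤ x)
    (hp : μ {ω | ¬ p ω} ≤ ENNReal.ofReal x) (hS : ∀ ω, p ω → ω ∈ S) : 1 - x ≤ μ.real S := by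
  have h1 : (1 : ℝ) ≤ μ.real S + μ.real {ω | ¬ p ω} := by
    have h2 : S ∪ {ω | ¬ p ω} = Set.univ :=
      Set.eq_univ_of_forall fun ω => (em (p ω)).imp (hS ω) id
    have h3 := measureReal_union_le (μ := μ) S {ω | ¬ p ω}
    rwa [h2, probReal_univ] at h3
  have h4 : μ.real {ω | ¬ p ω} ≤ x := ENNReal.toReal_le_of_le_ofReal hx hp
  linarith

end NoisyHead

open NoisyHead in
theorem mainTheorem4
    (K : ℝ) (hK : 1 ≤ K) (c : ℝ) (hc : 1 < c) (δ₁ : ℝ) (hδ₁ : δ₁ < 1) :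
    ∃ C c₂ : ℝ, 0 < C ∧ 0 < c₂ ∧ ∀ τ : NNReal, ∃ (c₁ : ℝ) (N₀ : ℕ), 0 < c₁ ∧
    ∀ (N L D T : ℕ) (ν κ lam η₀ B G R σ ε δ r : ℝ) (Γ₀ : Mat D),
      0 < N → 0 < L → 0 < D → 0 < T →
      Comparable K N ((L : ℝ) ^ 2) → Comparable K N ((D : ℝ) ^ 2) →
      Comparable K lam (N / D) →
      ν = 1 + (τ : ℝ) ^ 2 →
      0 < κ → κ < 1 → K⁻¹ * ((N : ℝ) * L)⁻¹ ≤ κ →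
      B = clipLevel N L ν κ →
      G = featureRadius N L D ν κ →
      Comparable K R (iterateRadiusOrder N L D ν κ lam) →
      Comparable K σ (2 * G * (B + R * G)) →
      lam / (c * (2 * lam + G ^ 2) ^ 2) < η₀ → η₀ < lam / (2 * lam + G ^ 2) ^ 2 →
      ‖Γ₀‖ ≤ R →
      0 < ε → 0 < δ → δ ≤ δ₁ →
      1 < r → (T : ℝ) = Real.log r / Real.log ((1 - η₀ * lam)⁻¹) →
      (ε ≤ K ∨ r ≤ K * N →
        1 - c₁ * Real.exp (-(c₂ * D)) - 4 * κ ≤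
          (sampleLaw N L D T τ (noiseVar N T η₀ σ ε δ)).real
            {s | costOfPrivacy B G R lam η₀ Γ₀ s ≤
              C * (ν ^ 5 * Real.log (N * L) ^ 3 * ((D : ℝ) ^ 2 / (N * L ^ 2 * r)) *
                (1 + r * Real.log r ^ 3 * ((D : ℝ) / N ^ 3) *
                  (Real.log (1 / δ) / ε ^ 2)))}) ∧
      (Comparable K r N →
        (N₀ ≤ N → Comparable C T (Real.log N)) ∧
        (Real.log (1 / δ) / ε ^ 2 * Real.log N ^ 3 ≤ K * Real.sqrt N ^ 3 →
          1 - c₁ * Real.exp (-(c₂ * D)) - 4 * κ ≤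
            (sampleLaw N L D T τ (noiseVar N T η₀ σ ε δ)).real
              {s | costOfPrivacy B G R lam η₀ Γ₀ s ≤
                C * (ν ^ 5 * Real.log (N * L) ^ 3 *
                  ((D : ℝ) ^ 2 / ((N : ℝ) ^ 2 * L ^ 2)))})) := by
  have hc0 : 0 < c := by linarith
  have hK0 : 0 < K := by linarith
  -- For `δ₁ ≤ 0` no admissible `δ` exists.
  rcases le_or_gt δ₁ 0 with hδ₁0 | hδ₁0
  · refine ⟨1, 1, one_pos, one_pos, fun τ => ⟨1, 0, one_pos, ?_⟩⟩
    intro N L D T ν κ lam η₀ B G R σ ε δ r Γ₀ _ _ _ _ _ _ _ _ _ _ _ _ _ _ _ _ _ _ _ hδ hδδ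
    linarith
  have hd : 0 < Real.log (1 / δ₁) := Real.log_pos ((one_lt_div hδ₁0).mpr hδ₁)
  set C₁ := costConstant K c (Real.log (1 / δ₁)) with hC₁
  have hC₁0 : 0 < C₁ := by rw [hC₁, costConstant]; positivity
  -- One summand for each use: the simplified bound for `r ≍ N`, the general bound, and the
  -- comparison of `T` with `log N`.
  set C := C₁ * (K * (1 + 8 * K ^ 3)) + C₁ + (18 * c + 2) with hC
  have hC0 : 0 ≤ C₁ * (K * (1 + 8 * K ^ 3)) := by positivity
  refine ⟨C, 1 / 2, by positivity, by norm_num, fun τ => ?_⟩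
  obtain ⟨N₀, hN₀⟩ := exists_threshold K (1 + (τ : ℝ) ^ 2) hK (by linarith [sq_nonneg (τ : ℝ)])
  -- The `6` comes from the injected noise. For `N < N₀` one has `D ≤ K * N₀`, so the exponential
  -- summand makes the claimed probability nonpositive.
  refine ⟨6 + Real.exp (K * N₀ / 2), N₀, by positivity, ?_⟩
  intro N L D T ν κ lam η₀ B G R σ ε δ r Γ₀ hN hL hD hT hNL hND hlam hν hκ hκ1 hκN hB hG hR hσ
    hη₁ hη₂ hΓ hε hδ hδδ hr hTr
  have := isProbabilityMeasure_sampleLaw N L T τ (noiseVar N T η₀ σ ε δ) hD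
  rcases lt_or_ge N N₀ with hNN | hNN
  · have htriv : 1 - (6 + Real.exp (K * N₀ / 2)) * Real.exp (-(1 / 2 * D)) - 4 * κ ≤ 0 := by
      have h1 : (1 : ℝ) ≤ D := by exact_mod_cast hD
      have h2 : (N : ℝ) ≤ N₀ := by exact_mod_cast hNN.le
      have h3 : (D : ℝ) ^ 2 ≤ K * N := (inv_mul_le_iff₀ hK0).mp hND.1
      have h4 : (D : ℝ) ≤ K * N₀ := by nlinarith
      have h5 : 1 ≤ Real.exp (K * N₀ / 2) * Real.exp (-(1 / 2 * D)) := by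
        rw [← Real.exp_add]
        exact Real.one_le_exp (by linarith)
      have h6 := Real.exp_pos (-(1 / 2 * (D : ℝ)))
      linarith
    exact ⟨fun _ => htriv.trans measureReal_nonneg,
      fun _ => ⟨fun h => absurd h (not_le.mpr hNN), fun _ => htriv.trans measureReal_nonneg⟩⟩
  obtain ⟨hlarge, hsmall⟩ := hN₀ N L hNN hL ((inv_mul_le_iff₀ hK0).mp hNL.1)
  have h : Regime K c N L D T ν κ lam η₀ B G R σ ε δ r :=
    { one_le_K := hK, one_lt_c := hc, N_pos := hN, L_pos := hL, D_pos := hD, T_pos := hT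
      N_L := hNL, N_D := hND, lam_comparable := hlam
      one_le_ν := by rw [hν]; linarith [sq_nonneg (τ : ℝ)]
      κ_pos := hκ, κ_lt_one := hκ1, κ_ge := hκN, B_eq := hB, G_eq := hG, R_comparable := hR
      σ_comparable := hσ, η₀_gt := hη₁, η₀_lt := hη₂, ε_pos := hε, δ_pos := hδ
      δ_lt_one := hδδ.trans_lt hδ₁, one_lt_r := hr, T_eq := hTr, N_large := hlarge
      log_small := by rw [hν]; exact hsmall }
  have hδlog : Real.log (1 / δ₁) ≤ Real.log (1 / δ) :=
    Real.log_le_log (by positivity) (one_div_le_one_div_of_le hδ hδδ)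
  have hgood : ∀ S : Set ((Fin N → Prompt L D) × Prompt L D × (Fin T → Mat D)),
      (∀ s, GoodSample B G (featureBound K N L ν) (angleBound N L D) lam η₀
        (noiseVar N T η₀ σ ε δ) s → s ∈ S) →
      1 - (6 + Real.exp (K * N₀ / 2)) * Real.exp (-(1 / 2 * D)) - 4 * κ ≤
        (sampleLaw N L D T τ (noiseVar N T η₀ σ ε δ)).real S := by
    intro S hS
    have h1 := one_sub_le_real_of_forall (sampleLaw N L D T τ (noiseVar N T η₀ σ ε δ))
      (by positivity) (h.sampleLaw_not_goodSample_le hν _) hS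
    have h2 : 0 ≤ Real.exp (K * N₀ / 2) * Real.exp (-(1 / 2 * D)) := by positivity
    have h3 : Real.exp (-((D : ℝ) / 2)) = Real.exp (-(1 / 2 * D)) := by congr 1; ring
    rw [h3] at h1
    linarith
  have hl := h.one_le_log
  have hν0 := h.ν_pos
  have hr0 : 0 < r := by linarith
  have hlr := h.log_r_pos
  have hlδ := h.log_inv_δ_pos
  refine ⟨fun hεr => hgood _ fun s hs => ?_, fun hrN => ⟨fun _ => ?_, fun hεδ =>
    hgood _ fun s hs => ?_⟩⟩
  · refine (h.costOfPrivacy_le hd hδlog hεr hΓ hs).trans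
      (mul_le_mul_of_nonneg_right ?_ (by positivity))
    linarith
  · exact h.comparable_T_log hrN (by linarith)
  · refine (h.costOfPrivacy_le hd hδlog (Or.inr hrN.2) hΓ hs).trans
      ((mul_le_mul_of_nonneg_left (h.bound_le_of_comparable hrN hεδ) hC₁0.le).trans ?_)
    rw [← mul_assoc]
    exact mul_le_mul_of_nonneg_right (by linarith) (by positivity)
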